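/- **Setting.** Let $A_\pm\ge 0$ and $V,\delta\in\mathbb R$, and let $J$ be $[0,\infty)$ or $\mathbb R$. Put $$f_\pm(x,t)=\tfrac12\big[\pm Vx+(V^2-2A_\pm^2)t\big],\qquad q_\pm(x,t)=A_\pm e^{-2if_\pm(x,t)\pm i\delta}.$$ Let $q:\mathbb R\times J\to\mathbb C$ be a bounded classical solution of the focusing NLS equation $iq_t+q_{xx}+2|q|^2q=0$ (with $q,q_x,q_{xx},q_t$ continuous on $\mathbb R\times J$). With $\sigma_3=\mathrm{diag}(1,-1)$, $\sigma_1=\begin{pmatrix}0&1\\1&0\end{pmatrix}$ and $Q=\begin{pmatrix}0&q\\-\bar q&0\end{pmatrix}$, its Lax pair is $$\phi_x=(ik\sigma_3+Q)\phi,\qquad \phi_t=\big(-2ik^2\sigma_3+i\sigma_3(Q_x-Q^2)-2kQ\big)\phi .$$ Let $\lambda_\pm(k)=((k\pm V/2)^2+A_\pm^2)^{1/2}$ with branch cut $\Sigma_\pm=\mp V/2+i[-A_\pm,A_\pm]$, continuous from the right on the cut and with $\lambda_\pm(k)\sim k$ at infinity. Put $$E_\pm=\mathrm I+\frac{iA_\pm}{\lambda_\pm+(k\pm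 V/2)}e^{\pm i\delta\sigma_3}\sigma_1,\quad d_\pm=\Big(\frac{2\lambda_\pm}{\lambda_\pm+(k\pm V/2)}\Big)^{1/2}\ \text{(principal root)},\quad \theta_\pm=\lambda_\pm\,(x-2(k\mp V/2)t),\quad \theta_o=k(x-2kt).$$ The columns $\phi_{\pm1},\phi_{\pm2}$ of the Jost solutions are the simultaneous solutions of the Lax pair such that, column by column, $\phi_\pm e^{-i\theta_\pm\sigma_3}-d_\pm^{-1}e^{-if_\pm\sigma_3}E_\pm\to0$ as $x\to\pm\infty$, for every $t\in J$. Here $\phi_{+1},\phi_{-2}$ are taken for $\operatorname{Im}k\ge0$ and $\phi_{-1},\phi_{+2}$ for $\operatorname{Im}k\le0$. With $\mathrm{Wr}[v,w]=\det(v,w)$, which does not depend on $(x,t)$ here, let $$s_{11}=\mathrm{Wr}[\phi_{-1},\phi_{+2}],\quad s_{12}=\mathrm{Wr}[\phi_{-2},\phi_{+2}],\quad s_{22}=\mathrm{Wr}[\phi_{+1},\phi_{-2}],\quad \rho=s_{12}/s_{22},$$ $$\Phi=(\phi_{+1},\phi_{-2}/s_{22})\ \text{ for } \operatorname{Im}k>0,\qquad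 \Phi=(\phi_{-1}/s_{11},\phi_{+2})\ \text{ for } \operatorname{Im}k<0,\qquad C(k)=\Phi(0,0,k).$$ Let $\Psi(x,t,k)$ be the simultaneous fundamental solution of the Lax pair with $\Psi(0,0,k)=\mathrm I$ (it is entire in $k$). Call $R>0$ admissible if the open ball $B_R=\{|k|<R\}$ contains $\Sigma_+$, $\Sigma_-$, all zeros of $s_{22}$ with $\operatorname{Im}k\ge0$ and all zeros of $s_{11}$ with $\operatorname{Im}k\le0$. For such $R$ let $\tilde\Sigma=(-\infty,-R)\cup\partial B_R\cup(R,\infty)$, where the half-lines and the two arcs of $\partial B_R$ joining $-R$ to $R$ are all oriented from left to right. Let $$\tilde M(x,t,k)=\begin{cases}\Phi(x,t,k)e^{-i\theta_o(x,t,k)\sigma_3},&k\in\mathbb C\setminus(\tilde\Sigma\cup B_R),\\ \Psi(x,t,k)e^{-i\theta_o(x,t,k)\sigma_3},&k\in B_R.\end{cases}$$ **Theorem.** Assume that $q(\cdot,t)-q_\pm(\cdot,t)\in L^1(\mathbb R^\pm)$ and $(q-q_\pm)_x(\cdot,t)\in L^1(\mathbb R^\pm)$ for every $t\in J$. Then admissible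 radii exist, and for every admissible $R$, every $x\in\mathbb R$ and every $t\in J$ the matrix $\tilde M(x,t,\cdot)$ solves the following modified Riemann–Hilbert problem: 1. $\tilde M(x,t,k)$ is analytic for $k\in\mathbb C\setminus\tilde\Sigma$; 2. at every $k\in\tilde\Sigma\setminus\{R,-R\}$ the boundary values $\tilde M^{\pm}$ from the left ($+$) and from the right ($-$) of $\tilde\Sigma$ exist, and $\tilde M^+=\tilde M^-\,e^{i\theta_o\sigma_3}\tilde J_o\,e^{-i\theta_o\sigma_3}$, where $$\tilde J_o(k)=\begin{cases}\begin{pmatrix}1&\rho(k)\\ \overline{\rho(k)}&1+|\rho(k)|^2\end{pmatrix},&k\in(-\infty,-R)\cup(R,\infty),\\[2mm] C(k),&k\in\partial B_R,\ \operatorname{Im}k>0,\\ C(k)^{-1},&k\in\partial B_R,\ \operatorname{Im}k<0;\end{cases}$$ 3. $\tilde M(x,t,k)=\mathrm I+O(1/k)$ as $k\to\infty$, $k\notin\tilde\Sigma$. -/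

import Mathlib

open Filter Topology Asymptotics Complex

noncomputable section

namespace NLSIST

/-- Complex `2 × 2` matrices. -/
abbrev Mat2 : Type := Matrix (Fin 2) (Fin 2) ℂ

/-- The data of the two background plane waves: amplitudes, velocity and phase. -/
structure Params where
  ampPlus : ℝ
  ampMinus : ℝ
  V : ℝ
  δ : ℝ

/-- The two spatial ends `x → +∞` and `x → -∞`, written as a subscript `±` below. -/
inductive SpatialEnd
  | plus
  | minus

/-- The sign `±1` of an end. -/
def SpatialEnd.sgn : SpatialEnd → ℝ
  | .plus => 1
  | .minus => -1

/-- The filter `x → ±∞`. -/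
def SpatialEnd.toFilter : SpatialEnd → Filter ℝ
  | .plus => atTop
  | .minus => atBot

/-- The half-line `ℝ^±`. -/
def SpatialEnd.halfLine : SpatialEnd → Set ℝ
  | .plus => Set.Ioi 0
  | .minus => Set.Iio 0

/-- The amplitude `A_±`. -/
def Params.amp (p : Params) : SpatialEnd → ℝ
  | .plus => p.ampPlus
  | .minus => p.ampMinus

/-- `exp (z σ₃)`. -/
def expSigma3 (z : ℂ) : Mat2 := !![exp z, 0; 0, exp (-z)]

/-! ### The background plane waves -/

/-- `f_±(x,t) = (± V x + (V² - 2 A_±²) t) / 2`. -/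
def bgPhase (p : Params) (e : SpatialEnd) (x t : ℝ) : ℝ :=
  (e.sgn * p.V * x + (p.V ^ 2 - 2 * p.amp e ^ 2) * t) / 2

/-- `q_±(x,t) = A_± exp (-2 i f_±(x,t) ± i δ)`. -/
def bgWave (p : Params) (e : SpatialEnd) (x t : ℝ) : ℂ :=
  (p.amp e : ℂ) * exp (-2 * I * (bgPhase p e x t : ℂ) + I * ((e.sgn * p.δ : ℝ) : ℂ))

/-! ### Branches of the asymptotic eigenvalues -/

/-- The argument of `z` chosen in `[-π/2, 3π/2)`. -/
def argCut (z : ℂ) : ℝ := if arg z < -(Real.pi / 2) then arg z + 2 * Real.pi else arg z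

/-- The square root of `z` with argument of `z` in `[-π/2, 3π/2)`. -/
def sqrtCut (z : ℂ) : ℂ := (Real.sqrt ‖z‖ : ℂ) * exp (I * ((argCut z / 2 : ℝ) : ℂ))

/-- `λ(k;A) = (k - iA)^{1/2} (k + iA)^{1/2}`, with branch cut `i[-A,A]`, continuous from the
right on the cut, and `λ(k;A) ~ k` at infinity. -/
def lam (A : ℝ) (k : ℂ) : ℂ := sqrtCut (k - I * (A : ℂ)) * sqrtCut (k + I * (A : ℂ))

/-- The shifted spectral parameter `k ± V/2`. -/
def kShift (p : Params) (e : SpatialEnd) (k : ℂ) : ℂ := k + ((e.sgn * p.V / 2 : ℝ) : ℂ)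

/-- `λ_±(k) = λ(k ± V/2; A_±)`. -/
def lamEnd (p : Params) (e : SpatialEnd) (k : ℂ) : ℂ := lam (p.amp e) (kShift p e k)

/-- The branch cut `Σ_± = ∓V/2 + i[-A_±, A_±]`. -/
def branchCut (p : Params) (e : SpatialEnd) : Set ℂ :=
  {k | k.re = -(e.sgn * p.V / 2) ∧ |k.im| ≤ p.amp e}

/-- `E_±(k) = I + (i A_± / (λ_± + (k ± V/2))) e^{± i δ σ₃} σ₁`. -/
def matE (p : Params) (e : SpatialEnd) (k : ℂ) : Mat2 :=
  let c : ℂ := I * (p.amp e : ℂ) / (lamEnd p e k + kShift p e k)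
  !![1, c * exp (I * ((e.sgn * p.δ : ℝ) : ℂ)); c * exp (-(I * ((e.sgn * p.δ : ℝ) : ℂ))), 1]

/-- `d_±(k) = D_±(k)^{1/2}` (principal square root), where
`D_± = det E_± = 2 λ_± / (λ_± + (k ± V/2))`. -/
def dEnd (p : Params) (e : SpatialEnd) (k : ℂ) : ℂ :=
  (2 * lamEnd p e k / (lamEnd p e k + kShift p e k)) ^ (1 / 2 : ℂ)

/-- `θ_±(x,t,k) = λ_±(k) (x - 2 (k ∓ V/2) t)`. -/
def thetaEnd (p : Params) (e : SpatialEnd) (x t : ℝ) (k : ℂ) : ℂ :=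
  lamEnd p e k * ((x : ℂ) - 2 * (k - ((e.sgn * p.V / 2 : ℝ) : ℂ)) * (t : ℂ))

/-- `θ_o(x,t,k) = k (x - 2 k t)`. -/
def thetaO (x t : ℝ) (k : ℂ) : ℂ := k * ((x : ℂ) - 2 * k * (t : ℂ))

/-! ### The focusing NLS equation and its Lax pair -/

/-- The partial derivative `q_x`. -/
def dX (q : ℝ → ℝ → ℂ) (x t : ℝ) : ℂ := deriv (fun y => q y t) x

/-- The partial derivative `q_t`, for times in `J` (one-sided at an end of `J`). -/
def dT (J : Set ℝ) (q : ℝ → ℝ → ℂ) (x t : ℝ) : ℂ := derivWithin (fun s => q x s) J t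

/-- `q` is a classical solution of `i q_t + q_xx + 2 |q|² q = 0` on `ℝ × J`: the derivatives
`q_x`, `q_xx`, `q_t` exist and are continuous on `ℝ × J`, and the equation holds. -/
structure IsClassicalNLS (J : Set ℝ) (q : ℝ → ℝ → ℂ) : Prop where
  diff_x : ∀ x, ∀ t ∈ J, DifferentiableAt ℝ (fun y => q y t) x
  diff_xx : ∀ x, ∀ t ∈ J, DifferentiableAt ℝ (fun y => dX q y t) x
  diff_t : ∀ x, ∀ t ∈ J, DifferentiableWithinAt ℝ (fun s => q x s) J t
  cont : ContinuousOn (fun z : ℝ × ℝ => q z.1 z.2) (Set.univ ×ˢ J)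
  cont_x : ContinuousOn (fun z : ℝ × ℝ => dX q z.1 z.2) (Set.univ ×ˢ J)
  cont_xx : ContinuousOn (fun z : ℝ × ℝ => dX (dX q) z.1 z.2) (Set.univ ×ˢ J)
  cont_t : ContinuousOn (fun z : ℝ × ℝ => dT J q z.1 z.2) (Set.univ ×ˢ J)
  eqn : ∀ x, ∀ t ∈ J,
    I * dT J q x t + dX (dX q) x t + 2 * ((‖q x t‖ ^ 2 : ℝ) : ℂ) * q x t = 0

/-- `σ₃`. -/
def sigma3 : Mat2 := !![1, 0; 0, -1]

/-- The matrix `((0, w), (-conj w, 0))`; it is `Q` for `w = q` and `Q_x` for `w = q_x`. -/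
def offDiag (w : ℂ) : Mat2 := !![0, w; -(starRingEnd ℂ w), 0]

/-- `X = i k σ₃ + Q`. -/
def laxX (q : ℝ → ℝ → ℂ) (k : ℂ) (x t : ℝ) : Mat2 := (I * k) • sigma3 + offDiag (q x t)

/-- `T = -2 i k² σ₃ + i σ₃ (Q_x - Q²) - 2 k Q`. -/
def laxT (q : ℝ → ℝ → ℂ) (k : ℂ) (x t : ℝ) : Mat2 :=
  (-2 * I * k ^ 2) • sigma3
    + I • (sigma3 * (offDiag (dX q x t) - offDiag (q x t) * offDiag (q x t)))
    - (2 * k) • offDiag (q x t)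

/-- The vector function `v` solves both parts `v_x = X v`, `v_t = T v` of the Lax pair
on `ℝ × J`. -/
structure IsLaxSolution (J : Set ℝ) (q : ℝ → ℝ → ℂ) (k : ℂ)
    (v : ℝ → ℝ → Fin 2 → ℂ) : Prop where
  eq_x : ∀ x, ∀ t ∈ J, HasDerivAt (fun y => v y t) ((laxX q k x t).mulVec (v x t)) x
  eq_t : ∀ x, ∀ t ∈ J, HasDerivWithinAt (fun s => v x s) ((laxT q k x t).mulVec (v x t)) J t

/-! ### Jost solutions, scattering coefficients, and the matrix `Φ` -/

/-- The sign of the exponent of `e^{i θ σ₃}` in column `j`. -/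
def colSign (j : Fin 2) : ℂ := if j = 0 then 1 else -1

/-- `v` is the column `j` of the Jost solution `φ_±(·,·,k)`: a simultaneous solution of the Lax
pair such that column `j` of `φ_± e^{-i θ_± σ₃} - d_±⁻¹ e^{-i f_± σ₃} E_±` tends to zero as
`x → ±∞`. -/
structure IsJostColumn (J : Set ℝ) (p : Params) (q : ℝ → ℝ → ℂ) (e : SpatialEnd) (j : Fin 2)
    (k : ℂ) (v : ℝ → ℝ → Fin 2 → ℂ) : Prop where
  lax : IsLaxSolution J q k v
  asymp : ∀ t ∈ J, ∀ i : Fin 2, Tendsto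
    (fun x : ℝ => exp (-(colSign j * (I * thetaEnd p e x t k))) * v x t i
      - (dEnd p e k)⁻¹ * (expSigma3 (-(I * (bgPhase p e x t : ℂ))) * matE p e k) i j)
    e.toFilter (𝓝 0)

/-- The column `j` of the Jost solution `φ_±(x,t,k)`. It is used only where the function is
determined by its defining property (for `x` real and `t` in `J`): for `Im k ≥ 0` for `φ_{+1}`
and `φ_{-2}`, and for `Im k ≤ 0` for `φ_{+2}` and `φ_{-1}`, off the branch cuts. -/
def jost (J : Set ℝ) (p : Params) (q : ℝ → ℝ → ℂ) (e : SpatialEnd) (j : Fin 2)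
    (x t : ℝ) (k : ℂ) : Fin 2 → ℂ :=
  Classical.epsilon (IsJostColumn J p q e j k) x t

/-- The Wronskian of two vectors. -/
def wr (v w : Fin 2 → ℂ) : ℂ := v 0 * w 1 - v 1 * w 0

/-- `s₁₁ = Wr[φ_{-1}, φ_{+2}]` (independent of `x` and `t`; computed at the origin). -/
def s11 (J : Set ℝ) (p : Params) (q : ℝ → ℝ → ℂ) (k : ℂ) : ℂ :=
  wr (jost J p q .minus 0 0 0 k) (jost J p q .plus 1 0 0 k)

/-- `s₁₂ = Wr[φ_{-2}, φ_{+2}]`. -/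
def s12 (J : Set ℝ) (p : Params) (q : ℝ → ℝ → ℂ) (k : ℂ) : ℂ :=
  wr (jost J p q .minus 1 0 0 k) (jost J p q .plus 1 0 0 k)

/-- `s₂₂ = Wr[φ_{+1}, φ_{-2}]`. -/
def s22 (J : Set ℝ) (p : Params) (q : ℝ → ℝ → ℂ) (k : ℂ) : ℂ :=
  wr (jost J p q .plus 0 0 0 k) (jost J p q .minus 1 0 0 k)

/-- The reflection coefficient `ρ = s₁₂ / s₂₂`. -/
def rho (J : Set ℝ) (p : Params) (q : ℝ → ℝ → ℂ) (k : ℂ) : ℂ := s12 J p q k / s22 J p q k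

/-- The matrix with the given two columns. -/
def ofCols (v w : Fin 2 → ℂ) : Mat2 := !![v 0, w 0; v 1, w 1]

/-- `Φ = (φ_{+1}, φ_{-2} / s₂₂)` in the upper and `(φ_{-1} / s₁₁, φ_{+2})` in the lower
half-plane. -/
def Phi (J : Set ℝ) (p : Params) (q : ℝ → ℝ → ℂ) (x t : ℝ) (k : ℂ) : Mat2 :=
  if 0 < k.im then
    ofCols (jost J p q .plus 0 x t k) ((s22 J p q k)⁻¹ • jost J p q .minus 1 x t k)
  else
    ofCols ((s11 J p q k)⁻¹ • jost J p q .minus 0 x t k) (jost J p q .plus 1 x t k)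

/-! ### The solution normalized at the origin -/

/-- `Ψ(·,·,k)` solves both parts of the Lax pair and equals the identity at `(0,0)`. -/
structure IsNormalizedLax (J : Set ℝ) (q : ℝ → ℝ → ℂ) (k : ℂ) (Ψ : ℝ → ℝ → Mat2) : Prop where
  lax : ∀ j : Fin 2, IsLaxSolution J q k (fun x t i => Ψ x t i j)
  init : Ψ 0 0 = 1

/-- The simultaneous fundamental solution `Ψ(x,t,k)` with `Ψ(0,0,k) = I`. -/
def Psi (J : Set ℝ) (q : ℝ → ℝ → ℂ) (x t : ℝ) (k : ℂ) : Mat2 :=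
  Classical.epsilon (IsNormalizedLax J q k) x t

/-! ### The modified Riemann-Hilbert problem -/

/-- The ball `|k| < R` contains both branch cuts and all the zeros of the analytic scattering
coefficients `s₂₂` (on the closed upper half-plane) and `s₁₁` (on the closed lower one). -/
structure IsAdmissibleRadius (J : Set ℝ) (p : Params) (q : ℝ → ℝ → ℂ) (R : ℝ) : Prop where
  pos : 0 < R
  cuts : ∀ e, branchCut p e ⊆ Metric.ball 0 R
  zeros22 : ∀ k : ℂ, 0 ≤ k.im → R ≤ ‖k‖ → s22 J p q k ≠ 0
  zeros11 : ∀ k : ℂ, k.im ≤ 0 → R ≤ ‖k‖ → s11 J p q k ≠ 0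

/-- `M̃ = Ψ e^{-i θ_o σ₃}` for `|k| < R`, and `M̃ = Φ e^{-i θ_o σ₃}` outside. -/
def Mtilde (J : Set ℝ) (p : Params) (q : ℝ → ℝ → ℂ) (R x t : ℝ) (k : ℂ) : Mat2 :=
  if ‖k‖ < R then Psi J q x t k * expSigma3 (-(I * thetaO x t k))
  else Phi J p q x t k * expSigma3 (-(I * thetaO x t k))

/-- The contour `Σ̃ = (-∞,-R) ∪ ∂B_R ∪ (R,∞)`. -/
def contour (R : ℝ) : Set ℂ := {k | ‖k‖ = R} ∪ {k | k.im = 0 ∧ R < |k.re|}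

/-- The region on the left of the contour near `k`. Both half-lines, and both arcs from `-R` to
`R`, are oriented from left to right, so the left side is the upper half-plane on the half-lines,
the outside of the circle on the upper arc, and the inside on the lower arc. -/
def leftSide (R : ℝ) (k : ℂ) : Set ℂ :=
  if ‖k‖ = R then (if 0 < k.im then {z | R < ‖z‖} else {z | ‖z‖ < R}) else {z | 0 < z.im}

/-- The region on the right of the contour near `k`. -/
def rightSide (R : ℝ) (k : ℂ) : Set ℂ :=
  if ‖k‖ = R then (if 0 < k.im then {z | ‖z‖ < R} else {z | R < ‖z‖}) else {z | z.im < 0}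

/-- The jump matrix on the real line, `J_o = ((1, ρ), (conj ρ, 1 + ρ conj ρ))`. -/
def jumpReal (J : Set ℝ) (p : Params) (q : ℝ → ℝ → ℂ) (k : ℂ) : Mat2 :=
  !![1, rho J p q k; starRingEnd ℂ (rho J p q k),
    1 + rho J p q k * starRingEnd ℂ (rho J p q k)]

/-- `J̃_o`: it is `J_o` on the half-lines, `C` on the upper and `C⁻¹` on the lower arc, where
`C(k) = Φ(0,0,k)`. -/
def jumpCore (J : Set ℝ) (p : Params) (q : ℝ → ℝ → ℂ) (R : ℝ) (k : ℂ) : Mat2 :=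
  if ‖k‖ = R then (if 0 < k.im then Phi J p q 0 0 k else (Phi J p q 0 0 k)⁻¹)
  else jumpReal J p q k

/-- `J̃ = e^{i θ_o σ₃} J̃_o e^{-i θ_o σ₃}`. -/
def jumpTilde (J : Set ℝ) (p : Params) (q : ℝ → ℝ → ℂ) (R x t : ℝ) (k : ℂ) : Mat2 :=
  expSigma3 (I * thetaO x t k) * jumpCore J p q R k * expSigma3 (-(I * thetaO x t k))

/-- `M` solves the Riemann-Hilbert problem on `contour R` with jump matrix `G`: it is analytic off
the contour, its boundary values from the two sides exist at each point other than the two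
self-intersection points `±R` and satisfy `M⁺ = M⁻ G`, and `M = I + O(1/k)` at infinity. -/
structure SolvesModifiedRHP (R : ℝ) (G M : ℂ → Mat2) : Prop where
  analytic : ∀ i j, AnalyticOnNhd ℂ (fun k => M k i j) (contour R)ᶜ
  jump : ∀ k ∈ contour R, k ≠ (R : ℂ) → k ≠ -(R : ℂ) → ∃ Mp Mm : Mat2,
    Tendsto M (𝓝[leftSide R k] k) (𝓝 Mp) ∧ Tendsto M (𝓝[rightSide R k] k) (𝓝 Mm) ∧
      Mp = Mm * G k
  normalization : ∀ i j, (fun k => M k i j - (1 : Mat2) i j)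
    =O[Bornology.cobounded ℂ ⊓ 𝓟 (contour R)ᶜ] (fun k => k⁻¹)

end NLSIST

end

/-! The jump relations are linear algebra once two families of solutions of the Lax pair are under
control.

The first is the fundamental solution Ψ. It is built by solving the t-equation along x = 0 and then
the x-equation at every fixed time. The equation for q enters only through the zero-curvature
relation (`hasDerivAt_laxT_mulVec`), which makes the result satisfy the t-equation for all x.
Differentiating in the parameter k shows that Ψ is entire (`exists_laxSolution`), and det Ψ = 1
because the Lax matrices are trace-free. Every simultaneous solution is Ψ times its value at the
origin (`IsLaxSolution.eq_Psi_mulVec`). Hence Φ = ΨC, which is the jump on the circle, and all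
dependence on k can be studied at x = t = 0.

The second is the family of Jost columns. In coordinates that diagonalize the background
(`jostCoord`) the x-equation is diagonal plus a perturbation bounded by |q - q_±|, and in the
correct half-plane the exponents have the sign for which integration from infinity is a contraction.
At t = 0, solutions matched to the background at x = ±n converge locally uniformly in k, so their
limits are analytic inside the half-plane and continuous up to its boundary off the cut
(`exists_jost_initial`). Grönwall's inequality gives uniqueness.

That the same solutions have the correct asymptotics at all other times is the delicate point
(`HasBackground.tendsto_jostPath`), because the decay of q - q_± is assumed separately at each time
and q_x need not be bounded. Three observations replace uniformity: the terms with q_x drop out of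
the t-derivative of |v|², so solutions grow in time at a rate independent of x; the t-derivative of
a suitably normalized coordinate is P_x + R with P and R decaying boundedly on finite time
intervals; and a slowly varying function that is such a derivative after integration in t must
vanish at infinity.

For large k, an integration by parts in x that uses the integrability of (q - q_±)_x gains a factor
1/k (`HasBackground.exists_norm_jostPath_sub_le`). Since θ_± - θ_o tends to f_±, the phase of the
background cancels and the limit is the identity. Consequently s₁₁ and s₂₂ tend to 1, so admissible
radii exist. On the real line, unimodularity and the conjugation symmetry of the two Jost matrices
yield the stated jump with ρ. -/

open Filter Topology Asymptotics Complex

noncomputable section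

namespace NLSIST

/-! ### Linear differential equations in Banach spaces: existence, uniqueness, dependence on a
parameter -/

section LinearODE

variable {𝕜 : Type*} [RCLike 𝕜] {E : Type*} [NormedAddCommGroup E] [NormedSpace ℝ E]
  [NormedSpace 𝕜 E]

/-- The terms of the Picard series of a linear differential equation. -/
def picardTerm (A : ℝ → E →L[𝕜] E) (w : ℝ → E) : ℕ → ℝ → E
  | 0 => w
  | n + 1 => fun x => ∫ s in (0 : ℝ)..x, A s (picardTerm A w n s)

lemma continuous_picardTerm [CompleteSpace E] {A : ℝ → E →L[𝕜] E} (hA : Continuous A)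
    {w : ℝ → E} (hw : Continuous w) (n : ℕ) : Continuous (picardTerm A w n) := by
  induction n with
  | zero => exact hw
  | succ n ih =>
    have hc : Continuous fun s => A s (picardTerm A w n s) := hA.clm_apply ih
    exact intervalIntegral.continuous_primitive (fun a b => hc.intervalIntegrable a b) 0

lemma hasDerivAt_picardTerm_succ [CompleteSpace E] {A : ℝ → E →L[𝕜] E} (hA : Continuous A)
    {w : ℝ → E} (hw : Continuous w) (n : ℕ) (x : ℝ) :
    HasDerivAt (picardTerm A w (n + 1)) (A x (picardTerm A w n x)) x := by
  have hc : Continuous fun s => A s (picardTerm A w n s) :=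
    hA.clm_apply (continuous_picardTerm hA hw n)
  exact intervalIntegral.integral_hasDerivAt_right (hc.intervalIntegrable _ _)
    (hc.stronglyMeasurableAtFilter _ _) hc.continuousAt

/-- Each integration of |s|^n gains a factor 1/(n+1). The resulting exponential majorant holds on
every bounded interval, so the Picard series gives global solutions without continuation. -/
lemma norm_picardTerm_le [CompleteSpace E] {A : ℝ → E →L[𝕜] E}
    {w : ℝ → E} {C M X : ℝ} (hC : ∀ x, |x| ≤ X → ‖A x‖ ≤ C)
    (hM : ∀ x, |x| ≤ X → ‖w x‖ ≤ M) (n : ℕ) :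
    ∀ x, |x| ≤ X → ‖picardTerm A w n x‖ ≤ M * (C * |x|) ^ n / n.factorial := by
  induction n with
  | zero => intro x hx; simpa [picardTerm] using hM x hx
  | succ n ih =>
    intro x hx
    have hC0 : 0 ≤ C := (norm_nonneg _).trans (hC x hx)
    have hsub : ∀ s ∈ Set.uIoc 0 x, |s| ≤ X := by
      intro s hs
      have : s ∈ Set.uIcc 0 x := Set.uIoc_subset_uIcc hs
      have := Set.abs_sub_left_of_mem_uIcc this
      simp at this; linarith
    have key : ‖picardTerm A w (n + 1) x‖ ≤
        |∫ s in (0 : ℝ)..x, M * C ^ (n + 1) / n.factorial * |s - 0| ^ n| := by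
      refine intervalIntegral.norm_integral_le_abs_of_norm_le ?_ ?_
      · filter_upwards [MeasureTheory.ae_restrict_mem measurableSet_uIoc] with s hs
        calc ‖A s (picardTerm A w n s)‖ ≤ ‖A s‖ * ‖picardTerm A w n s‖ := (A s).le_opNorm _
          _ ≤ C * (M * (C * |s|) ^ n / n.factorial) :=
            mul_le_mul (hC s (hsub s hs)) (ih s (hsub s hs)) (norm_nonneg _) hC0
          _ = _ := by rw [sub_zero]; ring
      · exact Continuous.intervalIntegrable (by fun_prop) _ _
    refine key.trans (le_of_eq ?_)
    have hM0 : 0 ≤ M := (norm_nonneg _).trans (hM x hx)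
    rw [intervalIntegral.integral_const_mul, abs_mul, intervalIntegral.abs_intervalIntegral_eq,
      integral_pow_abs_sub_uIoc, sub_zero, abs_of_nonneg (by positivity), abs_of_nonneg (by positivity),
      Nat.factorial_succ]
    push_cast
    field_simp
    ring

/-- Global solutions of inhomogeneous linear differential equations in Banach spaces. -/
theorem exists_affine_ode [CompleteSpace E] (A : ℝ → E →L[𝕜] E) (hA : Continuous A) (b : ℝ → E)
    (hb : Continuous b) (v0 : E) :
    ∃ v : ℝ → E, v 0 = v0 ∧ ∀ x, HasDerivAt v (A x (v x) + b x) x := by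
  -- Starting the Picard series at the primitive of `b` leaves a homogeneous iteration: all later
  -- terms vanish at 0, and each has derivative `A` applied to its predecessor.
  set w : ℝ → E := fun x => v0 + ∫ s in (0 : ℝ)..x, b s with hw
  have hwd : ∀ x, HasDerivAt w (b x) x := fun x =>
    (intervalIntegral.integral_hasDerivAt_right (hb.intervalIntegrable _ _)
      (hb.stronglyMeasurableAtFilter _ _) hb.continuousAt).const_add v0
  have hwc : Continuous w := continuous_iff_continuousAt.2 fun x => (hwd x).continuousAt
  have hz : ∀ n, picardTerm A w (n + 1) 0 = 0 := fun n => by simp [picardTerm]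
  refine ⟨fun x => w x + ∑' n, picardTerm A w (n + 1) x, ?_, fun x => ?_⟩
  · simp [hz, show w 0 = v0 by simp [hw]]
  obtain ⟨C, hC⟩ := (isCompact_Icc (a := -(|x| + 1)) (b := |x| + 1)).exists_bound_of_continuousOn
    hA.continuousOn
  obtain ⟨M, hM⟩ := (isCompact_Icc (a := -(|x| + 1)) (b := |x| + 1)).exists_bound_of_continuousOn
    hwc.continuousOn
  have hC' : ∀ y, |y| ≤ |x| + 1 → ‖A y‖ ≤ C := fun y hy => hC y (abs_le.1 hy)
  have hM' : ∀ y, |y| ≤ |x| + 1 → ‖w y‖ ≤ M := fun y hy => hM y (abs_le.1 hy)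
  have h0 : |(0 : ℝ)| ≤ |x| + 1 := by simp; positivity
  have hC0 : 0 ≤ C := (norm_nonneg _).trans (hC' 0 h0)
  have hM0 : 0 ≤ M := (norm_nonneg _).trans (hM' 0 h0)
  have hbd : ∀ n y, |y| ≤ |x| + 1 →
      ‖picardTerm A w n y‖ ≤ M * ((C * (|x| + 1)) ^ n / n.factorial) := by
    intro n y hy
    refine (norm_picardTerm_le hC' hM' n y hy).trans ?_
    rw [mul_div_assoc]
    gcongr
  have hsum : Summable fun n : ℕ => M * ((C * (|x| + 1)) ^ n / n.factorial) :=
    (Real.summable_pow_div_factorial _).mul_left M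
  -- Termwise differentiation shifts the index by one, so the derivatives sum to `A` applied to the
  -- whole series including `w`; the derivative of `w` itself supplies `b`.
  have hderiv := hasDerivAt_tsum_of_isPreconnected (𝕜 := ℝ)
    (g := fun n y => picardTerm A w (n + 1) y) (g' := fun n y => A y (picardTerm A w n y))
    (t := Set.Ioo (-(|x| + 1)) (|x| + 1)) (y₀ := 0) (y := x) (hsum.mul_left C) isOpen_Ioo
    isPreconnected_Ioo (fun n y _ => hasDerivAt_picardTerm_succ hA hwc n y)
    (fun n y hy => ((A y).le_opNorm _).trans
      (mul_le_mul (hC' y (abs_le.2 ⟨hy.1.le, hy.2.le⟩)) (hbd n y (abs_le.2 ⟨hy.1.le, hy.2.le⟩))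
        (norm_nonneg _) hC0))
    (by constructor <;> linarith [abs_nonneg x]) (by simp [hz])
    (by constructor <;> linarith [neg_abs_le x, le_abs_self x])
  have hs : Summable fun n => picardTerm A w n x :=
    .of_norm_bounded hsum fun n => hbd n x (by linarith)
  have := (hwd x).add hderiv
  refine this.congr_deriv ?_
  rw [← (A x).map_tsum hs, hs.tsum_eq_zero_add]
  simp [picardTerm, add_comm]

/-- A two-sided Grönwall inequality. -/
lemma norm_le_of_norm_deriv_le {v v' : ℝ → E} {K ε X : ℝ} (hK : 0 ≤ K) (hε : 0 ≤ ε)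
    (hv : ∀ x, |x| ≤ X → HasDerivAt v (v' x) x)
    (hb : ∀ x, |x| ≤ X → ‖v' x‖ ≤ K * ‖v x‖ + ε) :
    ∀ x, |x| ≤ X → ‖v x‖ ≤ (‖v 0‖ + ε * X) * Real.exp (K * X) := by
  have hg : ∀ x, 0 ≤ x → x ≤ X →
      gronwallBound ‖v 0‖ K ε x ≤ (‖v 0‖ + ε * X) * Real.exp (K * X) := by
    intro x hx hxX
    have h1 : gronwallBound ‖v 0‖ K ε x ≤ (‖v 0‖ + ε * x) * Real.exp (K * x) := by
      rcases hK.eq_or_lt with rfl | hK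
      · simp [gronwallBound_K0]
      · rw [gronwallBound_of_K_ne_0 hK.ne', add_mul]
        -- The inequality e^s - 1 ≤ s e^s removes the division by `K`, so that the final bound also
        -- covers `K = 0`.
        have h2 := Real.add_one_le_exp (-(K * x))
        have h3 : Real.exp (K * x) - 1 ≤ K * x * Real.exp (K * x) := by
          have h5 : Real.exp (-(K * x)) * Real.exp (K * x) = 1 := by
            rw [← Real.exp_add]; simp
          nlinarith [Real.exp_pos (K * x)]
        have h4 : ε / K * (Real.exp (K * x) - 1) ≤ ε / K * (K * x * Real.exp (K * x)) := by
          gcongr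
        have h5 : ε / K * (K * x * Real.exp (K * x)) = ε * x * Real.exp (K * x) := by
          field_simp
        linarith
    have hX0 : 0 ≤ X := hx.trans hxX
    refine h1.trans ?_
    gcongr
  have fwd : ∀ (u u' : ℝ → E), (∀ x, 0 ≤ x → x ≤ X → HasDerivAt u (u' x) x) →
      (∀ x, 0 ≤ x → x ≤ X → ‖u' x‖ ≤ K * ‖u x‖ + ε) →
      ∀ x, 0 ≤ x → x ≤ X → ‖u x‖ ≤ gronwallBound ‖u 0‖ K ε x := by
    intro u u' hu hub x hx hxX
    have := norm_le_gronwallBound_of_norm_deriv_right_le (f := u) (f' := u') (δ := ‖u 0‖) (K := K)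
      (ε := ε) (a := 0) (b := X) (fun y hy => (hu y hy.1 hy.2).continuousAt.continuousWithinAt)
      (fun y hy => (hu y hy.1 hy.2.le).hasDerivWithinAt) le_rfl
      (fun y hy => hub y hy.1 hy.2.le) x ⟨hx, hxX⟩
    simpa using this
  intro x hx
  rcases le_total 0 x with h | h
  · rw [abs_of_nonneg h] at hx
    exact (fwd v v' (fun y hy hyX => hv y (by rwa [abs_of_nonneg hy]))
      (fun y hy hyX => hb y (by rwa [abs_of_nonneg hy])) x h hx).trans (hg x h hx)
  · rw [abs_of_nonpos h] at hx
    have := fwd (fun y => v (-y)) (fun y => -v' (-y))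
      (fun y hy hyX => by
        have := (hv (-y) (by rwa [abs_neg, abs_of_nonneg hy])).scomp y (hasDerivAt_neg y)
        simpa [Function.comp_def] using this)
      (fun y hy hyX => by
        rw [norm_neg]; exact hb (-y) (by rwa [abs_neg, abs_of_nonneg hy])) (-x) (by linarith) hx
    simp only [neg_neg, neg_zero] at this
    exact this.trans (hg (-x) (by linarith) hx)

/-- Uniqueness for linear differential equations. -/
lemma linear_ode_unique {A : ℝ → E →L[𝕜] E} (hA : Continuous A) {v w : ℝ → E}
    (hv : ∀ x, HasDerivAt v (A x (v x)) x) (hw : ∀ x, HasDerivAt w (A x (w x)) x)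
    (h0 : v 0 = w 0) : v = w := by
  funext x
  obtain ⟨C, hC⟩ := (isCompact_Icc (a := -|x|) (b := |x|)).exists_bound_of_continuousOn
    hA.continuousOn
  have hC0 : 0 ≤ C := (norm_nonneg _).trans (hC 0 (by simp))
  have := norm_le_of_norm_deriv_le (v := fun y => v y - w y) (K := C) (ε := 0) (X := |x|) hC0 le_rfl
    (fun y _ => (hv y).sub (hw y)) (fun y hy => by
      rw [← map_sub, add_zero]
      exact ((A y).le_opNorm _).trans (by gcongr; exact hC y (abs_le.1 hy))) x le_rfl
  simp only [h0, sub_self, norm_zero, zero_mul, add_zero] at this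
  exact sub_eq_zero.1 (norm_le_zero_iff.1 this)

/-- Differentiability of the solution of a linear differential equation in a parameter: the
derivative is the solution of the variational equation. -/
theorem hasDerivWithinAt_ode_param [SMulCommClass ℝ 𝕜 E] {S : Set 𝕜} {s0 : 𝕜}
    {A : ℝ → 𝕜 → E →L[𝕜] E} {A' : ℝ → E →L[𝕜] E}
    (hA0 : Continuous fun x => A x s0) (hA' : Continuous A')
    (hdiff : ∀ X ε : ℝ, 0 < ε → ∀ᶠ s in 𝓝[S] s0, ∀ x, |x| ≤ X →
      ‖A x s - A x s0 - (s - s0) • A' x‖ ≤ ε * ‖s - s0‖)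
    {Y : ℝ → 𝕜 → E} (hY0 : ∀ x, HasDerivAt (fun y => Y y s0) (A x s0 (Y x s0)) x)
    (hY : ∀ᶠ s in 𝓝[S] s0, ∀ x, HasDerivAt (fun y => Y y s) (A x s (Y x s)) x)
    {G : ℝ → E} (hG : ∀ x, HasDerivAt G (A x s0 (G x) + A' x (Y x s0)) x)
    (hinit : HasDerivWithinAt (Y 0) (G 0) S s0) (x : ℝ) :
    HasDerivWithinAt (Y x) (G x) S s0 := by
  set X := |x| with hX
  have hX0 : 0 ≤ X := abs_nonneg x
  have h00 : |(0 : ℝ)| ≤ X := by simpa using hX0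
  obtain ⟨C, hC⟩ := (isCompact_Icc (a := -X) (b := X)).exists_bound_of_continuousOn
    hA0.continuousOn
  obtain ⟨D, hD⟩ := (isCompact_Icc (a := -X) (b := X)).exists_bound_of_continuousOn
    hA'.continuousOn
  obtain ⟨M, hM⟩ := (isCompact_Icc (a := -X) (b := X)).exists_bound_of_continuousOn
    (f := fun y => Y y s0) (fun y _ => (hY0 y).continuousAt.continuousWithinAt)
  replace hC : ∀ y, |y| ≤ X → ‖A y s0‖ ≤ C := fun y hy => hC y (abs_le.1 hy)
  replace hD : ∀ y, |y| ≤ X → ‖A' y‖ ≤ D := fun y hy => hD y (abs_le.1 hy)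
  replace hM : ∀ y, |y| ≤ X → ‖Y y s0‖ ≤ M := fun y hy => hM y (abs_le.1 hy)
  have hC0 : 0 ≤ C := (norm_nonneg _).trans (hC 0 h00)
  have hD0 : 0 ≤ D := (norm_nonneg _).trans (hD 0 h00)
  have hM0 : 0 ≤ M := (norm_nonneg _).trans (hM 0 h00)
  -- For s within distance 1 of s0, `C1` bounds the operators A(·, s), and `K1` is the resulting
  -- Grönwall constant in ‖Y y s - Y y s0‖ ≤ K1 ‖s - s0‖.
  set C1 := C + (D + 1) with hC1
  have hC10 : 0 ≤ C1 := by positivity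
  set K1 := (‖G 0‖ + 1 + (D + 1) * M * X) * Real.exp (C1 * X) with hK1
  have hK10 : 0 ≤ K1 := by positivity
  rw [hasDerivWithinAt_iff_isLittleO] at hinit ⊢
  rw [isLittleO_iff] at hinit ⊢
  intro c hc
  -- `Z` is the constant of the second Grönwall estimate below, so ε = c/Z makes the remainder at
  -- most c ‖s - s0‖.
  set Z := (1 + (M + K1 + D * K1) * X) * Real.exp (C * X) with hZ
  have hZ0 : 0 < Z := by positivity
  set ε := c / Z with hε
  have hε0 : 0 < ε := by positivity
  have hball : ∀ᶠ s in 𝓝[S] s0, ‖s - s0‖ ≤ min ε 1 := by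
    have : Tendsto (fun s : 𝕜 => ‖s - s0‖) (𝓝[S] s0) (𝓝 0) := by
      have : ContinuousAt (fun s : 𝕜 => ‖s - s0‖) s0 := by fun_prop
      have h2 := this.tendsto
      simp only [sub_self, norm_zero] at h2
      exact h2.mono_left nhdsWithin_le_nhds
    exact (this.eventually (gt_mem_nhds (show (0 : ℝ) < min ε 1 by positivity))).mono
      fun s hs => le_of_lt hs
  filter_upwards [hball, hinit hε0, hinit one_pos, hdiff X ε hε0, hdiff X 1 one_pos, hY]
    with s hs hi hi1 hd hd1 hYs
  set σ := ‖s - s0‖ with hσ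
  have hσ0 : 0 ≤ σ := norm_nonneg _
  have hσε : σ ≤ ε := hs.trans (min_le_left _ _)
  have hσ1 : σ ≤ 1 := hs.trans (min_le_right _ _)
  have hAd : ∀ y, |y| ≤ X → ‖A y s - A y s0‖ ≤ (D + 1) * σ := by
    intro y hy
    calc ‖A y s - A y s0‖ = ‖(A y s - A y s0 - (s - s0) • A' y) + (s - s0) • A' y‖ := by
          rw [sub_add_cancel]
      _ ≤ 1 * σ + σ * D := by
          refine (norm_add_le _ _).trans (add_le_add (hd1 y hy) ?_)
          rw [norm_smul]; gcongr; exact hD y hy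
      _ = _ := by ring
  have hΔ0 : ‖Y 0 s - Y 0 s0‖ ≤ (‖G 0‖ + 1) * σ := by
    calc ‖Y 0 s - Y 0 s0‖ = ‖(Y 0 s - Y 0 s0 - (s - s0) • G 0) + (s - s0) • G 0‖ := by
          rw [sub_add_cancel]
      _ ≤ 1 * σ + σ * ‖G 0‖ := (norm_add_le _ _).trans (add_le_add hi1 (norm_smul_le _ _))
      _ = _ := by ring
  -- First pass: Y is Lipschitz in the parameter at s0. The second pass feeds this into the equation
  -- of the first-order remainder, whose inhomogeneity is then o(‖s - s0‖).
  have hΔ : ∀ y, |y| ≤ X → ‖Y y s - Y y s0‖ ≤ K1 * σ := by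
    intro y hy
    have := norm_le_of_norm_deriv_le (v := fun y => Y y s - Y y s0)
      (K := C1) (ε := (D + 1) * σ * M) (X := X) hC10 (by positivity)
      (fun y _ => (hYs y).sub (hY0 y)) (fun y hy => by
        have e : A y s (Y y s) - A y s0 (Y y s0) =
            A y s (Y y s - Y y s0) + (A y s - A y s0) (Y y s0) := by
          simp [map_sub]
        rw [e]
        have h1 : ‖A y s‖ ≤ C1 := by
          calc ‖A y s‖ = ‖A y s0 + (A y s - A y s0)‖ := by rw [add_sub_cancel]
            _ ≤ C + (D + 1) * σ := (norm_add_le _ _).trans (add_le_add (hC y hy) (hAd y hy))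
            _ ≤ C + (D + 1) * 1 := by gcongr
            _ = C1 := by rw [hC1]; ring
        refine (norm_add_le _ _).trans (add_le_add ?_ ?_)
        · exact ((A y s).le_opNorm _).trans (by gcongr)
        · exact ((A y s - A y s0).le_opNorm _).trans
            (mul_le_mul (hAd y hy) (hM y hy) (norm_nonneg _) (by positivity))) y hy
    refine this.trans ?_
    calc (‖Y 0 s - Y 0 s0‖ + (D + 1) * σ * M * X) * Real.exp (C1 * X)
        ≤ ((‖G 0‖ + 1) * σ + (D + 1) * σ * M * X) * Real.exp (C1 * X) := by gcongr
      _ = K1 * σ := by rw [hK1]; ring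
  have hR := norm_le_of_norm_deriv_le (v := fun y => Y y s - Y y s0 - (s - s0) • G y)
      (K := C) (ε := ε * σ * (M + K1 + D * K1)) (X := X) hC0 (by positivity)
      (fun y _ => ((hYs y).sub (hY0 y)).sub ((hG y).const_smul (s - s0))) (fun y hy => by
        have e : A y s (Y y s) - A y s0 (Y y s0) - (s - s0) • (A y s0 (G y) + A' y (Y y s0)) =
            A y s0 (Y y s - Y y s0 - (s - s0) • G y) +
            ((A y s - A y s0 - (s - s0) • A' y) (Y y s) + (s - s0) • A' y (Y y s - Y y s0)) := by
          simp only [map_sub, map_smul, sub_apply,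
            smul_apply, smul_add, smul_sub]
          abel
        rw [e]
        have hYb : ‖Y y s‖ ≤ M + K1 := by
          calc ‖Y y s‖ = ‖Y y s0 + (Y y s - Y y s0)‖ := by rw [add_sub_cancel]
            _ ≤ M + K1 * σ := (norm_add_le _ _).trans (add_le_add (hM y hy) (hΔ y hy))
            _ ≤ M + K1 * 1 := by gcongr
            _ = M + K1 := by ring
        have h2 : ‖(A y s - A y s0 - (s - s0) • A' y) (Y y s)‖ ≤ ε * σ * (M + K1) :=
          (ContinuousLinearMap.le_opNorm _ _).trans
            (mul_le_mul (hd y hy) hYb (norm_nonneg _) (by positivity))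
        have h3 : ‖(s - s0) • A' y (Y y s - Y y s0)‖ ≤ σ * (D * (K1 * σ)) := by
          rw [norm_smul]
          gcongr
          exact ((A' y).le_opNorm _).trans
            (mul_le_mul (hD y hy) (hΔ y hy) (norm_nonneg _) hD0)
        have h4 : σ * (D * (K1 * σ)) ≤ ε * σ * (D * K1) := by
          have : σ * (σ * (D * K1)) ≤ ε * (σ * (D * K1)) := by gcongr
          linarith
        refine (norm_add_le _ _).trans (add_le_add ((A y s0).le_opNorm _ |>.trans ?_) ?_)
        · gcongr; exact hC y hy
        · refine (norm_add_le _ _).trans ?_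
          calc _ ≤ ε * σ * (M + K1) + ε * σ * (D * K1) := add_le_add h2 (h3.trans h4)
            _ = _ := by ring) x le_rfl
  refine hR.trans ?_
  calc (‖Y 0 s - Y 0 s0 - (s - s0) • G 0‖ + ε * σ * (M + K1 + D * K1) * X) * Real.exp (C * X)
      ≤ (ε * σ + ε * σ * (M + K1 + D * K1) * X) * Real.exp (C * X) := by gcongr
    _ = ε * Z * σ := by rw [hZ]; ring
    _ = c * σ := by rw [hε, div_mul_cancel₀ _ hZ0.ne']

end LinearODE

/-! ### The branch of the square root -/

lemma sqrtCut_sq (z : ℂ) : sqrtCut z ^ 2 = z := by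
  have h1 : exp (I * ((argCut z / 2 : ℝ) : ℂ)) ^ 2 = exp (arg z * I) := by
    rw [← Complex.exp_nat_mul]
    unfold argCut
    split_ifs with h
    · rw [← Complex.exp_periodic (arg z * I)]
      congr 1; push_cast; ring
    · congr 1; push_cast; ring
  have h2 : ((Real.sqrt ‖z‖ : ℝ) : ℂ) ^ 2 = ‖z‖ := by
    rw [← ofReal_pow, Real.sq_sqrt (norm_nonneg _)]
  rw [sqrtCut, mul_pow, h1, h2, Complex.norm_mul_exp_arg_mul_I]

/-- The sign is governed by half the difference of the chosen arguments: it is positive as soon as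
they differ by less than π. -/
lemma re_sqrtCut_mul_conj (a b : ℂ) :
    (sqrtCut a * starRingEnd ℂ (sqrtCut b)).re =
      Real.sqrt ‖a‖ * Real.sqrt ‖b‖ * Real.cos ((argCut a - argCut b) / 2) := by
  have h : sqrtCut a * starRingEnd ℂ (sqrtCut b) =
      ((Real.sqrt ‖a‖ * Real.sqrt ‖b‖ : ℝ) : ℂ) * exp ((((argCut a - argCut b) / 2 : ℝ) : ℂ) * I) := by
    rw [sqrtCut, sqrtCut, map_mul, ← Complex.exp_conj, map_mul, conj_ofReal, conj_ofReal, conj_I]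
    rw [show (((argCut a - argCut b) / 2 : ℝ) : ℂ) * I = I * ((argCut a / 2 : ℝ) : ℂ) +
      -I * ((argCut b / 2 : ℝ) : ℂ) by push_cast; ring, Complex.exp_add]
    push_cast; ring
  rw [h, re_ofReal_mul, exp_ofReal_mul_I_re]

lemma argCut_mem_of_re_pos {z : ℂ} (h : 0 < z.re) : |argCut z| < Real.pi / 2 := by
  have h1 : |arg z| < Real.pi / 2 := abs_arg_lt_pi_div_two_iff.2 (Or.inl h)
  rw [argCut, if_neg (by have := abs_lt.1 h1; linarith)]
  exact h1

lemma argCut_mem_of_re_neg {z : ℂ} (h : z.re < 0) : |argCut z - Real.pi| < Real.pi / 2 := by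
  have h1 : ¬ |arg z| ≤ Real.pi / 2 := by
    rw [abs_arg_le_pi_div_two_iff]; linarith
  have h2 := neg_pi_lt_arg z
  have h3 := arg_le_pi z
  rw [abs_le, not_and_or] at h1
  rw [argCut]
  split_ifs with h4
  · rw [abs_lt]; constructor <;> linarith
  · rcases h1 with h1 | h1
    · exact absurd (not_le.1 h1) h4
    · rw [abs_lt]; constructor <;> linarith [not_le.1 h1]

lemma lam_sq (A : ℝ) (k : ℂ) : lam A k ^ 2 = k ^ 2 + A ^ 2 := by
  rw [lam, mul_pow, sqrtCut_sq, sqrtCut_sq]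
  ring_nf
  rw [I_sq]; ring

/-- Off the branch cut, `lam A k` lies in the open half-plane centred at the direction of `k`. -/
lemma re_lam_mul_conj_pos {A : ℝ} {k : ℂ} (hA : 0 ≤ A) (hk : ¬ (k.re = 0 ∧ |k.im| ≤ A)) :
    0 < (lam A k * starRingEnd ℂ k).re := by
  set a := k - I * A with ha
  set b := k + I * A with hb
  have hare : a.re = k.re := by simp [ha]
  have hbre : b.re = k.re := by simp [hb]
  have haim : a.im = k.im - A := by simp [ha]
  have hbim : b.im = k.im + A := by simp [hb]
  have ha0 : a ≠ 0 := by
    intro h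
    rw [h] at hare haim
    simp only [zero_re, zero_im] at hare haim
    exact hk ⟨hare.symm, by rw [show k.im = A by linarith, abs_of_nonneg hA]⟩
  have hb0 : b ≠ 0 := by
    intro h
    rw [h] at hbre hbim
    simp only [zero_re, zero_im] at hbre hbim
    exact hk ⟨hbre.symm, by rw [show k.im = -A by linarith, abs_neg, abs_of_nonneg hA]⟩
  -- Both points lie on the vertical line through k. Off the imaginary axis their arguments fall in
  -- a common open interval of length π, around 0 or around π; on the axis beyond the cut they
  -- coincide.
  have hang : |argCut a - argCut b| < Real.pi := by
    rcases lt_trichotomy k.re 0 with h | h | h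
    · have h1 := argCut_mem_of_re_neg (z := a) (by rwa [hare])
      have h2 := argCut_mem_of_re_neg (z := b) (by rwa [hbre])
      rw [abs_lt] at *
      constructor <;> linarith [h1.1, h1.2, h2.1, h2.2]
    · have h3 : argCut a = argCut b := by
        have him : A < |k.im| := by
          by_contra hc
          exact hk ⟨h, not_lt.1 hc⟩
        have key : arg a = arg b := by
          rcases le_total 0 k.im with h0 | h0
          · rw [abs_of_nonneg h0] at him
            rw [arg_eq_pi_div_two_iff.2 ⟨by rw [hare, h], by rw [haim]; linarith⟩,
              arg_eq_pi_div_two_iff.2 ⟨by rw [hbre, h], by rw [hbim]; linarith⟩]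
          · rw [abs_of_nonpos h0] at him
            rw [arg_eq_neg_pi_div_two_iff.2 ⟨by rw [hare, h], by rw [haim]; linarith⟩,
              arg_eq_neg_pi_div_two_iff.2 ⟨by rw [hbre, h], by rw [hbim]; linarith⟩]
        rw [argCut, argCut, key]
      rw [h3, sub_self, abs_zero]; exact Real.pi_pos
    · have h1 := argCut_mem_of_re_pos (z := a) (by rwa [hare])
      have h2 := argCut_mem_of_re_pos (z := b) (by rwa [hbre])
      rw [abs_lt] at *
      constructor <;> linarith [h1.1, h1.2, h2.1, h2.2]
  have hpos : 0 < (sqrtCut a * starRingEnd ℂ (sqrtCut b)).re := by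
    rw [re_sqrtCut_mul_conj]
    have h1 : 0 < Real.sqrt ‖a‖ := Real.sqrt_pos.2 (norm_pos_iff.2 ha0)
    have h2 : 0 < Real.sqrt ‖b‖ := Real.sqrt_pos.2 (norm_pos_iff.2 hb0)
    have h3 : 0 < Real.cos ((argCut a - argCut b) / 2) := by
      apply Real.cos_pos_of_mem_Ioo
      rw [abs_lt] at hang
      constructor <;> linarith [hang.1, hang.2]
    positivity
  -- With u² = a and v² = b one has 2k = u² + v², whence Re(uv k̄) = (|u|² + |v|²)/2 · Re(u v̄).
  have hk2 : k = (sqrtCut a ^ 2 + sqrtCut b ^ 2) / 2 := by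
    rw [sqrtCut_sq, sqrtCut_sq, ha, hb]; ring
  have hla : lam A k = sqrtCut a * sqrtCut b := rfl
  rw [hla]
  set u := sqrtCut a
  set v := sqrtCut b
  rw [hk2]
  have hu : 0 < normSq u := by
    rw [normSq_pos]; intro h; rw [h] at hpos; simp at hpos
  have e : (u * v * starRingEnd ℂ ((u ^ 2 + v ^ 2) / 2)).re =
      (normSq u + normSq v) / 2 * (u * starRingEnd ℂ v).re := by
    rw [show starRingEnd ℂ ((u ^ 2 + v ^ 2) / 2) = (starRingEnd ℂ u ^ 2 + starRingEnd ℂ v ^ 2) / 2 by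
      simp [map_ofNat]]
    have h2 : ((2 : ℝ) : ℂ) = 2 := by norm_num
    rw [← h2, ← mul_div_assoc, div_ofReal_re]
    simp [pow_two, normSq_apply]
    ring
  rw [e]
  have := normSq_nonneg v
  positivity

lemma lam_ne_zero {A : ℝ} {k : ℂ} (hA : 0 ≤ A) (hk : ¬ (k.re = 0 ∧ |k.im| ≤ A)) :
    lam A k ≠ 0 := by
  intro h
  have := re_lam_mul_conj_pos hA hk
  simp [h] at this

/-- The two candidate roots are opposite, and positivity of the real part excludes one of them. This
characterizes the branch without reference to arguments. -/
lemma lam_unique {A : ℝ} {k z : ℂ} (hA : 0 ≤ A) (hk : ¬ (k.re = 0 ∧ |k.im| ≤ A))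
    (hz : z ^ 2 = k ^ 2 + A ^ 2) (hpos : 0 < (z * starRingEnd ℂ k).re) : lam A k = z := by
  have h1 := re_lam_mul_conj_pos hA hk
  have h2 : lam A k ^ 2 = z ^ 2 := by rw [lam_sq, hz]
  rcases sq_eq_sq_iff_eq_or_eq_neg.1 h2 with h | h
  · exact h
  · rw [h, neg_mul, neg_re] at h1
    linarith

lemma lam_conj {A : ℝ} {k : ℂ} (hA : 0 ≤ A) (hk : ¬ (k.re = 0 ∧ |k.im| ≤ A)) :
    lam A (starRingEnd ℂ k) = starRingEnd ℂ (lam A k) := by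
  refine lam_unique hA (by simpa using hk) ?_ ?_
  · rw [← map_pow, lam_sq]; simp
  · have := re_lam_mul_conj_pos hA hk
    rw [← map_mul, conj_re]
    exact this

lemma sq_mem_slitPlane {z : ℂ} (hz : 0 < z.re) : z ^ 2 ∈ slitPlane := by
  rw [mem_slitPlane_iff]
  by_cases h : z.im = 0
  · left; simp [pow_two, h]; positivity
  · right; simp only [pow_two, mul_im]; intro h'
    have : z.re * z.im = 0 := by linarith
    rcases mul_eq_zero.1 this with h2 | h2
    · exact hz.ne' h2
    · exact h h2

lemma isClosed_cut (A : ℝ) : IsClosed {k : ℂ | k.re = 0 ∧ |k.im| ≤ A} :=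
  (isClosed_eq continuous_re continuous_const).inter
    (isClosed_le (continuous_abs.comp continuous_im) continuous_const)

/-- Off the cut the quotient λ/w lies in the right half-plane and squares to 1 + A²/w². So λ is w
times a principal square root whose argument avoids the negative axis. -/
lemma differentiableAt_lam {A : ℝ} {k : ℂ} (hA : 0 ≤ A) (hk : ¬ (k.re = 0 ∧ |k.im| ≤ A)) :
    DifferentiableAt ℂ (lam A) k := by
  have key : ∀ w : ℂ, ¬ (w.re = 0 ∧ |w.im| ≤ A) → w ≠ 0 ∧ 0 < (lam A w / w).re ∧
      1 + (A : ℂ) ^ 2 / w ^ 2 = (lam A w / w) ^ 2 := by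
    intro w hw
    have hw0 : w ≠ 0 := by
      rintro rfl; exact hw ⟨rfl, by simpa using hA⟩
    refine ⟨hw0, ?_, ?_⟩
    · have := re_lam_mul_conj_pos hA hw
      rw [div_eq_mul_inv, inv_def, ← mul_assoc, re_mul_ofReal]
      exact mul_pos this (inv_pos.2 (normSq_pos.2 hw0))
    · rw [div_pow, lam_sq]; field_simp
  have hform : ∀ᶠ w in 𝓝 k, lam A w = w * (1 + (A : ℂ) ^ 2 / w ^ 2) ^ (2⁻¹ : ℂ) := by
    filter_upwards [(isClosed_cut A).isOpen_compl.mem_nhds hk] with w hw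
    obtain ⟨h0, h1, h2⟩ := key w hw
    rw [h2, sq_cpow_two_inv h1]; field_simp
  refine DifferentiableAt.congr_of_eventuallyEq ?_ hform
  obtain ⟨h0, h1, h2⟩ := key k hk
  refine differentiableAt_id.mul (DifferentiableAt.cpow_const ?_ ?_)
  · exact (differentiableAt_const _).add
      ((differentiableAt_const _).div (differentiableAt_id.pow 2) (pow_ne_zero 2 h0))
  · rw [h2]; exact sq_mem_slitPlane h1

/-! ### The coefficients of the asymptotic matrices -/

section Coefficients

variable {p : Params} {e : SpatialEnd} {k : ℂ}

/-- The amplitudes are nonnegative. -/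
def Params.AmpNonneg (p : Params) : Prop := ∀ e, 0 ≤ p.amp e

/-- The off-diagonal coefficient `i A_± / (λ_± + (k ± V/2))` of `E_±`. -/
def cEnd (p : Params) (e : SpatialEnd) (k : ℂ) : ℂ :=
  I * (p.amp e : ℂ) / (lamEnd p e k + kShift p e k)

/-- The phase factor `e^{± i δ}`. -/
def epsEnd (p : Params) (e : SpatialEnd) : ℂ := exp (I * ((e.sgn * p.δ : ℝ) : ℂ))

/-- `D_± = det E_±`. -/
def detE (p : Params) (e : SpatialEnd) (k : ℂ) : ℂ :=
  2 * lamEnd p e k / (lamEnd p e k + kShift p e k)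

lemma matE_eq : matE p e k = !![1, cEnd p e k * epsEnd p e; cEnd p e k * (epsEnd p e)⁻¹, 1] := by
  simp only [matE, cEnd, epsEnd, Complex.exp_neg]

lemma epsEnd_ne_zero : epsEnd p e ≠ 0 := exp_ne_zero _

lemma norm_epsEnd : ‖epsEnd p e‖ = 1 := by
  rw [epsEnd, mul_comm, norm_exp_ofReal_mul_I]

lemma conj_epsEnd : starRingEnd ℂ (epsEnd p e) = (epsEnd p e)⁻¹ := by
  rw [epsEnd, ← exp_conj, ← Complex.exp_neg]; simp

lemma kShift_re : (kShift p e k).re = k.re + e.sgn * p.V / 2 := by simp [kShift]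

lemma kShift_im : (kShift p e k).im = k.im := by
  rw [kShift, add_im, ofReal_im, add_zero]

lemma not_mem_branchCut (hk : k ∉ branchCut p e) :
    ¬ ((kShift p e k).re = 0 ∧ |(kShift p e k).im| ≤ p.amp e) := by
  rw [kShift_re, kShift_im]
  intro h
  exact hk ⟨by linarith [h.1], h.2⟩

lemma isClosed_branchCut : IsClosed (branchCut p e) :=
  (isClosed_eq continuous_re continuous_const).inter
    (isClosed_le (continuous_abs.comp continuous_im) continuous_const)

lemma lamEnd_sq : lamEnd p e k ^ 2 = kShift p e k ^ 2 + (p.amp e : ℂ) ^ 2 := lam_sq _ _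

variable (hA : p.AmpNonneg) (hk : k ∉ branchCut p e)
include hA hk

lemma re_lamEnd_mul_conj_pos : 0 < (lamEnd p e k * starRingEnd ℂ (kShift p e k)).re :=
  re_lam_mul_conj_pos (hA e) (not_mem_branchCut hk)

lemma lamEnd_ne_zero : lamEnd p e k ≠ 0 := lam_ne_zero (hA e) (not_mem_branchCut hk)

lemma kShift_ne_zero : kShift p e k ≠ 0 := by
  intro h
  have := re_lamEnd_mul_conj_pos hA hk
  simp [h] at this

/-- Expanding |λ + κ|², the cross term is 2 Re(λ κ̄) > 0. This lower bound underlies all size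
estimates of the background coefficients. -/
lemma norm_kShift_le : ‖kShift p e k‖ ≤ ‖lamEnd p e k + kShift p e k‖ := by
  have h := re_lamEnd_mul_conj_pos hA hk
  rw [← sq_le_sq₀ (norm_nonneg _) (norm_nonneg _), ← normSq_eq_norm_sq, ← normSq_eq_norm_sq,
    normSq_add]
  have := normSq_nonneg (lamEnd p e k)
  linarith

lemma norm_lamEnd_sub_le :
    ‖lamEnd p e k - kShift p e k‖ ≤ ‖lamEnd p e k + kShift p e k‖ := by
  have h := re_lamEnd_mul_conj_pos hA hk
  rw [← sq_le_sq₀ (norm_nonneg _) (norm_nonneg _), ← normSq_eq_norm_sq, ← normSq_eq_norm_sq,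
    normSq_add, normSq_sub]
  linarith

lemma lamEnd_add_ne_zero : lamEnd p e k + kShift p e k ≠ 0 := by
  intro h
  have h1 := norm_kShift_le hA hk
  rw [h, norm_zero] at h1
  exact kShift_ne_zero hA hk (norm_le_zero_iff.1 h1)

omit hA hk in
lemma lamEnd_sub_mul_add :
    (lamEnd p e k - kShift p e k) * (lamEnd p e k + kShift p e k) = (p.amp e : ℂ) ^ 2 := by
  linear_combination (lamEnd_sq (p := p) (e := e) (k := k))

/-- From A² = |λ - κ||λ + κ| and |λ - κ| ≤ |λ + κ| it follows that A ≤ |λ + κ|. -/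
lemma norm_cEnd_le_one : ‖cEnd p e k‖ ≤ 1 := by
  have h0 : 0 < ‖lamEnd p e k + kShift p e k‖ := norm_pos_iff.2 (lamEnd_add_ne_zero hA hk)
  have h1 := congrArg norm (lamEnd_sub_mul_add (p := p) (e := e) (k := k))
  rw [norm_mul, norm_pow, norm_real] at h1
  have h2 : ‖p.amp e‖ ^ 2 ≤ ‖lamEnd p e k + kShift p e k‖ ^ 2 := by
    rw [← h1, pow_two]
    gcongr
    exact norm_lamEnd_sub_le hA hk
  rw [cEnd, norm_div, norm_mul, norm_I, one_mul, norm_real, div_le_one h0]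
  exact (sq_le_sq₀ (norm_nonneg _) (norm_nonneg _)).1 h2

lemma norm_cEnd_le : ‖cEnd p e k‖ ≤ p.amp e / ‖kShift p e k‖ := by
  have h0 : 0 < ‖kShift p e k‖ := norm_pos_iff.2 (kShift_ne_zero hA hk)
  rw [cEnd, norm_div, norm_mul, norm_I, one_mul, norm_real, Real.norm_of_nonneg (hA e)]
  have := hA e
  gcongr
  exact norm_kShift_le hA hk

lemma norm_lamEnd_sub_kShift_le :
    ‖lamEnd p e k - kShift p e k‖ ≤ p.amp e ^ 2 / ‖kShift p e k‖ := by
  have h0 : 0 < ‖kShift p e k‖ := norm_pos_iff.2 (kShift_ne_zero hA hk)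
  have h1 := congrArg norm (lamEnd_sub_mul_add (p := p) (e := e) (k := k))
  rw [norm_mul, norm_pow, norm_real, Real.norm_of_nonneg (hA e)] at h1
  rw [le_div_iff₀ h0, ← h1]
  gcongr
  exact norm_kShift_le hA hk

lemma amp_mul_cEnd : I * (p.amp e : ℂ) * cEnd p e k = -(lamEnd p e k - kShift p e k) := by
  have h := lamEnd_add_ne_zero hA hk
  rw [cEnd]
  field_simp
  rw [I_sq]
  linear_combination lamEnd_sub_mul_add (p := p) (e := e) (k := k)

lemma cEnd_mul_add : cEnd p e k * (lamEnd p e k + kShift p e k) = I * (p.amp e : ℂ) :=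
  div_mul_cancel₀ _ (lamEnd_add_ne_zero hA hk)

lemma detE_eq : detE p e k = 1 - cEnd p e k ^ 2 := by
  have h := lamEnd_add_ne_zero hA hk
  rw [detE, cEnd]
  field_simp
  rw [I_sq]
  linear_combination lamEnd_sub_mul_add (p := p) (e := e) (k := k)

lemma detE_ne_zero : detE p e k ≠ 0 :=
  div_ne_zero (mul_ne_zero two_ne_zero (lamEnd_ne_zero hA hk)) (lamEnd_add_ne_zero hA hk)

/-- The real part of λ times the conjugate of λ + κ is |λ|² + Re(λ κ̄) > 0. Hence the principal root
defining d_± is analytic off the cut and commutes with conjugation. -/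
lemma detE_re_pos : 0 < (detE p e k).re := by
  have h := re_lamEnd_mul_conj_pos hA hk
  have h0 := lamEnd_add_ne_zero hA hk
  rw [detE, div_eq_mul_inv, inv_def, ← mul_assoc, re_mul_ofReal]
  refine mul_pos ?_ (inv_pos.2 (normSq_pos.2 h0))
  rw [map_add, mul_assoc, show (2 : ℂ) = ((2 : ℝ) : ℂ) by norm_num, re_ofReal_mul, mul_add, add_re,
    mul_conj, ofReal_re]
  have := normSq_nonneg (lamEnd p e k)
  linarith

omit hA hk in
lemma dEnd_sq : dEnd p e k ^ 2 = detE p e k := by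
  rw [dEnd, one_div]
  exact cpow_nat_inv_pow _ two_ne_zero

lemma dEnd_ne_zero : dEnd p e k ≠ 0 := by
  intro h
  have := dEnd_sq (p := p) (e := e) (k := k)
  rw [h] at this
  exact detE_ne_zero hA hk (by rw [← this]; simp)

lemma differentiableAt_lamEnd : DifferentiableAt ℂ (lamEnd p e) k := by
  have h := differentiableAt_lam (hA e) (not_mem_branchCut hk)
  have h2 : DifferentiableAt ℂ (kShift p e) k := by unfold kShift; fun_prop
  exact h.comp k h2

omit hA hk in
lemma differentiable_kShift : Differentiable ℂ (kShift p e) := by unfold kShift; fun_prop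

lemma differentiableAt_cEnd : DifferentiableAt ℂ (cEnd p e) k :=
  (differentiableAt_const _).div ((differentiableAt_lamEnd hA hk).add (differentiable_kShift k))
    (lamEnd_add_ne_zero hA hk)

lemma differentiableAt_detE : DifferentiableAt ℂ (detE p e) k :=
  ((differentiableAt_const _).mul (differentiableAt_lamEnd hA hk)).div
    ((differentiableAt_lamEnd hA hk).add (differentiable_kShift k)) (lamEnd_add_ne_zero hA hk)

lemma differentiableAt_dEnd : DifferentiableAt ℂ (dEnd p e) k :=
  (differentiableAt_detE hA hk).cpow_const (Or.inl (detE_re_pos hA hk))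

omit hA hk in
lemma kShift_conj : kShift p e (starRingEnd ℂ k) = starRingEnd ℂ (kShift p e k) := by
  rw [kShift, kShift, map_add, conj_ofReal]

lemma lamEnd_conj : lamEnd p e (starRingEnd ℂ k) = starRingEnd ℂ (lamEnd p e k) := by
  rw [lamEnd, kShift_conj]
  exact lam_conj (hA e) (not_mem_branchCut hk)

lemma cEnd_conj : cEnd p e (starRingEnd ℂ k) = -starRingEnd ℂ (cEnd p e k) := by
  rw [cEnd, cEnd, lamEnd_conj hA hk, kShift_conj]
  simp [neg_div]

lemma detE_conj : detE p e (starRingEnd ℂ k) = starRingEnd ℂ (detE p e k) := by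
  rw [detE, detE, lamEnd_conj hA hk, kShift_conj]
  simp [map_ofNat]

lemma dEnd_conj : dEnd p e (starRingEnd ℂ k) = starRingEnd ℂ (dEnd p e k) := by
  have h : arg (detE p e k) ≠ Real.pi := by
    intro h
    rw [arg_eq_pi_iff] at h
    linarith [detE_re_pos hA hk, h.1]
  change detE p e (starRingEnd ℂ k) ^ (1 / 2 : ℂ) = starRingEnd ℂ (detE p e k ^ (1 / 2 : ℂ))
  rw [detE_conj hA hk, conj_cpow _ _ h]
  simp [map_ofNat]

/-- The imaginary parts of `λ_±(k)` and `k` have the same sign. -/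
lemma lamEnd_im_sign :
    (0 < k.im → 0 < (lamEnd p e k).im) ∧ (k.im < 0 → (lamEnd p e k).im < 0) ∧
      (k.im = 0 → (lamEnd p e k).im = 0) := by
  have h1 := re_lamEnd_mul_conj_pos hA hk
  have h2 := congrArg im (lamEnd_sq (p := p) (e := e) (k := k))
  rw [← kShift_im (p := p) (e := e)]
  set l := lamEnd p e k
  set κ := kShift p e k
  simp only [pow_two, mul_im, add_im, ofReal_im, mul_zero, zero_mul, add_zero] at h2
  simp only [mul_re, conj_re, conj_im] at h1
  -- The imaginary part of λ² = κ² + A² reads Re λ Im λ = Re κ Im κ, so the products of the real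
  -- parts and of the imaginary parts cannot have opposite signs; their sum is positive by `h1`.
  have h3 : (l.re * κ.re) * (l.im * κ.im) = (κ.re * κ.im) ^ 2 := by
    have : l.re * l.im = κ.re * κ.im := by linarith
    linear_combination (κ.re * κ.im) * this
  have h4 : 0 ≤ l.im * κ.im := by
    by_contra hc
    push Not at hc
    nlinarith [sq_nonneg (κ.re * κ.im)]
  have h5 : κ.im ≠ 0 → 0 < l.im * κ.im := by
    intro hκ
    rcases h4.eq_or_lt with h | h
    · exfalso
      rw [← h, mul_zero] at h3
      have h6 : κ.re * κ.im = 0 := by nlinarith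
      rcases mul_eq_zero.1 h6 with h7 | h7
      · rw [h7] at h1; linarith
      · exact hκ h7
    · exact h
  refine ⟨fun h => ?_, fun h => ?_, fun h => ?_⟩
  · exact pos_of_mul_pos_left (h5 h.ne') h.le
  · have := h5 h.ne
    by_contra hc
    push Not at hc
    nlinarith
  · rw [h] at h1 h2
    have : l.re * l.im = 0 := by linarith
    rcases mul_eq_zero.1 this with h7 | h7
    · rw [h7] at h1; linarith
    · exact h7

/-- One has (d - 1)(d + 1) = d² - 1 = -c², and |d + 1| ≥ 1 because a principal root has nonnegative
real part. -/
lemma norm_dEnd_sub_one_le : ‖dEnd p e k - 1‖ ≤ p.amp e ^ 2 / ‖kShift p e k‖ ^ 2 := by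
  have hre : 0 ≤ (dEnd p e k).re := by
    have h1 : dEnd p e k = exp (log (detE p e k) * (1 / 2 : ℂ)) := by
      rw [dEnd, cpow_def_of_ne_zero]
      · rfl
      · exact detE_ne_zero hA hk
    rw [h1, exp_re]
    refine mul_nonneg (Real.exp_pos _).le (Real.cos_nonneg_of_mem_Icc ?_)
    have h2 : (log (detE p e k) * (1 / 2 : ℂ)).im = arg (detE p e k) / 2 := by
      rw [show (1 / 2 : ℂ) = ((1 / 2 : ℝ) : ℂ) by norm_num, im_mul_ofReal, log_im]; ring
    rw [h2]
    constructor <;> linarith [neg_pi_lt_arg (detE p e k), arg_le_pi (detE p e k)]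
  have h1 : (1 : ℝ) ≤ ‖dEnd p e k + 1‖ := by
    refine le_trans ?_ (re_le_norm _)
    rw [add_re, one_re]; linarith
  have h2 : (dEnd p e k - 1) * (dEnd p e k + 1) = -cEnd p e k ^ 2 := by
    have := dEnd_sq (p := p) (e := e) (k := k)
    rw [detE_eq hA hk] at this
    linear_combination this
  have h3 := congrArg norm h2
  rw [norm_mul, norm_neg, norm_pow] at h3
  calc ‖dEnd p e k - 1‖ ≤ ‖dEnd p e k - 1‖ * ‖dEnd p e k + 1‖ :=
        le_mul_of_one_le_right (norm_nonneg _) h1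
    _ = ‖cEnd p e k‖ ^ 2 := h3
    _ ≤ (p.amp e / ‖kShift p e k‖) ^ 2 := by gcongr; exact norm_cEnd_le hA hk
    _ = _ := by rw [div_pow]

end Coefficients

/-! ### Estimates for linear systems on a half-line, integrated from infinity -/

lemma norm_sub_le_integral {f f' : ℝ → ℂ} {n : ℝ → ℝ} {y L : ℝ} (hyL : y ≤ L)
    (hf : ∀ x, HasDerivAt f (f' x) x) (hn : Continuous n) (hb : ∀ x ∈ Set.Icc y L, ‖f' x‖ ≤ n x) :
    ‖f L - f y‖ ≤ ∫ x in y..L, n x := by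
  have hB : ∀ x, HasDerivAt (fun x => ∫ s in y..x, n s) (n x) x := fun x =>
    intervalIntegral.integral_hasDerivAt_right (hn.intervalIntegrable _ _)
      (hn.stronglyMeasurableAtFilter _ _) hn.continuousAt
  exact image_norm_le_of_norm_deriv_right_le_deriv_boundary (f := fun x => f x - f y) (f' := f')
    (B := fun x => ∫ s in y..x, n s) (B' := n) (a := y) (b := L)
    (fun x _ => ((hf x).sub_const _).continuousAt.continuousWithinAt)
    (fun x _ => ((hf x).sub_const _).hasDerivWithinAt) (by simp)
    hB (fun x hx => hb x ⟨hx.1, hx.2.le⟩) ⟨hyL, le_rfl⟩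

/-- Duhamel estimate, integrating from the right. -/
lemma norm_le_duhamel {z g : ℝ → ℂ} {μ : ℂ} {n : ℝ → ℝ} {y L : ℝ} (hyL : y ≤ L) (hμ : 0 ≤ μ.re)
    (hz : ∀ x, HasDerivAt z (μ * z x + g x) x) (hn : Continuous n)
    (hg : ∀ x ∈ Set.Icc y L, ‖g x‖ ≤ n x) :
    ‖z y‖ ≤ Real.exp (-(μ.re * (L - y))) * ‖z L‖ + ∫ x in y..L, n x := by
  -- The integrating factor is normalized at the left endpoint, so its modulus is at most 1 on the
  -- whole interval and the forcing is integrated without loss.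
  have hd : ∀ x, HasDerivAt (fun x : ℝ => exp (μ * ((y - x : ℝ) : ℂ)) * z x)
      (exp (μ * ((y - x : ℝ) : ℂ)) * g x) x := by
    intro x
    have h1 : HasDerivAt (fun x : ℝ => μ * ((y - x : ℝ) : ℂ)) (μ * ((-1 : ℝ) : ℂ)) x :=
      (((hasDerivAt_id x).const_sub y).ofReal_comp).const_mul μ
    refine (h1.cexp.mul (hz x)).congr_deriv ?_
    push_cast; ring
  have h := norm_sub_le_integral hyL hd hn (fun x hx => by
    rw [norm_mul, norm_exp, re_mul_ofReal]
    calc Real.exp (μ.re * (y - x)) * ‖g x‖ ≤ 1 * ‖g x‖ := by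
          gcongr
          rw [Real.exp_le_one_iff]
          exact mul_nonpos_of_nonneg_of_nonpos hμ (by linarith [hx.1])
      _ ≤ n x := by rw [one_mul]; exact hg x hx)
  simp only [sub_self, ofReal_zero, mul_zero, exp_zero, one_mul] at h
  have h2 : ‖exp (μ * ((y - L : ℝ) : ℂ)) * z L‖ = Real.exp (-(μ.re * (L - y))) * ‖z L‖ := by
    rw [norm_mul, norm_exp, re_mul_ofReal]; congr 2; ring
  have h3 := norm_sub_norm_le (z y) (exp (μ * ((y - L : ℝ) : ℂ)) * z L)
  rw [norm_sub_rev, h2] at h3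
  linarith

/-- Backward Grönwall inequality in integral form. -/
lemma le_exp_of_le_integral {φ m : ℝ → ℝ} {c y L : ℝ} (hyL : y ≤ L) (hφ : Continuous φ)
    (hm : Continuous m) (hm0 : ∀ x, 0 ≤ m x)
    (h : ∀ x ∈ Set.Icc y L, φ x ≤ c + ∫ s in x..L, m s * φ s) :
    φ y ≤ c * Real.exp (∫ s in y..L, m s) := by
  have hN : ∀ x, HasDerivAt (fun x => ∫ s in x..L, m s) (-m x) x := fun x =>
    intervalIntegral.integral_hasDerivAt_left (hm.intervalIntegrable _ _)
      (hm.stronglyMeasurableAtFilter _ _) hm.continuousAt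
  have hmφ := hm.mul hφ
  have hU : ∀ x, HasDerivAt (fun x => c + ∫ s in x..L, m s * φ s) (-(m x * φ x)) x := fun x =>
    (intervalIntegral.integral_hasDerivAt_left (hmφ.intervalIntegrable _ _)
      (hmφ.stronglyMeasurableAtFilter _ _) hmφ.continuousAt).const_add c
  -- The right side of the integral inequality, times exp(-∫m), has a derivative whose sign is that
  -- of the hypothesis; hence it is nondecreasing on [y, L].
  have hV : ∀ x, HasDerivAt
      (fun x => (c + ∫ s in x..L, m s * φ s) * Real.exp (-∫ s in x..L, m s))
      (Real.exp (-∫ s in x..L, m s) * m x * ((c + ∫ s in x..L, m s * φ s) - φ x)) x := fun x => by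
    refine ((hU x).mul (hN x).neg.exp).congr_deriv ?_
    simp only [Pi.neg_apply]
    ring
  have hmono : MonotoneOn (fun x => (c + ∫ s in x..L, m s * φ s) * Real.exp (-∫ s in x..L, m s))
      (Set.Icc y L) := by
    refine monotoneOn_of_hasDerivWithinAt_nonneg (convex_Icc _ _)
      (fun x _ => (hV x).continuousAt.continuousWithinAt)
      (fun x hx => (hV x).hasDerivWithinAt) (fun x hx => ?_)
    have := h x (interior_subset hx)
    have := hm0 x
    have := Real.exp_pos (-∫ s in x..L, m s)
    apply mul_nonneg (by positivity)
    linarith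
  have h1 := hmono ⟨le_rfl, hyL⟩ ⟨hyL, le_rfl⟩ hyL
  simp only [intervalIntegral.integral_same, neg_zero, Real.exp_zero, add_zero, mul_one] at h1
  rw [Real.exp_neg, ← div_eq_mul_inv, div_le_iff₀ (Real.exp_pos _)] at h1
  exact (h y ⟨le_rfl, hyL⟩).trans h1

/-- Solutions of a diagonal system with nonnegative real parts, perturbed by a term of size
`m ‖w‖`, grow to the left by at most the exponential of the integral of `m`. -/
lemma norm_le_exp_mul {w g : ℝ → Fin 2 → ℂ} {μ : Fin 2 → ℂ} {m : ℝ → ℝ} (hμ : ∀ i, 0 ≤ (μ i).re)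
    (hw : ∀ x i, HasDerivAt (fun x => w x i) (μ i * w x i + g x i) x) (hm : Continuous m)
    (hg : ∀ x i, ‖g x i‖ ≤ m x * ‖w x‖) (hm0 : ∀ x, 0 ≤ m x) {y L : ℝ} (hyL : y ≤ L) :
    ‖w y‖ ≤ ‖w L‖ * Real.exp (∫ s in y..L, m s) := by
  have hwc : Continuous w := continuous_pi fun i => continuous_iff_continuousAt.2 fun x =>
    (hw x i).continuousAt
  refine le_exp_of_le_integral (φ := fun x => ‖w x‖) hyL hwc.norm hm hm0 fun x hx => ?_
  have hnn : 0 ≤ ∫ s in x..L, m s * ‖w s‖ :=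
    intervalIntegral.integral_nonneg hx.2 fun s _ => mul_nonneg (hm0 s) (norm_nonneg _)
  rw [pi_norm_le_iff_of_nonneg (by positivity)]
  intro i
  have := norm_le_duhamel (n := fun s => m s * ‖w s‖) hx.2 (hμ i) (fun s => hw s i)
    (hm.mul hwc.norm) (fun s _ => hg s i)
  refine this.trans ?_
  gcongr
  calc Real.exp (-((μ i).re * (L - x))) * ‖w L i‖ ≤ 1 * ‖w L‖ := by
        gcongr
        · rw [Real.exp_le_one_iff]
          have := mul_nonneg (hμ i) (sub_nonneg.2 hx.2); linarith
        · exact norm_le_pi_norm _ _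
    _ = ‖w L‖ := one_mul _

/-! ### The Lax pair in asymptotic coordinates -/

lemma laxX_mulVec (q : ℝ → ℝ → ℂ) (k : ℂ) (x t : ℝ) (v : Fin 2 → ℂ) :
    (laxX q k x t).mulVec v =
      ![I * k * v 0 + q x t * v 1, -(I * k * v 1) - starRingEnd ℂ (q x t) * v 0] := by
  ext i
  fin_cases i <;>
    simp [laxX, sigma3, offDiag, Matrix.mulVec, dotProduct, Fin.sum_univ_two]
  ring

lemma hasDerivAt_pair {v : ℝ → Fin 2 → ℂ} {a b : ℂ} {x : ℝ} :
    HasDerivAt v ![a, b] x ↔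
      HasDerivAt (fun y => v y 0) a x ∧ HasDerivAt (fun y => v y 1) b x := by
  rw [hasDerivAt_pi]
  simp [Fin.forall_fin_two]

lemma hasDerivAt_bgPhase_x (p : Params) (e : SpatialEnd) (x t : ℝ) :
    HasDerivAt (fun y => bgPhase p e y t) (e.sgn * p.V / 2) x := by
  unfold bgPhase
  have := ((((hasDerivAt_id x).const_mul (e.sgn * p.V)).add_const
    ((p.V ^ 2 - 2 * p.amp e ^ 2) * t)).div_const 2)
  simpa using this

lemma hasDerivAt_thetaEnd_x (p : Params) (e : SpatialEnd) (k : ℂ) (x t : ℝ) :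
    HasDerivAt (fun y : ℝ => thetaEnd p e y t k) (lamEnd p e k) x := by
  unfold thetaEnd
  have := ((((hasDerivAt_id x).ofReal_comp).sub_const
    (2 * (k - ((e.sgn * p.V / 2 : ℝ) : ℂ)) * (t : ℂ))).const_mul (lamEnd p e k))
  simpa using this

/-- The deviation `(q - q_±) e^{2 i f_±}` from the background, in the frame of the background. -/
def resid (p : Params) (q : ℝ → ℝ → ℂ) (e : SpatialEnd) (x t : ℝ) : ℂ :=
  (q x t - bgWave p e x t) * exp (2 * I * (bgPhase p e x t : ℂ))

lemma norm_resid (p : Params) (q : ℝ → ℝ → ℂ) (e : SpatialEnd) (x t : ℝ) :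
    ‖resid p q e x t‖ = ‖q x t - bgWave p e x t‖ := by
  rw [resid, norm_mul, show 2 * I * (bgPhase p e x t : ℂ) = ((2 * bgPhase p e x t : ℝ) : ℂ) * I by
    push_cast; ring, norm_exp_ofReal_mul_I, mul_one]

/-- The phase of the background factors out as e^{-2if}. After conjugation by e^{if σ₃} the
potential is the constant A_± e^{±iδ} plus the integrable deviation. -/
lemma q_eq (p : Params) (q : ℝ → ℝ → ℂ) (e : SpatialEnd) (x t : ℝ) :
    q x t = ((p.amp e : ℂ) * epsEnd p e + resid p q e x t) *
      exp (-(I * (bgPhase p e x t : ℂ))) ^ 2 := by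
  have h1 : exp (2 * I * (bgPhase p e x t : ℂ)) * exp (-(I * (bgPhase p e x t : ℂ))) ^ 2 = 1 := by
    rw [← exp_nat_mul, ← exp_add, ← exp_zero]
    congr 1; push_cast; ring
  have h2 : exp (-2 * I * (bgPhase p e x t : ℂ)) = exp (-(I * (bgPhase p e x t : ℂ))) ^ 2 := by
    rw [← exp_nat_mul]
    congr 1; push_cast; ring
  rw [resid, bgWave, exp_add, h2, epsEnd]
  linear_combination -(q x t - (p.amp e : ℂ) * (exp (-(I * (bgPhase p e x t : ℂ))) ^ 2 *
    exp (I * ((e.sgn * p.δ : ℝ) : ℂ)))) * h1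

lemma conj_q_eq (p : Params) (q : ℝ → ℝ → ℂ) (e : SpatialEnd) (x t : ℝ) :
    starRingEnd ℂ (q x t) = ((p.amp e : ℂ) * (epsEnd p e)⁻¹ + starRingEnd ℂ (resid p q e x t)) *
      exp (I * (bgPhase p e x t : ℂ)) ^ 2 := by
  conv_lhs => rw [q_eq p q e x t]
  rw [map_mul, map_add, map_mul, conj_epsEnd, conj_ofReal, map_pow, ← exp_conj]
  simp

/-- The coordinates of a vector `v` in the frame `e^{i σ_j θ_±} d_±⁻¹ e^{-i f_± σ₃} E_±`. -/
def jostCoord (p : Params) (e : SpatialEnd) (j : Fin 2) (k : ℂ) (x t : ℝ) (v : Fin 2 → ℂ) :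
    Fin 2 → ℂ :=
  let h := (dEnd p e k)⁻¹ * exp (-(colSign j * (I * thetaEnd p e x t k)))
  ![h * (exp (I * (bgPhase p e x t : ℂ)) * v 0
      - cEnd p e k * epsEnd p e * (exp (-(I * (bgPhase p e x t : ℂ))) * v 1)),
    h * (exp (-(I * (bgPhase p e x t : ℂ))) * v 1
      - cEnd p e k * (epsEnd p e)⁻¹ * (exp (I * (bgPhase p e x t : ℂ)) * v 0))]

/-- The potential term of the `x`-equation in the coordinates `jostCoord`. -/
def jostForce (p : Params) (e : SpatialEnd) (k r : ℂ) (u : Fin 2 → ℂ) : Fin 2 → ℂ :=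
  let V0 := (detE p e k)⁻¹ * (u 0 + cEnd p e k * epsEnd p e * u 1)
  let V1 := (detE p e k)⁻¹ * (u 1 + cEnd p e k * (epsEnd p e)⁻¹ * u 0)
  ![r * V1 + cEnd p e k * epsEnd p e * (starRingEnd ℂ r * V0),
    -(starRingEnd ℂ r * V0) - cEnd p e k * (epsEnd p e)⁻¹ * (r * V1)]

section

variable {p : Params} {e : SpatialEnd} {k : ℂ} (hA : p.AmpNonneg) (hk : k ∉ branchCut p e)
include hA hk

lemma norm_jostForce_le (r : ℂ) (u : Fin 2 → ℂ) (i : Fin 2) :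
    ‖jostForce p e k r u i‖ ≤ 4 * ‖(detE p e k)⁻¹‖ * ‖r‖ * ‖u‖ := by
  have hc := norm_cEnd_le_one hA hk
  have hε : ‖epsEnd p e‖ = 1 := norm_epsEnd
  have hε' : ‖(epsEnd p e)⁻¹‖ = 1 := by rw [norm_inv, hε, inv_one]
  have h0 := norm_le_pi_norm u 0
  have h1 := norm_le_pi_norm u 1
  have hV0 : ‖(detE p e k)⁻¹ * (u 0 + cEnd p e k * epsEnd p e * u 1)‖ ≤
      ‖(detE p e k)⁻¹‖ * (‖u‖ + 1 * 1 * ‖u‖) := by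
    rw [norm_mul]
    gcongr
    refine (norm_add_le _ _).trans (add_le_add h0 ?_)
    rw [norm_mul, norm_mul, hε]
    gcongr
  have hV1 : ‖(detE p e k)⁻¹ * (u 1 + cEnd p e k * (epsEnd p e)⁻¹ * u 0)‖ ≤
      ‖(detE p e k)⁻¹‖ * (‖u‖ + 1 * 1 * ‖u‖) := by
    rw [norm_mul]
    gcongr
    refine (norm_add_le _ _).trans (add_le_add h1 ?_)
    rw [norm_mul, norm_mul, hε']
    gcongr
  set V0 := (detE p e k)⁻¹ * (u 0 + cEnd p e k * epsEnd p e * u 1)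
  set V1 := (detE p e k)⁻¹ * (u 1 + cEnd p e k * (epsEnd p e)⁻¹ * u 0)
  have hr : ‖starRingEnd ℂ r‖ = ‖r‖ := RCLike.norm_conj r
  have e0 : jostForce p e k r u 0 = r * V1 + cEnd p e k * epsEnd p e * (starRingEnd ℂ r * V0) := rfl
  have e1 : jostForce p e k r u 1 =
    -(starRingEnd ℂ r * V0) - cEnd p e k * (epsEnd p e)⁻¹ * (r * V1) := rfl
  -- Each of `V0` and `V1` costs a factor 2, and each coordinate of the force contains both of them:
  -- this is the constant 4.
  have key : ‖r‖ * ‖V1‖ + 1 * 1 * (‖r‖ * ‖V0‖) ≤ 4 * ‖(detE p e k)⁻¹‖ * ‖r‖ * ‖u‖ := by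
    nlinarith [mul_le_mul_of_nonneg_left hV0 (norm_nonneg r),
      mul_le_mul_of_nonneg_left hV1 (norm_nonneg r)]
  have key' : ‖r‖ * ‖V0‖ + 1 * 1 * (‖r‖ * ‖V1‖) ≤ 4 * ‖(detE p e k)⁻¹‖ * ‖r‖ * ‖u‖ := by
    linarith
  revert i
  rw [Fin.forall_fin_two, e0, e1]
  constructor
  · refine ((norm_add_le _ _).trans ?_).trans key
    simp only [norm_mul, hε, hr]
    gcongr
  · refine ((norm_sub_le _ _).trans ?_).trans key'
    simp only [norm_neg, norm_mul, hε', hr]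
    gcongr

/-- The inverse of the change of coordinates `jostCoord`. -/
lemma jostCoord_inv (j : Fin 2) (x t : ℝ) (v : Fin 2 → ℂ) :
    exp (-(colSign j * (I * thetaEnd p e x t k))) * v 0 = (dEnd p e k)⁻¹ *
        (exp (-(I * (bgPhase p e x t : ℂ))) * (jostCoord p e j k x t v 0 +
          cEnd p e k * epsEnd p e * jostCoord p e j k x t v 1)) ∧
      exp (-(colSign j * (I * thetaEnd p e x t k))) * v 1 = (dEnd p e k)⁻¹ *
        (exp (I * (bgPhase p e x t : ℂ)) * (jostCoord p e j k x t v 1 +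
          cEnd p e k * (epsEnd p e)⁻¹ * jostCoord p e j k x t v 0)) := by
  have hd := dEnd_ne_zero hA hk
  have hd2 : dEnd p e k ^ 2 = 1 - cEnd p e k ^ 2 := by rw [dEnd_sq, detE_eq hA hk]
  have hε := epsEnd_ne_zero (p := p) (e := e)
  simp only [jostCoord, exp_neg (I * (bgPhase p e x t : ℂ)), Matrix.cons_val_zero,
    Matrix.cons_val_one]
  have ha := exp_ne_zero (I * (bgPhase p e x t : ℂ))
  set a := exp (I * (bgPhase p e x t : ℂ))
  set h := exp (-(colSign j * (I * thetaEnd p e x t k)))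
  constructor
  · field_simp
    linear_combination (h * v 0 * a ^ 2) * hd2
  · field_simp
    linear_combination (h * v 1 * epsEnd p e) * hd2

omit hA hk in
/-- The `x`-equation in the frame `e^{-i f_± σ₃}`. -/
lemma hasDerivAt_frame {q : ℝ → ℝ → ℂ} {v : ℝ → Fin 2 → ℂ} {x t : ℝ}
    (hv : HasDerivAt v ((laxX q k x t).mulVec (v x)) x) :
    HasDerivAt (fun y => exp (I * (bgPhase p e y t : ℂ)) * v y 0)
        (I * kShift p e k * (exp (I * (bgPhase p e x t : ℂ)) * v x 0) +
          ((p.amp e : ℂ) * epsEnd p e + resid p q e x t) *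
            (exp (-(I * (bgPhase p e x t : ℂ))) * v x 1)) x ∧
      HasDerivAt (fun y => exp (-(I * (bgPhase p e y t : ℂ))) * v y 1)
        (-(I * kShift p e k * (exp (-(I * (bgPhase p e x t : ℂ))) * v x 1)) -
          ((p.amp e : ℂ) * (epsEnd p e)⁻¹ + starRingEnd ℂ (resid p q e x t)) *
            (exp (I * (bgPhase p e x t : ℂ)) * v x 0)) x := by
  rw [laxX_mulVec, hasDerivAt_pair, conj_q_eq p q e x t] at hv
  rw [q_eq p q e x t] at hv
  obtain ⟨hv0, hv1⟩ := hv
  have hf := ((hasDerivAt_bgPhase_x p e x t).ofReal_comp.const_mul I)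
  have hinv : exp (I * (bgPhase p e x t : ℂ)) * exp (-(I * (bgPhase p e x t : ℂ))) = 1 := by
    rw [← exp_add]; simp
  have hκ : kShift p e k = k + ((e.sgn * p.V / 2 : ℝ) : ℂ) := rfl
  constructor
  · refine (hf.cexp.mul hv0).congr_deriv ?_
    rw [hκ]
    linear_combination ((p.amp e : ℂ) * epsEnd p e + resid p q e x t) * v x 1 *
      exp (-(I * (bgPhase p e x t : ℂ))) * hinv
  · refine (hf.neg.cexp.mul hv1).congr_deriv ?_
    rw [hκ]
    simp only [Pi.neg_apply]
    linear_combination -((p.amp e : ℂ) * (epsEnd p e)⁻¹ + starRingEnd ℂ (resid p q e x t)) * v x 0 *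
      exp (I * (bgPhase p e x t : ℂ)) * hinv

/-- Up to the factor 1/det, the inverse of E_± is E_± with its off-diagonal entries negated. The
vectors inside `jostForce` are therefore the frame components of the solution. -/
lemma detE_inv_mul_frame (h V0 V1 : ℂ) :
    (detE p e k)⁻¹ * (h * (V0 - cEnd p e k * epsEnd p e * V1) + cEnd p e k * epsEnd p e *
      (h * (V1 - cEnd p e k * (epsEnd p e)⁻¹ * V0))) = h * V0 ∧
    (detE p e k)⁻¹ * (h * (V1 - cEnd p e k * (epsEnd p e)⁻¹ * V0) + cEnd p e k * (epsEnd p e)⁻¹ *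
      (h * (V0 - cEnd p e k * epsEnd p e * V1))) = h * V1 := by
  have hD := detE_ne_zero hA hk
  have hDc : detE p e k = 1 - cEnd p e k ^ 2 := detE_eq hA hk
  have hε := mul_inv_cancel₀ (epsEnd_ne_zero (p := p) (e := e))
  constructor
  · rw [inv_mul_eq_iff_eq_mul₀ hD, hDc]
    linear_combination -(cEnd p e k ^ 2 * h * V0) * hε
  · rw [inv_mul_eq_iff_eq_mul₀ hD, hDc]
    linear_combination -(cEnd p e k ^ 2 * h * V1) * hε

/-- The `x`-equation in asymptotic coordinates. -/
lemma hasDerivAt_jostCoord {q : ℝ → ℝ → ℂ} {v : ℝ → Fin 2 → ℂ} {x t : ℝ} (j : Fin 2)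
    (hv : HasDerivAt v ((laxX q k x t).mulVec (v x)) x) (i : Fin 2) :
    HasDerivAt (fun y => jostCoord p e j k y t (v y) i)
      (I * lamEnd p e k * (colSign i - colSign j) * jostCoord p e j k x t (v x) i
        + jostForce p e k (resid p q e x t) (jostCoord p e j k x t (v x)) i) x := by
  obtain ⟨hv0, hv1⟩ := hasDerivAt_frame (p := p) (e := e) hv
  have hθ : HasDerivAt (fun y : ℝ => (dEnd p e k)⁻¹ * exp (-(colSign j * (I * thetaEnd p e y t k))))
      (-(colSign j * I * lamEnd p e k) *
        ((dEnd p e k)⁻¹ * exp (-(colSign j * (I * thetaEnd p e x t k))))) x := by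
    refine ((((hasDerivAt_thetaEnd_x p e k x t).const_mul I).const_mul
      (colSign j)).neg.cexp.const_mul (dEnd p e k)⁻¹).congr_deriv ?_
    simp only [Pi.neg_apply]
    ring
  have hε := mul_inv_cancel₀ (epsEnd_ne_zero (p := p) (e := e))
  have hc1 := amp_mul_cEnd hA hk
  have hc2 := cEnd_mul_add hA hk
  -- Together with `hl2`, this says that the rows of E_±⁻¹ are left eigenvectors of the constant
  -- background matrix, with eigenvalues ±iλ_±; the x-equation becomes diagonal up to the deviation.
  have hl1 : cEnd p e k * p.amp e = I * (lamEnd p e k - kShift p e k) := by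
    linear_combination (-I) * hc1 + (cEnd p e k * p.amp e) * I_sq
  have hl2 : (p.amp e : ℂ) = -(I * cEnd p e k * (lamEnd p e k + kShift p e k)) := by
    linear_combination I * hc2 + (p.amp e : ℂ) * I_sq
  revert i
  rw [Fin.forall_fin_two]
  constructor
  · refine (hθ.mul (hv0.sub (hv1.const_mul (cEnd p e k * epsEnd p e)))).congr_deriv ?_
    simp only [jostCoord, jostForce, Matrix.cons_val_zero, Matrix.cons_val_one, Pi.sub_apply]
    rw [(detE_inv_mul_frame hA hk _ _ _).1, (detE_inv_mul_frame hA hk _ _ _).2,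
      show colSign 0 = 1 from rfl]
    generalize exp (-(colSign j * (I * thetaEnd p e x t k))) = E
    generalize exp (I * (bgPhase p e x t : ℂ)) * v x 0 = V0
    generalize exp (-(I * (bgPhase p e x t : ℂ))) * v x 1 = V1
    set h := (dEnd p e k)⁻¹ * E
    linear_combination (h * V0) * hl1 + (h * epsEnd p e * V1) * hl2 +
      (h * cEnd p e k * p.amp e * V0) * hε
  · refine (hθ.mul (hv1.sub (hv0.const_mul (cEnd p e k * (epsEnd p e)⁻¹)))).congr_deriv ?_
    simp only [jostCoord, jostForce, Matrix.cons_val_zero, Matrix.cons_val_one, Pi.sub_apply]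
    rw [(detE_inv_mul_frame hA hk _ _ _).1, (detE_inv_mul_frame hA hk _ _ _).2,
      show colSign 1 = -1 from rfl]
    generalize exp (-(colSign j * (I * thetaEnd p e x t k))) = E
    generalize exp (I * (bgPhase p e x t : ℂ)) * v x 0 = V0
    generalize exp (-(I * (bgPhase p e x t : ℂ))) * v x 1 = V1
    set h := (dEnd p e k)⁻¹ * E
    linear_combination (-h * V1) * hl1 - (h * (epsEnd p e)⁻¹ * V0) * hl2 -
      (h * cEnd p e k * p.amp e * V1) * hε

end

/-! ### Simultaneous solutions of the Lax pair -/

/-- The admissible time domains `[0, ∞)` and `ℝ`. -/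
def IsTimeDomain (J : Set ℝ) : Prop := J = Set.Ici 0 ∨ J = Set.univ

lemma IsTimeDomain.zero_mem {J : Set ℝ} (hJ : IsTimeDomain J) : (0 : ℝ) ∈ J := by
  rcases hJ with rfl | rfl <;> simp

lemma IsTimeDomain.convex {J : Set ℝ} (hJ : IsTimeDomain J) : Convex ℝ J := by
  rcases hJ with rfl | rfl
  · exact convex_Ici 0
  · exact convex_univ

/-- Composing with the retraction extends coefficients from J to all times continuously, so that the
global existence theorem on ℝ applies; the values outside J play no role. -/
lemma IsTimeDomain.exists_retraction {J : Set ℝ} (hJ : IsTimeDomain J) :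
    ∃ ρ : ℝ → ℝ, Continuous ρ ∧ (∀ t, ρ t ∈ J) ∧ ∀ t ∈ J, ρ t = t := by
  rcases hJ with rfl | rfl
  · exact ⟨fun t => max t 0, by fun_prop, fun t => Set.mem_Ici.2 (le_max_right _ _), fun t ht => max_eq_left ht⟩
  · exact ⟨id, continuous_id, fun _ => trivial, fun _ _ => rfl⟩

/-- Grönwall's inequality on a time domain, starting from time zero. -/
lemma IsTimeDomain.norm_le_exp {J : Set ℝ} (hJ : IsTimeDomain J) {E : Type*}
    [NormedAddCommGroup E] [NormedSpace ℝ E] {f f' : ℝ → E} {K t : ℝ} (ht : t ∈ J)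
    (hf : ∀ s ∈ J, HasDerivWithinAt f (f' s) J s)
    (hb : ∀ s ∈ J, |s| ≤ |t| → ‖f' s‖ ≤ K * ‖f s‖) :
    ‖f t‖ ≤ ‖f 0‖ * Real.exp (K * |t|) := by
  rcases le_total 0 t with h0 | h0
  · have hsub : ∀ s : ℝ, 0 ≤ s → Set.Ici s ⊆ J := by
      intro s hs
      rcases hJ with rfl | rfl
      · exact Set.Ici_subset_Ici.2 hs
      · exact Set.subset_univ _
    have := norm_le_gronwallBound_of_norm_deriv_right_le (f := f) (f' := f') (δ := ‖f 0‖) (K := K)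
      (ε := 0) (a := 0) (b := t)
      (fun s hs => ((hf s (hsub 0 le_rfl hs.1)).mono
        (Set.Icc_subset_Ici_self.trans (hsub 0 le_rfl))).continuousWithinAt)
      (fun s hs => (hf s (hsub 0 le_rfl hs.1)).mono (hsub s hs.1)) le_rfl
      (fun s hs => by
        rw [add_zero]
        exact hb s (hsub 0 le_rfl hs.1) (by rw [abs_of_nonneg hs.1, abs_of_nonneg h0]; exact hs.2.le))
      t ⟨h0, le_rfl⟩
    rwa [gronwallBound_ε0, sub_zero, show K * t = K * |t| by rw [abs_of_nonneg h0]] at this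
  · rcases h0.eq_or_lt with rfl | h0'
    · simp
    have hJu : J = Set.univ := by
      rcases hJ with rfl | rfl
      · exact absurd ht (by simpa using h0')
      · rfl
    subst hJu
    have hd : ∀ s, HasDerivAt (fun s => f (-s)) (-f' (-s)) s := fun s => by
      have := (hf (-s) trivial).hasDerivAt univ_mem |>.scomp s (hasDerivAt_neg s)
      simpa [Function.comp_def] using this
    have := norm_le_gronwallBound_of_norm_deriv_right_le (f := fun s => f (-s))
      (f' := fun s => -f' (-s)) (δ := ‖f 0‖) (K := K)
      (ε := 0) (a := 0) (b := -t) (fun s _ => (hd s).continuousAt.continuousWithinAt)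
      (fun s _ => (hd s).hasDerivWithinAt) (by simp)
      (fun s hs => by
        rw [add_zero, norm_neg]
        exact hb (-s) trivial (by
          rw [abs_neg, abs_of_nonneg hs.1, abs_of_nonpos h0]; exact hs.2.le))
      (-t) ⟨by linarith, le_rfl⟩
    rw [gronwallBound_ε0, sub_zero, neg_neg, ← abs_of_nonpos h0] at this
    exact this

/-- A `2 × 2` matrix as a continuous linear operator. -/
def toCLM : Mat2 ≃ₗ[ℂ] ((Fin 2 → ℂ) →L[ℂ] (Fin 2 → ℂ)) :=
  Matrix.toLin' ≪≫ₗ LinearMap.toContinuousLinearMap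

lemma toCLM_apply (M : Mat2) (v : Fin 2 → ℂ) : toCLM M v = M.mulVec v := rfl

lemma continuous_toCLM : Continuous toCLM :=
  LinearMap.continuous_of_finiteDimensional toCLM.toLinearMap

/-- A `2 × 2` complex matrix as a continuous real linear operator. -/
def toRealCLM (M : Mat2) : (Fin 2 → ℂ) →L[ℝ] (Fin 2 → ℂ) := (toCLM M).restrictScalars ℝ

lemma toRealCLM_apply (M : Mat2) (v : Fin 2 → ℂ) : toRealCLM M v = M.mulVec v := rfl

lemma continuous_toRealCLM : Continuous toRealCLM :=
  (ContinuousLinearMap.restrictScalarsL ℂ (Fin 2 → ℂ) (Fin 2 → ℂ) ℝ ℝ).continuous.comp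
    continuous_toCLM

lemma continuous_offDiag : Continuous offDiag := by
  unfold offDiag
  refine continuous_matrix fun i j => ?_
  fin_cases i <;> fin_cases j <;> simp <;> fun_prop

lemma norm_offDiag_mulVec_le (w : ℂ) (v : Fin 2 → ℂ) : ‖(offDiag w).mulVec v‖ ≤ ‖w‖ * ‖v‖ := by
  rw [pi_norm_le_iff_of_nonneg (by positivity), Fin.forall_fin_two]
  constructor
  · simp only [offDiag, Matrix.mulVec, dotProduct, Fin.sum_univ_two]
    simp only [Matrix.of_apply, Matrix.cons_val_zero, Matrix.cons_val_one, zero_mul, zero_add,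
      norm_mul]
    gcongr
    exact norm_le_pi_norm v 1
  · simp only [offDiag, Matrix.mulVec, dotProduct, Fin.sum_univ_two]
    simp
    gcongr
    exact norm_le_pi_norm v 0

lemma norm_sigma3_mulVec_le (v : Fin 2 → ℂ) : ‖sigma3.mulVec v‖ ≤ ‖v‖ := by
  rw [pi_norm_le_iff_of_nonneg (norm_nonneg _), Fin.forall_fin_two]
  constructor
  · simpa [sigma3, Matrix.mulVec, dotProduct, Fin.sum_univ_two] using norm_le_pi_norm v 0
  · simpa [sigma3, Matrix.mulVec, dotProduct, Fin.sum_univ_two] using norm_le_pi_norm v 1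

lemma laxT_mulVec (q : ℝ → ℝ → ℂ) (k : ℂ) (x t : ℝ) (v : Fin 2 → ℂ) :
    (laxT q k x t).mulVec v =
      ![(-2 * I * k ^ 2 + I * (q x t * starRingEnd ℂ (q x t))) * v 0
          + (I * dX q x t - 2 * k * q x t) * v 1,
        (I * starRingEnd ℂ (dX q x t) + 2 * k * starRingEnd ℂ (q x t)) * v 0
          + (2 * I * k ^ 2 - I * (q x t * starRingEnd ℂ (q x t))) * v 1] := by
  ext i
  fin_cases i <;>
    simp [laxT, sigma3, offDiag, Matrix.mulVec, dotProduct, Fin.sum_univ_two,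
      -mul_eq_mul_right_iff]
  all_goals ring

section

variable {J : Set ℝ} {q : ℝ → ℝ → ℂ}

lemma IsClassicalNLS.continuous_q (hq : IsClassicalNLS J q) {t : ℝ} (ht : t ∈ J) :
    Continuous fun x => q x t :=
  continuous_iff_continuousAt.2 fun x => (hq.diff_x x t ht).continuousAt

lemma IsClassicalNLS.hasDerivAt_q (hq : IsClassicalNLS J q) {t : ℝ} (ht : t ∈ J) (x : ℝ) :
    HasDerivAt (fun y => q y t) (dX q x t) x := (hq.diff_x x t ht).hasDerivAt

lemma IsClassicalNLS.hasDerivAt_dX (hq : IsClassicalNLS J q) {t : ℝ} (ht : t ∈ J) (x : ℝ) :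
    HasDerivAt (fun y => dX q y t) (dX (dX q) x t) x := (hq.diff_xx x t ht).hasDerivAt

lemma continuous_slice {X : Type*} [TopologicalSpace X] {g : ℝ → ℝ → ℂ}
    (hg : ContinuousOn (fun z : ℝ × ℝ => g z.1 z.2) (Set.univ ×ˢ J)) {a b : X → ℝ}
    (ha : Continuous a) (hb : Continuous b) (hbJ : ∀ y, b y ∈ J) :
    Continuous fun y => g (a y) (b y) :=
  hg.comp_continuous (ha.prodMk hb) fun y => ⟨trivial, hbJ y⟩

lemma continuous_laxX (hq : IsClassicalNLS J q) (k : ℂ) {t : ℝ} (ht : t ∈ J) :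
    Continuous fun x => laxX q k x t := by
  unfold laxX
  exact continuous_const.add (continuous_offDiag.comp (hq.continuous_q ht))

lemma hasDerivAt_conj {f : ℝ → ℂ} {f' : ℂ} {x : ℝ} (h : HasDerivAt f f' x) :
    HasDerivAt (fun y => starRingEnd ℂ (f y)) (starRingEnd ℂ f') x := h.star

/-- The zero curvature relation: `T v` solves the variational equation of the `x`-part. -/
lemma hasDerivAt_laxT_mulVec (hq : IsClassicalNLS J q) {k : ℂ} {t : ℝ} (ht : t ∈ J)
    {v : ℝ → Fin 2 → ℂ} {x : ℝ} (hv : HasDerivAt v ((laxX q k x t).mulVec (v x)) x) :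
    HasDerivAt (fun y => (laxT q k y t).mulVec (v y))
      ((laxX q k x t).mulVec ((laxT q k x t).mulVec (v x)) +
        (offDiag (dT J q x t)).mulVec (v x)) x := by
  have h0 := hq.hasDerivAt_q ht x
  have h1 := hq.hasDerivAt_dX ht x
  have h0c := hasDerivAt_conj h0
  have h1c := hasDerivAt_conj h1
  have heq := hq.eqn x t ht
  -- The equation solved for q_t. This is the only use of the NLS equation itself; everything else
  -- uses regularity and decay.
  have hqt : dT J q x t = I * dX (dX q) x t + 2 * I * (q x t * starRingEnd ℂ (q x t)) * q x t := by
    rw [mul_conj, normSq_eq_norm_sq]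
    linear_combination (-I) * heq + dT J q x t * I_sq
  have hqtc : starRingEnd ℂ (dT J q x t) = -I * starRingEnd ℂ (dX (dX q) x t) -
      2 * I * (q x t * starRingEnd ℂ (q x t)) * starRingEnd ℂ (q x t) := by
    rw [hqt]
    simp only [map_add, map_mul, conj_I, conj_conj, map_ofNat]
    ring
  rw [laxX_mulVec, hasDerivAt_pair] at hv
  obtain ⟨hv0, hv1⟩ := hv
  simp only [laxT_mulVec]
  have e : (laxX q k x t).mulVec
        ![(-2 * I * k ^ 2 + I * (q x t * starRingEnd ℂ (q x t))) * v x 0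
          + (I * dX q x t - 2 * k * q x t) * v x 1,
        (I * starRingEnd ℂ (dX q x t) + 2 * k * starRingEnd ℂ (q x t)) * v x 0
          + (2 * I * k ^ 2 - I * (q x t * starRingEnd ℂ (q x t))) * v x 1] +
        (offDiag (dT J q x t)).mulVec (v x) =
      ![I * k * ((-2 * I * k ^ 2 + I * (q x t * starRingEnd ℂ (q x t))) * v x 0
          + (I * dX q x t - 2 * k * q x t) * v x 1) + q x t *
          ((I * starRingEnd ℂ (dX q x t) + 2 * k * starRingEnd ℂ (q x t)) * v x 0
          + (2 * I * k ^ 2 - I * (q x t * starRingEnd ℂ (q x t))) * v x 1) + dT J q x t * v x 1,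
        -(I * k * ((I * starRingEnd ℂ (dX q x t) + 2 * k * starRingEnd ℂ (q x t)) * v x 0
          + (2 * I * k ^ 2 - I * (q x t * starRingEnd ℂ (q x t))) * v x 1)) - starRingEnd ℂ (q x t) *
          ((-2 * I * k ^ 2 + I * (q x t * starRingEnd ℂ (q x t))) * v x 0
          + (I * dX q x t - 2 * k * q x t) * v x 1) - starRingEnd ℂ (dT J q x t) * v x 0] := by
    rw [laxX_mulVec]
    ext i
    fin_cases i
    · simp [offDiag, dotProduct, Fin.sum_univ_two]
    · simp [offDiag, dotProduct, Fin.sum_univ_two]; ring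
  rw [e, hasDerivAt_pair, hqtc, hqt]
  constructor
  · refine (((((h0.mul h0c).const_mul I).const_add (-2 * I * k ^ 2)).mul hv0).add
      (((h1.const_mul I).sub (h0.const_mul (2 * k))).mul hv1)).congr_deriv ?_
    simp only [Pi.mul_apply, Pi.sub_apply]
    linear_combination (-2 * dX q x t * k * v x 1) * I_sq
  · refine ((((h1c.const_mul I).add (h0c.const_mul (2 * k))).mul hv0).add
      ((((h0.mul h0c).const_mul I).const_sub (2 * I * k ^ 2)).mul hv1)).congr_deriv ?_
    simp only [Pi.mul_apply, Pi.add_apply]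
    linear_combination (2 * k * starRingEnd ℂ (dX q x t) * v x 0) * I_sq

lemma offDiag_add (a b : ℂ) : offDiag (a + b) = offDiag a + offDiag b := by
  ext i j
  fin_cases i <;> fin_cases j <;> simp [offDiag]; ring

lemma offDiag_smul (c : ℝ) (a : ℂ) : offDiag (c • a) = (c : ℂ) • offDiag a := by
  ext i j
  fin_cases i <;> fin_cases j <;> simp [offDiag]

/-- Locally uniform differentiability of the potential in time. -/
lemma IsClassicalNLS.eventually_norm_sub_le (hJ : IsTimeDomain J) (hq : IsClassicalNLS J q) {t : ℝ}
    (ht : t ∈ J) (X : ℝ) {ε : ℝ} (hε : 0 < ε) : ∀ᶠ s in 𝓝[J] t, ∀ x, |x| ≤ X →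
      ‖q x s - q x t - ((s - t : ℝ) : ℂ) * dT J q x t‖ ≤ ε * ‖s - t‖ := by
  obtain ⟨ρ, hρc, hρJ, hρ⟩ := hJ.exists_retraction
  have hc : Continuous fun z : ℝ × ℝ => dT J q z.2 (ρ z.1) :=
    continuous_slice hq.cont_t continuous_snd (hρc.comp continuous_fst) fun z => hρJ _
  have hc2 : Continuous fun z : ℝ × ℝ => dT J q z.2 t :=
    continuous_slice hq.cont_t continuous_snd continuous_const fun z => ht
  -- Compactness makes the continuity of q_t at time t uniform in |x| ≤ X; the mean value inequality
  -- in time then gives the claim.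
  have h1 : ∀ᶠ s in 𝓝 t, ∀ x ∈ Set.Icc (-X) X, ‖dT J q x (ρ s) - dT J q x t‖ < ε := by
    refine isCompact_Icc.eventually_forall_of_forall_eventually fun x _ => ?_
    have h2 : Continuous fun z : ℝ × ℝ => ‖dT J q z.2 (ρ z.1) - dT J q z.2 t‖ := (hc.sub hc2).norm
    refine h2.continuousAt.eventually_lt continuousAt_const ?_
    simpa [hρ t ht] using hε
  obtain ⟨δ, hδ, hball⟩ := Metric.eventually_nhds_iff_ball.1 h1
  filter_upwards [inter_mem_nhdsWithin J (Metric.ball_mem_nhds t hδ)] with s hs x hx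
  have hconv : Convex ℝ (J ∩ Metric.ball t δ) := hJ.convex.inter (convex_ball t δ)
  have hd : ∀ τ ∈ J ∩ Metric.ball t δ,
      HasDerivWithinAt (fun τ : ℝ => q x τ - ((τ - t : ℝ) : ℂ) * dT J q x t)
        (dT J q x τ - dT J q x t) (J ∩ Metric.ball t δ) τ := by
    intro τ hτ
    have h3 : HasDerivWithinAt (fun τ => q x τ) (dT J q x τ) J τ :=
      (hq.diff_t x τ hτ.1).hasDerivWithinAt
    have h4 : HasDerivAt (fun τ : ℝ => ((τ - t : ℝ) : ℂ) * dT J q x t) (dT J q x t) τ := by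
      have := (((hasDerivAt_id τ).sub_const t).ofReal_comp).mul_const (dT J q x t)
      simpa using this
    exact (h3.mono Set.inter_subset_left).sub h4.hasDerivWithinAt
  have := hconv.norm_image_sub_le_of_norm_hasDerivWithin_le (C := ε) hd (fun τ hτ => by
    have := hball τ hτ.2 x (abs_le.1 hx)
    rw [hρ τ hτ.1] at this
    exact this.le) ⟨ht, Metric.mem_ball_self hδ⟩ hs
  simpa [sub_right_comm] using this

lemma norm_toRealCLM_offDiag_le (w : ℂ) : ‖toRealCLM (offDiag w)‖ ≤ ‖w‖ :=
  ContinuousLinearMap.opNorm_le_bound _ (norm_nonneg _) fun v => norm_offDiag_mulVec_le w v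

/-- Existence of simultaneous solutions of the Lax pair, entire in the spectral parameter. -/
theorem exists_laxSolution (hJ : IsTimeDomain J) (hq : IsClassicalNLS J q) (v0 : Fin 2 → ℂ) :
    ∃ Y : ℝ → ℝ → ℂ → Fin 2 → ℂ, (∀ k, IsLaxSolution J q k fun x t => Y x t k) ∧
      (∀ k, Y 0 0 k = v0) ∧ ∀ x, ∀ t ∈ J, Differentiable ℂ (Y x t) := by
  obtain ⟨ρ, hρc, hρJ, hρ⟩ := hJ.exists_retraction
  have hTc : ∀ k : ℂ, Continuous fun t => laxT q k 0 (ρ t) := by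
    intro k
    have c0 : Continuous fun t => offDiag (q 0 (ρ t)) :=
      continuous_offDiag.comp (continuous_slice hq.cont continuous_const hρc hρJ)
    have c1 : Continuous fun t => offDiag (dX q 0 (ρ t)) :=
      continuous_offDiag.comp (continuous_slice hq.cont_x continuous_const hρc hρJ)
    unfold laxT
    exact (continuous_const.add ((continuous_const.matrix_mul
      (c1.sub (c0.matrix_mul c0))).const_smul I)).sub (c0.const_smul (2 * k))
  have hXc : ∀ (k : ℂ) (t : ℝ), Continuous fun x => laxX q k x (ρ t) := fun k t =>
    continuous_laxX hq k (hρJ t)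
  -- `h` solves the t-equation along x = 0, and `y` solves the x-equation at each time with `h` as
  -- initial data.
  choose h hh0 hh using fun k : ℂ => exists_affine_ode (fun t => toCLM (laxT q k 0 (ρ t)))
    (continuous_toCLM.comp (hTc k)) (fun _ => 0) continuous_const v0
  choose y hy0 hy using fun (k : ℂ) (t : ℝ) => exists_affine_ode
    (fun x => toCLM (laxX q k x (ρ t))) (continuous_toCLM.comp (hXc k t)) (fun _ => 0)
    continuous_const (h k t)
  simp only [add_zero, toCLM_apply] at hh hy
  have hyx : ∀ k, ∀ t ∈ J, ∀ x, HasDerivAt (y k t) ((laxX q k x t).mulVec (y k t x)) x := by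
    intro k t ht x
    have := hy k t x
    rwa [hρ t ht] at this
  refine ⟨fun x t k => y k t x, fun k => ⟨fun x t ht => hyx k t ht x, fun x t ht => ?_⟩,
    fun k => (hy0 k 0).trans (hh0 k), fun x t ht k => ?_⟩
  -- Time is treated as a parameter of the x-equation. By zero curvature Tv solves the variational
  -- equation, and at x = 0 it equals the t-derivative of the initial data, so it is v_t.
  · refine hasDerivWithinAt_ode_param (𝕜 := ℝ) (S := J) (s0 := t)
      (A := fun x s => toRealCLM (laxX q k x (ρ s)))
      (A' := fun x => toRealCLM (offDiag (dT J q x t))) (Y := fun x s => y k s x)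
      (G := fun x => (laxT q k x t).mulVec (y k t x))
      (continuous_toRealCLM.comp (hXc k t))
      (continuous_toRealCLM.comp (continuous_offDiag.comp
        (continuous_slice hq.cont_t continuous_id continuous_const fun _ => ht)))
      ?_ (fun x => hy k t x) (Eventually.of_forall fun s x => hy k s x)
      (fun x => by
        have := hasDerivAt_laxT_mulVec hq ht (hyx k t ht x)
        simpa only [toRealCLM_apply, hρ t ht] using this)
      ?_ x
    · intro X ε hε
      filter_upwards [hq.eventually_norm_sub_le hJ ht X hε, self_mem_nhdsWithin] with s hs hsJ x hx
      have e : toRealCLM (laxX q k x (ρ s)) - toRealCLM (laxX q k x (ρ t)) -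
          (s - t) • toRealCLM (offDiag (dT J q x t)) =
          toRealCLM (offDiag (q x s - q x t - ((s - t : ℝ) : ℂ) * dT J q x t)) := by
        ext1 v
        have e2 : q x s = (q x s - q x t - ((s - t : ℝ) : ℂ) * dT J q x t) + q x t +
            (s - t) • dT J q x t := by
          rw [real_smul]; ring
        have e3 : offDiag (q x s) = offDiag (q x s - q x t - ((s - t : ℝ) : ℂ) * dT J q x t) +
            offDiag (q x t) + ((s - t : ℝ) : ℂ) • offDiag (dT J q x t) := by
          conv_lhs => rw [e2]
          rw [offDiag_add, offDiag_add, offDiag_smul]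
        simp only [sub_apply, smul_apply, toRealCLM_apply, hρ s hsJ, hρ t ht, laxX, e3,
          Matrix.add_mulVec, Matrix.smul_mulVec]
        ext i
        simp only [Pi.sub_apply, Pi.add_apply, Pi.smul_apply, real_smul, smul_eq_mul]
        ring
      rw [e]
      exact (norm_toRealCLM_offDiag_le _).trans (hs x hx)
    · have h1 : (fun s => y k s 0) = h k := by funext s; rw [hy0]
      change HasDerivWithinAt (fun s => y k s 0) ((laxT q k 0 t).mulVec (y k t 0)) J t
      rw [h1, hy0]
      have := hh k t
      rw [hρ t ht] at this
      exact this.hasDerivWithinAt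
  -- Differentiability in k is proved in the same two stages, first along x = 0 and then in x.
  · have hh_diff : ∀ τ, ∃ g, HasDerivAt (fun κ => h κ τ) g k := by
      set T' : ℝ → Mat2 := fun τ => (-4 * I * k) • sigma3 - (2 : ℂ) • offDiag (q 0 (ρ τ)) with hT'
      have hT'c : Continuous T' := by
        have c0 : Continuous fun t => offDiag (q 0 (ρ t)) :=
          continuous_offDiag.comp (continuous_slice hq.cont continuous_const hρc hρJ)
        exact continuous_const.sub (c0.const_smul (2 : ℂ))
      have hhc : Continuous (h k) := continuous_iff_continuousAt.2 fun τ => (hh k τ).continuousAt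
      obtain ⟨G, hG0, hG⟩ := exists_affine_ode (fun t => toCLM (laxT q k 0 (ρ t)))
        (continuous_toCLM.comp (hTc k)) (fun τ => toCLM (T' τ) (h k τ))
        ((continuous_toCLM.comp hT'c).clm_apply hhc) 0
      intro τ
      refine ⟨G τ, ?_⟩
      rw [← hasDerivWithinAt_univ]
      refine hasDerivWithinAt_ode_param (𝕜 := ℂ) (S := Set.univ) (s0 := k)
        (A := fun τ κ => toCLM (laxT q κ 0 (ρ τ))) (A' := fun τ => toCLM (T' τ))
        (Y := fun τ κ => h κ τ) (continuous_toCLM.comp (hTc k)) (continuous_toCLM.comp hT'c)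
        ?_ (hh k) (Eventually.of_forall hh) hG ?_ τ
      · intro X ε hε
        have : ∀ᶠ κ : ℂ in 𝓝 k, ‖κ - k‖ < ε / 2 := by
          filter_upwards [Metric.ball_mem_nhds k (half_pos hε)] with κ hκ
          rwa [← dist_eq_norm]
        rw [nhdsWithin_univ]
        filter_upwards [this] with κ hκ x _
        refine ContinuousLinearMap.opNorm_le_bound _ (by positivity) fun v => ?_
        -- T is quadratic in k with leading part -2ik²σ₃, so this is its exact Taylor remainder. For
        -- X, which is affine in k, the corresponding remainder below is zero.
        have e : (toCLM (laxT q κ 0 (ρ x)) - toCLM (laxT q k 0 (ρ x)) - (κ - k) • toCLM (T' x)) v =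
            (-2 * I * (κ - k) ^ 2) • sigma3.mulVec v := by
          simp only [sub_apply, smul_apply, toCLM_apply, laxT, hT', Matrix.add_mulVec,
            Matrix.sub_mulVec, Matrix.smul_mulVec]
          ext i
          simp only [Pi.sub_apply, Pi.add_apply, Pi.smul_apply, smul_eq_mul]
          ring
        rw [e, norm_smul]
        have h2 : ‖-2 * I * (κ - k) ^ 2‖ = 2 * ‖κ - k‖ * ‖κ - k‖ := by
          simp [pow_two]; ring
        rw [h2]
        refine mul_le_mul ?_ (norm_sigma3_mulVec_le v) (norm_nonneg _) (by positivity)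
        gcongr
        linarith
      · have : (fun κ => h κ 0) = fun _ => v0 := funext hh0
        change HasDerivWithinAt (fun κ => h κ 0) (G 0) _ _
        rw [this, hG0]
        exact hasDerivWithinAt_const _ _ _
    obtain ⟨g, hg⟩ := hh_diff t
    have hyc : Continuous (y k t) := continuous_iff_continuousAt.2 fun x => (hy k t x).continuousAt
    obtain ⟨G, hG0, hG⟩ := exists_affine_ode (fun x => toCLM (laxX q k x (ρ t)))
      (continuous_toCLM.comp (hXc k t)) (fun x => toCLM (I • sigma3) (y k t x))
      ((toCLM (I • sigma3)).continuous.comp hyc) g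
    have : HasDerivWithinAt (fun κ => y κ t x) (G x) Set.univ k := by
      refine hasDerivWithinAt_ode_param (𝕜 := ℂ) (S := Set.univ) (s0 := k)
        (A := fun x κ => toCLM (laxX q κ x (ρ t))) (A' := fun _ => toCLM (I • sigma3))
        (Y := fun x κ => y κ t x) (continuous_toCLM.comp (hXc k t)) continuous_const
        ?_ (hy k t) (Eventually.of_forall fun κ => hy κ t) hG ?_ x
      · intro X ε hε
        refine Eventually.of_forall fun κ x _ => ?_
        have e : toCLM (laxX q κ x (ρ t)) - toCLM (laxX q k x (ρ t)) -
            (κ - k) • toCLM (I • sigma3) = 0 := by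
          rw [← map_sub, ← map_smul, ← map_sub, ← map_zero toCLM]
          congr 1
          simp only [laxX]
          module
        rw [e, norm_zero]
        positivity
      · have : (fun κ => y κ t 0) = fun κ => h κ t := funext fun κ => hy0 κ t
        change HasDerivWithinAt (fun κ => y κ t 0) (G 0) _ _
        rw [this, hG0, hasDerivWithinAt_univ]
        exact hg
    rw [hasDerivWithinAt_univ] at this
    exact this.differentiableAt

/-! ### Uniqueness, Wronskians and the normalized solution -/

lemma wr_deriv_x {k : ℂ} {x t : ℝ} {v w : ℝ → Fin 2 → ℂ}
    (hv : HasDerivAt v ((laxX q k x t).mulVec (v x)) x)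
    (hw : HasDerivAt w ((laxX q k x t).mulVec (w x)) x) :
    HasDerivAt (fun y => wr (v y) (w y)) 0 x := by
  rw [laxX_mulVec, hasDerivAt_pair] at hv hw
  refine ((hv.1.mul hw.2).sub (hv.2.mul hw.1)).congr_deriv ?_
  ring

lemma hasDerivWithinAt_pair {v : ℝ → Fin 2 → ℂ} {a b : ℂ} {s : ℝ} {S : Set ℝ} :
    HasDerivWithinAt v ![a, b] S s ↔
      HasDerivWithinAt (fun y => v y 0) a S s ∧ HasDerivWithinAt (fun y => v y 1) b S s := by
  rw [hasDerivWithinAt_pi]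
  simp [Fin.forall_fin_two]

/-- Both Lax matrices are trace-free, so the Wronskian is constant in x at time t and then constant
in t along x = 0. -/
lemma IsLaxSolution.wr_eq (hJ : IsTimeDomain J) {k : ℂ} {v w : ℝ → ℝ → Fin 2 → ℂ}
    (hv : IsLaxSolution J q k v) (hw : IsLaxSolution J q k w) (x : ℝ) {t : ℝ} (ht : t ∈ J) :
    wr (v x t) (w x t) = wr (v 0 0) (w 0 0) := by
  have h1 : wr (v x t) (w x t) = wr (v 0 t) (w 0 t) :=
    is_const_of_deriv_eq_zero (f := fun y => wr (v y t) (w y t))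
      (fun y => (wr_deriv_x (hv.eq_x y t ht) (hw.eq_x y t ht)).differentiableAt)
      (fun y => (wr_deriv_x (hv.eq_x y t ht) (hw.eq_x y t ht)).deriv) x 0
  rw [h1]
  have := hJ.norm_le_exp (f := fun s => wr (v 0 s) (w 0 s) - wr (v 0 0) (w 0 0)) (f' := fun _ => 0)
    (K := 0) ht (fun s hs => by
      have h2 := hv.eq_t 0 s hs
      have h3 := hw.eq_t 0 s hs
      rw [laxT_mulVec, hasDerivWithinAt_pair] at h2 h3
      refine (((h2.1.mul h3.2).sub (h2.2.mul h3.1)).sub_const _).congr_deriv ?_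
      ring) (fun s _ _ => by simp)
  simp only [sub_self, norm_zero, zero_mul] at this
  exact sub_eq_zero.1 (norm_le_zero_iff.1 this)

lemma lax_unique_x (hq : IsClassicalNLS J q) {k : ℂ} {t : ℝ} (ht : t ∈ J) {v w : ℝ → Fin 2 → ℂ}
    (hv : ∀ x, HasDerivAt v ((laxX q k x t).mulVec (v x)) x)
    (hw : ∀ x, HasDerivAt w ((laxX q k x t).mulVec (w x)) x) (h0 : v 0 = w 0) : v = w :=
  linear_ode_unique (A := fun x => toCLM (laxX q k x t))
    (continuous_toCLM.comp (continuous_laxX hq k ht)) hv hw h0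

lemma IsLaxSolution.unique (hJ : IsTimeDomain J) (hq : IsClassicalNLS J q) {k : ℂ}
    {v w : ℝ → ℝ → Fin 2 → ℂ} (hv : IsLaxSolution J q k v) (hw : IsLaxSolution J q k w)
    (h0 : v 0 0 = w 0 0) (x : ℝ) {t : ℝ} (ht : t ∈ J) : v x t = w x t := by
  obtain ⟨ρ, hρc, hρJ, hρ⟩ := hJ.exists_retraction
  have h1 : v 0 t = w 0 t := by
    have hTc : Continuous fun t => toCLM (laxT q k 0 (ρ t)) := by
      have c0 : Continuous fun t => offDiag (q 0 (ρ t)) :=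
        continuous_offDiag.comp (continuous_slice hq.cont continuous_const hρc hρJ)
      have c1 : Continuous fun t => offDiag (dX q 0 (ρ t)) :=
        continuous_offDiag.comp (continuous_slice hq.cont_x continuous_const hρc hρJ)
      unfold laxT
      exact continuous_toCLM.comp ((continuous_const.add ((continuous_const.matrix_mul
        (c1.sub (c0.matrix_mul c0))).const_smul I)).sub (c0.const_smul (2 * k)))
    obtain ⟨C, hC⟩ := (isCompact_Icc (a := -|t|) (b := |t|)).exists_bound_of_continuousOn
      hTc.continuousOn
    have := hJ.norm_le_exp (f := fun s => v 0 s - w 0 s)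
      (f' := fun s => (laxT q k 0 s).mulVec (v 0 s) - (laxT q k 0 s).mulVec (w 0 s))
      (K := C) ht (fun s hs => (hv.eq_t 0 s hs).sub (hw.eq_t 0 s hs)) (fun s hs hst => by
        rw [← Matrix.mulVec_sub, ← toCLM_apply]
        refine ((toCLM (laxT q k 0 s)).le_opNorm _).trans ?_
        have := hC s (abs_le.1 hst)
        rw [hρ s hs] at this
        gcongr)
    simp only [h0, sub_self, norm_zero, zero_mul] at this
    exact sub_eq_zero.1 (norm_le_zero_iff.1 this)
  exact congrFun (lax_unique_x hq ht (fun x => hv.eq_x x t ht) (fun x => hw.eq_x x t ht) h1) x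

lemma IsLaxSolution.linear {k : ℂ} {v w : ℝ → ℝ → Fin 2 → ℂ}
    (hv : IsLaxSolution J q k v) (hw : IsLaxSolution J q k w) (a b : ℂ) :
    IsLaxSolution J q k fun x t => a • v x t + b • w x t := by
  constructor
  · intro x t ht
    rw [Matrix.mulVec_add, Matrix.mulVec_smul, Matrix.mulVec_smul]
    exact ((hv.eq_x x t ht).const_smul a).add ((hw.eq_x x t ht).const_smul b)
  · intro x t ht
    rw [Matrix.mulVec_add, Matrix.mulVec_smul, Matrix.mulVec_smul]
    exact ((hv.eq_t x t ht).const_smul a).add ((hw.eq_t x t ht).const_smul b)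

lemma exists_normalizedLax (hJ : IsTimeDomain J) (hq : IsClassicalNLS J q) :
    ∃ Y : ℝ → ℝ → ℂ → Mat2, (∀ k, IsNormalizedLax J q k fun x t => Y x t k) ∧
      ∀ x, ∀ t ∈ J, ∀ i j, Differentiable ℂ fun k => Y x t k i j := by
  choose Y hY h0 hd using fun j : Fin 2 =>
    exists_laxSolution hJ hq (fun i => (1 : Mat2) i j)
  refine ⟨fun x t k => Matrix.of fun i j => Y j x t k i, fun k => ⟨fun j => hY j k, ?_⟩,
    fun x t ht i j => ?_⟩
  · ext i j
    simp [h0]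
  · have := hd j x t ht
    rw [differentiable_pi] at this
    exact this i

lemma isNormalizedLax_Psi (hJ : IsTimeDomain J) (hq : IsClassicalNLS J q) (k : ℂ) :
    IsNormalizedLax J q k fun x t => Psi J q x t k := by
  obtain ⟨Y, hY, -⟩ := exists_normalizedLax hJ hq
  exact Classical.epsilon_spec (p := IsNormalizedLax J q k) ⟨_, hY k⟩

lemma Psi_zero (hJ : IsTimeDomain J) (hq : IsClassicalNLS J q) (k : ℂ) : Psi J q 0 0 k = 1 :=
  (isNormalizedLax_Psi hJ hq k).init

/-- `Psi` is chosen separately for each k, so regularity in k is not built in; uniqueness identifies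
it with the entire family already constructed. -/
lemma differentiable_Psi (hJ : IsTimeDomain J) (hq : IsClassicalNLS J q) (x : ℝ) {t : ℝ}
    (ht : t ∈ J) (i j : Fin 2) : Differentiable ℂ fun k => Psi J q x t k i j := by
  obtain ⟨Y, hY, hd⟩ := exists_normalizedLax hJ hq
  have : (fun k => Psi J q x t k i j) = fun k => Y x t k i j := by
    funext k
    have hu := ((isNormalizedLax_Psi hJ hq k).lax j).unique hJ hq ((hY k).lax j)
      (by simp only [Psi_zero hJ hq, (hY k).init]) x ht
    exact congrFun hu i
  rw [this]
  exact hd x t ht i j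

lemma isLaxSolution_Psi_mulVec (hJ : IsTimeDomain J) (hq : IsClassicalNLS J q) (k : ℂ)
    (a : Fin 2 → ℂ) : IsLaxSolution J q k fun x t => (Psi J q x t k).mulVec a := by
  have h := ((isNormalizedLax_Psi hJ hq k).lax 0).linear ((isNormalizedLax_Psi hJ hq k).lax 1)
    (a 0) (a 1)
  have e : (fun x t => (Psi J q x t k).mulVec a) = fun x t =>
      a 0 • (fun i => Psi J q x t k i 0) + a 1 • fun i => Psi J q x t k i 1 := by
    funext x t i
    simp [Matrix.mulVec, dotProduct, Fin.sum_univ_two, mul_comm]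
  rw [e]
  exact h

/-- Since Ψ is entire in k, this transfers continuity and analyticity in k from the origin to every
(x, t), and it produces the jump on the circle. -/
lemma IsLaxSolution.eq_Psi_mulVec (hJ : IsTimeDomain J) (hq : IsClassicalNLS J q) {k : ℂ}
    {v : ℝ → ℝ → Fin 2 → ℂ} (hv : IsLaxSolution J q k v) (x : ℝ) {t : ℝ} (ht : t ∈ J) :
    v x t = (Psi J q x t k).mulVec (v 0 0) :=
  hv.unique hJ hq (isLaxSolution_Psi_mulVec hJ hq k (v 0 0)) (by simp [Psi_zero hJ hq]) x ht

lemma det_Psi (hJ : IsTimeDomain J) (hq : IsClassicalNLS J q) (k : ℂ) (x : ℝ) {t : ℝ}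
    (ht : t ∈ J) : (Psi J q x t k).det = 1 := by
  have h := ((isNormalizedLax_Psi hJ hq k).lax 0).wr_eq hJ ((isNormalizedLax_Psi hJ hq k).lax 1) x ht
  simp only [Psi_zero hJ hq] at h
  rw [Matrix.det_fin_two]
  simp only [wr, Matrix.one_apply] at h
  simp at h
  linear_combination h

end

/-! ### Tails of integrable functions -/

/-- `T` bounds the tails of the integrals of the nonnegative continuous function `n`. -/
structure HasTail (n T : ℝ → ℝ) : Prop where
  cont : Continuous n
  nonneg : ∀ y, 0 ≤ n y
  le : ∀ y L, y ≤ L → ∫ s in y..L, n s ≤ T y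
  tendsto : Tendsto T atTop (𝓝 0)

lemma HasTail.tail_nonneg {n T : ℝ → ℝ} (h : HasTail n T) (y : ℝ) : 0 ≤ T y := by
  simpa using h.le y y le_rfl

lemma hasTail_of_integrableOn {n : ℝ → ℝ} (hc : Continuous n) (h0 : ∀ y, 0 ≤ n y)
    (hi : MeasureTheory.IntegrableOn n (Set.Ioi 0)) : ∃ T, HasTail n T := by
  have hi' : ∀ y, MeasureTheory.IntegrableOn n (Set.Ioi y) := by
    intro y
    have h1 : MeasureTheory.IntegrableOn n (Set.Icc y 0) := hc.integrableOn_Icc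
    refine (h1.union hi).mono_set fun z hz => ?_
    rcases le_or_gt z 0 with h | h
    · exact Or.inl ⟨le_of_lt hz, h⟩
    · exact Or.inr h
  refine ⟨fun y => ∫ s in Set.Ioi y, n s, hc, h0, fun y L hyL => ?_, ?_⟩
  · rw [intervalIntegral.integral_of_le hyL]
    exact MeasureTheory.setIntegral_mono_set (hi' y) (Eventually.of_forall h0)
      (Set.Ioc_subset_Ioi_self.eventuallyLE)
  · have h1 := MeasureTheory.intervalIntegral_tendsto_integral_Ioi 0 hi tendsto_id
    have h2 : ∀ᶠ y in atTop, (∫ s in Set.Ioi 0, n s) - ∫ s in (0 : ℝ)..y, n s =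
        ∫ s in Set.Ioi y, n s := by
      filter_upwards [eventually_ge_atTop 0] with y hy
      rw [sub_eq_iff_eq_add', intervalIntegral.integral_of_le hy,
        ← MeasureTheory.setIntegral_union (Set.Ioc_disjoint_Ioi le_rfl) measurableSet_Ioi
          ((hi' 0).mono_set Set.Ioc_subset_Ioi_self) (hi' y), Set.Ioc_union_Ioi_eq_Ioi hy]
    have h3 := h1.const_sub (∫ s in Set.Ioi 0, n s)
    rw [sub_self] at h3
    exact h3.congr' h2

lemma HasTail.const_mul {n T : ℝ → ℝ} (h : HasTail n T) {c : ℝ} (hc : 0 ≤ c) :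
    HasTail (fun y => c * n y) fun y => c * T y := by
  refine ⟨continuous_const.mul h.cont, fun y => mul_nonneg hc (h.nonneg y), fun y L hyL => ?_, ?_⟩
  · rw [intervalIntegral.integral_const_mul]
    exact mul_le_mul_of_nonneg_left (h.le y L hyL) hc
  · simpa using h.tendsto.const_mul c

/-! ### Spatial ends -/

lemma SpatialEnd.sgn_sq (e : SpatialEnd) : e.sgn * e.sgn = 1 := by
  cases e <;> simp [SpatialEnd.sgn]

lemma SpatialEnd.abs_sgn (e : SpatialEnd) : |e.sgn| = 1 := by
  cases e <;> simp [SpatialEnd.sgn]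

lemma SpatialEnd.tendsto_sgn_mul (e : SpatialEnd) :
    Tendsto (fun y : ℝ => e.sgn * y) atTop e.toFilter := by
  cases e
  · simp only [SpatialEnd.sgn, SpatialEnd.toFilter, one_mul]
    exact tendsto_id
  · simpa [SpatialEnd.sgn, SpatialEnd.toFilter] using tendsto_neg_atTop_atBot

lemma SpatialEnd.tendsto_sgn_mul' (e : SpatialEnd) :
    Tendsto (fun x : ℝ => e.sgn * x) e.toFilter atTop := by
  cases e
  · simp only [SpatialEnd.sgn, SpatialEnd.toFilter, one_mul]
    exact tendsto_id
  · simpa [SpatialEnd.sgn, SpatialEnd.toFilter] using tendsto_neg_atBot_atTop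

lemma SpatialEnd.tendsto_iff (e : SpatialEnd) {α : Type*} {f : ℝ → α} {l : Filter α} :
    Tendsto f e.toFilter l ↔ Tendsto (fun y => f (e.sgn * y)) atTop l := by
  refine ⟨fun h => h.comp e.tendsto_sgn_mul, fun h => ?_⟩
  have := h.comp e.tendsto_sgn_mul'
  refine this.congr fun x => ?_
  simp only [Function.comp_apply]
  rw [← mul_assoc, e.sgn_sq, one_mul]

lemma SpatialEnd.integrableOn_comp (e : SpatialEnd) {f : ℝ → ℂ}
    (h : MeasureTheory.IntegrableOn f e.halfLine) :
    MeasureTheory.IntegrableOn (fun y => f (e.sgn * y)) (Set.Ioi 0) := by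
  cases e
  · simpa [SpatialEnd.sgn, SpatialEnd.halfLine] using h
  · have h2 := ((MeasureTheory.Measure.measurePreserving_neg
      (MeasureTheory.volume : MeasureTheory.Measure ℝ)).integrableOn_comp_preimage
      (Homeomorph.neg ℝ).measurableEmbedding (f := f) (s := Set.Iio 0)).2 h
    simpa [SpatialEnd.sgn, Function.comp_def] using h2

/-! ### Solutions of the `x`-equation near one end -/

/-- The sign of `Im k` for which column `j` of the Jost solution at the end `e` is defined. -/
def jostSign (e : SpatialEnd) (j : Fin 2) : ℝ := e.sgn * (if j = 0 then 1 else -1)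

/-- The set of spectral parameters for which column `j` of the Jost solution at `e` is defined. -/
def jostRegion (p : Params) (e : SpatialEnd) (j : Fin 2) : Set ℂ :=
  {k | k ∉ branchCut p e ∧ 0 ≤ jostSign e j * k.im}

lemma colSign_eq (j : Fin 2) : colSign j = ((if j = 0 then 1 else -1 : ℝ) : ℂ) := by
  unfold colSign; split_ifs <;> simp

/-- Column `j` of `d_±⁻¹ e^{-i f_± σ₃} E_±`. -/
def jostVec (p : Params) (e : SpatialEnd) (j : Fin 2) (k : ℂ) (x t : ℝ) : Fin 2 → ℂ :=
  fun i => (dEnd p e k)⁻¹ * (expSigma3 (-(I * (bgPhase p e x t : ℂ))) * matE p e k) i j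

lemma jostVec_zero (p : Params) (e : SpatialEnd) (j : Fin 2) (k : ℂ) (x t : ℝ) :
    jostVec p e j k x t 0 = (dEnd p e k)⁻¹ * (exp (-(I * (bgPhase p e x t : ℂ))) *
      ((Pi.single j 1 : Fin 2 → ℂ) 0 +
        cEnd p e k * epsEnd p e * (Pi.single j 1 : Fin 2 → ℂ) 1)) := by
  rw [jostVec, matE_eq]
  fin_cases j <;> simp [expSigma3, Matrix.mul_apply, Fin.sum_univ_two]

lemma jostVec_one (p : Params) (e : SpatialEnd) (j : Fin 2) (k : ℂ) (x t : ℝ) :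
    jostVec p e j k x t 1 = (dEnd p e k)⁻¹ * (exp (I * (bgPhase p e x t : ℂ)) *
      ((Pi.single j 1 : Fin 2 → ℂ) 1 +
        cEnd p e k * (epsEnd p e)⁻¹ * (Pi.single j 1 : Fin 2 → ℂ) 0)) := by
  rw [jostVec, matE_eq]
  fin_cases j <;> simp [expSigma3, Matrix.mul_apply, Fin.sum_univ_two]

/-- The real parts of the exponents of the half-line system. -/
def jostExp (p : Params) (e : SpatialEnd) (j : Fin 2) (k : ℂ) (i : Fin 2) : ℂ :=
  (e.sgn : ℂ) * (I * lamEnd p e k * (colSign i - colSign j))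

lemma jostExp_self (p : Params) (e : SpatialEnd) (j : Fin 2) (k : ℂ) : jostExp p e j k j = 0 := by
  simp [jostExp]

lemma jostExp_re (p : Params) (e : SpatialEnd) (j : Fin 2) (k : ℂ) {i : Fin 2} (hij : i ≠ j) :
    (jostExp p e j k i).re = 2 * (jostSign e j * (lamEnd p e k).im) := by
  have h : colSign i - colSign j = ((-2 * (if j = 0 then 1 else -1) : ℝ) : ℂ) := by
    fin_cases i <;> fin_cases j <;> simp [colSign] at hij ⊢ <;> norm_num
  rw [jostExp, h, re_ofReal_mul, re_mul_ofReal, I_mul_re, jostSign]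
  ring

/-- The solution `v` in asymptotic coordinates, with `y = ± x`. -/
def jostPath (p : Params) (e : SpatialEnd) (j : Fin 2) (k : ℂ) (t : ℝ) (v : ℝ → Fin 2 → ℂ)
    (y : ℝ) : Fin 2 → ℂ := jostCoord p e j k (e.sgn * y) t (v (e.sgn * y))

lemma jostCoord_sub (p : Params) (e : SpatialEnd) (j : Fin 2) (k : ℂ) (x t : ℝ)
    (v w : Fin 2 → ℂ) :
    jostCoord p e j k x t (v - w) = jostCoord p e j k x t v - jostCoord p e j k x t w := by
  ext i
  fin_cases i <;> simp [jostCoord] <;> ring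

section

variable {p : Params} {e : SpatialEnd} {k : ℂ} (hA : p.AmpNonneg)

/-- Im λ_± has the sign of Im k, and `jostRegion` is the side on which that sign suits column j.
This is the reason why each column lives in its own half-plane. -/
lemma jostExp_re_nonneg {j : Fin 2} (hA : p.AmpNonneg) (hk : k ∈ jostRegion p e j) (i : Fin 2) :
    0 ≤ (jostExp p e j k i).re := by
  by_cases hij : i = j
  · rw [hij, jostExp_self]; simp
  rw [jostExp_re p e j k hij]
  obtain ⟨h1, h2⟩ := hk
  obtain ⟨ha, hb, hc⟩ := lamEnd_im_sign hA h1
  have : 0 ≤ jostSign e j * (lamEnd p e k).im := by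
    rcases lt_trichotomy k.im 0 with h | h | h
    · exact mul_nonneg_of_nonpos_of_nonpos (by
        by_contra hs; push Not at hs; nlinarith) (hb h).le
    · rw [hc h, mul_zero]
    · exact mul_nonneg (by by_contra hs; push Not at hs; nlinarith) (ha h).le
  linarith

include hA

lemma hasDerivAt_jostPath (hk : k ∉ branchCut p e) {q : ℝ → ℝ → ℂ} {v : ℝ → Fin 2 → ℂ} {t : ℝ}
    (j : Fin 2) (hv : ∀ x, HasDerivAt v ((laxX q k x t).mulVec (v x)) x) (y : ℝ) (i : Fin 2) :
    HasDerivAt (fun y => jostPath p e j k t v y i)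
      (jostExp p e j k i * jostPath p e j k t v y i +
        (e.sgn : ℂ) * jostForce p e k (resid p q e (e.sgn * y) t) (jostPath p e j k t v y) i) y := by
  have h := (hasDerivAt_jostCoord hA hk j (hv (e.sgn * y)) i).scomp y
    ((hasDerivAt_id y).const_mul e.sgn)
  refine h.congr_deriv ?_
  rw [jostExp, jostPath, real_smul]
  push_cast
  ring

lemma norm_sgn_mul_jostForce_le (hk : k ∉ branchCut p e) (r : ℂ) (u : Fin 2 → ℂ) (i : Fin 2) :
    ‖(e.sgn : ℂ) * jostForce p e k r u i‖ ≤ 4 * ‖(detE p e k)⁻¹‖ * ‖r‖ * ‖u‖ := by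
  rw [norm_mul, norm_real, Real.norm_eq_abs, e.abs_sgn, one_mul]
  exact norm_jostForce_le hA hk r u i

/-- The coordinates are chosen so that column j of the pure background solution becomes the j-th
unit vector; the Jost condition then reads as convergence to that vector. -/
lemma jostCoord_jostVec (hk : k ∉ branchCut p e) (j i : Fin 2) (x t : ℝ) :
    jostCoord p e j k x t (exp (colSign j * (I * thetaEnd p e x t k)) • jostVec p e j k x t) i =
      (Pi.single j 1 : Fin 2 → ℂ) i := by
  have hd := dEnd_ne_zero hA hk
  have hd2 : dEnd p e k ^ 2 = 1 - cEnd p e k ^ 2 := by rw [dEnd_sq, detE_eq hA hk]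
  have hε := epsEnd_ne_zero (p := p) (e := e)
  have ha := exp_ne_zero (I * (bgPhase p e x t : ℂ))
  have hb := exp_ne_zero (colSign j * (I * thetaEnd p e x t k))
  revert i
  rw [Fin.forall_fin_two]
  simp only [jostCoord, Pi.smul_apply, smul_eq_mul, jostVec_zero, jostVec_one,
    exp_neg (I * (bgPhase p e x t : ℂ)), exp_neg (colSign j * (I * thetaEnd p e x t k)),
    Matrix.cons_val_zero, Matrix.cons_val_one]
  constructor
  · field_simp
    linear_combination -(Pi.single j 1 : Fin 2 → ℂ) 0 * hd2
  · field_simp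
    linear_combination -((Pi.single j 1 : Fin 2 → ℂ) 1 * epsEnd p e) * hd2

lemma jostCoord_sub_single (hk : k ∉ branchCut p e) (j i : Fin 2) (x t : ℝ) (v : Fin 2 → ℂ) :
    jostCoord p e j k x t v i - (Pi.single j 1 : Fin 2 → ℂ) i =
      jostCoord p e j k x t
        (v - exp (colSign j * (I * thetaEnd p e x t k)) • jostVec p e j k x t) i := by
  rw [jostCoord_sub, Pi.sub_apply, jostCoord_jostVec hA hk]

omit hA in
lemma norm_exp_I_bgPhase (x t : ℝ) : ‖exp (I * (bgPhase p e x t : ℂ))‖ = 1 := by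
  rw [mul_comm, norm_exp_ofReal_mul_I]

omit hA in
lemma norm_exp_neg_I_bgPhase (x t : ℝ) : ‖exp (-(I * (bgPhase p e x t : ℂ)))‖ = 1 := by
  rw [exp_neg, norm_inv, norm_exp_I_bgPhase, inv_one]

/-- The asymptotic condition of a Jost column in asymptotic coordinates. -/
lemma asymp_iff (hk : k ∉ branchCut p e) (j : Fin 2) (t : ℝ) (v : ℝ → Fin 2 → ℂ) :
    (∀ i : Fin 2, Tendsto (fun x : ℝ => exp (-(colSign j * (I * thetaEnd p e x t k))) * v x i
      - (dEnd p e k)⁻¹ * (expSigma3 (-(I * (bgPhase p e x t : ℂ))) * matE p e k) i j)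
        e.toFilter (𝓝 0)) ↔
    ∀ i : Fin 2, Tendsto (fun y => jostPath p e j k t v y i - (Pi.single j 1 : Fin 2 → ℂ) i)
      atTop (𝓝 0) := by
  -- Both conditions are statements about the deviation δ from the background column, weighted by
  -- the same exponential. They are related by a change of coordinates whose coefficients, in both
  -- directions, are bounded in x.
  set δ : ℝ → Fin 2 → ℂ := fun x =>
    v x - exp (colSign j * (I * thetaEnd p e x t k)) • jostVec p e j k x t with hδ
  have h1 : ∀ x i, exp (-(colSign j * (I * thetaEnd p e x t k))) * v x i
      - (dEnd p e k)⁻¹ * (expSigma3 (-(I * (bgPhase p e x t : ℂ))) * matE p e k) i j =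
      exp (-(colSign j * (I * thetaEnd p e x t k))) * δ x i := by
    intro x i
    change _ - jostVec p e j k x t i = _
    simp only [hδ, Pi.sub_apply, Pi.smul_apply, smul_eq_mul]
    have : exp (-(colSign j * (I * thetaEnd p e x t k))) *
      exp (colSign j * (I * thetaEnd p e x t k)) = 1 := by rw [← exp_add]; simp
    linear_combination jostVec p e j k x t i * this
  have h2 : ∀ y i, jostPath p e j k t v y i - (Pi.single j 1 : Fin 2 → ℂ) i =
      jostPath p e j k t δ y i := fun y i => jostCoord_sub_single hA hk j i _ t _
  simp only [h1, h2]
  have h3 : ∀ i, Tendsto (fun y => jostPath p e j k t δ y i) atTop (𝓝 0) ↔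
      Tendsto (fun x => jostCoord p e j k x t (δ x) i) e.toFilter (𝓝 0) := fun i =>
    (e.tendsto_iff (f := fun x => jostCoord p e j k x t (δ x) i)).symm
  simp only [h3]
  have bdd : ∀ {f g : ℝ → ℂ} {C : ℝ}, (∀ x, ‖f x‖ ≤ C) → Tendsto g e.toFilter (𝓝 0) →
      Tendsto (fun x => f x * g x) e.toFilter (𝓝 0) := by
    intro f g C hf hg
    refine squeeze_zero_norm (a := fun x => C * ‖g x‖) (fun x => ?_) (by simpa using hg.norm.const_mul C)
    rw [norm_mul]
    exact mul_le_mul_of_nonneg_right (hf x) (norm_nonneg _)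
  constructor
  · intro h
    have t0 := bdd (f := fun x => exp (I * (bgPhase p e x t : ℂ))) (C := 1)
      (fun x => (norm_exp_I_bgPhase x t).le) (h 0)
    have t1 := bdd (f := fun x => exp (-(I * (bgPhase p e x t : ℂ)))) (C := 1)
      (fun x => (norm_exp_neg_I_bgPhase x t).le) (h 1)
    rw [Fin.forall_fin_two]
    constructor
    · have := ((t0.sub (t1.const_mul (cEnd p e k * epsEnd p e))).const_mul (dEnd p e k)⁻¹)
      simp only [mul_zero, sub_zero] at this
      refine this.congr fun x => ?_
      simp only [jostCoord, Matrix.cons_val_zero]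
      ring
    · have := ((t1.sub (t0.const_mul (cEnd p e k * (epsEnd p e)⁻¹))).const_mul (dEnd p e k)⁻¹)
      simp only [mul_zero, sub_zero] at this
      refine this.congr fun x => ?_
      simp only [jostCoord, Matrix.cons_val_one, Matrix.cons_val_zero]
      ring
  · intro h
    rw [Fin.forall_fin_two]
    constructor
    · have := (bdd (f := fun x => exp (-(I * (bgPhase p e x t : ℂ)))) (C := 1)
        (fun x => (norm_exp_neg_I_bgPhase x t).le)
        ((h 0).add ((h 1).const_mul (cEnd p e k * epsEnd p e))|>.trans (by simp))).const_mul
          (dEnd p e k)⁻¹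
      rw [mul_zero] at this
      exact this.congr fun x => (jostCoord_inv hA hk j x t (δ x)).1.symm
    · have := (bdd (f := fun x => exp (I * (bgPhase p e x t : ℂ))) (C := 1)
        (fun x => (norm_exp_I_bgPhase x t).le)
        ((h 1).add ((h 0).const_mul (cEnd p e k * (epsEnd p e)⁻¹))|>.trans (by simp))).const_mul
          (dEnd p e k)⁻¹
      rw [mul_zero] at this
      exact this.congr fun x => (jostCoord_inv hA hk j x t (δ x)).2.symm

/-- Growth of solutions towards the left of the half-line. -/
lemma norm_jostPath_le {j : Fin 2} (hk : k ∈ jostRegion p e j) {q : ℝ → ℝ → ℂ} {t : ℝ}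
    {T : ℝ → ℝ} (hT : HasTail (fun y => ‖resid p q e (e.sgn * y) t‖) T) {v : ℝ → Fin 2 → ℂ}
    (hv : ∀ x, HasDerivAt v ((laxX q k x t).mulVec (v x)) x) {y L : ℝ} (hyL : y ≤ L) :
    ‖jostPath p e j k t v y‖ ≤
      ‖jostPath p e j k t v L‖ * Real.exp (4 * ‖(detE p e k)⁻¹‖ * T y) := by
  have hT' := hT.const_mul (c := 4 * ‖(detE p e k)⁻¹‖) (by positivity)
  refine (norm_le_exp_mul (jostExp_re_nonneg hA hk) (hasDerivAt_jostPath hA hk.1 j hv) hT'.cont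
    (fun x i => norm_sgn_mul_jostForce_le hA hk.1 _ _ i) hT'.nonneg hyL).trans ?_
  gcongr
  exact hT'.le y L hyL

/-- Deviation of a bounded solution from the asymptotic vector. -/
lemma norm_jostPath_sub_le {j : Fin 2} (hk : k ∈ jostRegion p e j) {q : ℝ → ℝ → ℂ} {t : ℝ}
    {T : ℝ → ℝ} (hT : HasTail (fun y => ‖resid p q e (e.sgn * y) t‖) T) {v : ℝ → Fin 2 → ℂ}
    (hv : ∀ x, HasDerivAt v ((laxX q k x t).mulVec (v x)) x) {y L M : ℝ} (hyL : y ≤ L) (hM : 0 ≤ M)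
    (hb : ∀ s ∈ Set.Icc y L, ‖jostPath p e j k t v s‖ ≤ M) (i : Fin 2) :
    ‖jostPath p e j k t v y i - (Pi.single j 1 : Fin 2 → ℂ) i‖ ≤
      Real.exp (-((jostExp p e j k i).re * (L - y))) *
        ‖jostPath p e j k t v L i - (Pi.single j 1 : Fin 2 → ℂ) i‖ +
        4 * ‖(detE p e k)⁻¹‖ * M * T y := by
  have hT' := hT.const_mul (c := 4 * ‖(detE p e k)⁻¹‖ * M) (by positivity)
  -- The unit vector e_j is stationary for the diagonal part, since the j-th exponent is zero; the
  -- deviation from it therefore obeys the same equation.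
  have hz : jostExp p e j k i * (Pi.single j 1 : Fin 2 → ℂ) i = 0 := by
    by_cases hij : i = j
    · rw [hij, jostExp_self, zero_mul]
    · rw [Pi.single_eq_of_ne hij, mul_zero]
  have := norm_le_duhamel (z := fun s => jostPath p e j k t v s i - (Pi.single j 1 : Fin 2 → ℂ) i)
    hyL (jostExp_re_nonneg hA hk i) (fun s => by
      refine ((hasDerivAt_jostPath hA hk.1 j hv s i).sub_const _).congr_deriv ?_
      rw [mul_sub, hz, sub_zero]) hT'.cont (fun s hs => by
      refine (norm_sgn_mul_jostForce_le hA hk.1 _ _ i).trans ?_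
      calc 4 * ‖(detE p e k)⁻¹‖ * ‖resid p q e (e.sgn * s) t‖ * ‖jostPath p e j k t v s‖
          ≤ 4 * ‖(detE p e k)⁻¹‖ * ‖resid p q e (e.sgn * s) t‖ * M := by
            gcongr; exact hb s hs
        _ = _ := by ring)
  exact this.trans (by gcongr; exact hT'.le y L hyL)

/-- Growth towards the left is bounded by a factor independent of the starting point L; letting L
tend to infinity forces the solution to vanish. -/
lemma eq_zero_of_jostPath_tendsto {j : Fin 2} (hk : k ∈ jostRegion p e j) {q : ℝ → ℝ → ℂ} {t : ℝ}
    {T : ℝ → ℝ} (hT : HasTail (fun y => ‖resid p q e (e.sgn * y) t‖) T) {v : ℝ → Fin 2 → ℂ}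
    (hv : ∀ x, HasDerivAt v ((laxX q k x t).mulVec (v x)) x)
    (h0 : ∀ i, Tendsto (fun y => jostPath p e j k t v y i) atTop (𝓝 0)) (x : ℝ) : v x = 0 := by
  have h1 : Tendsto (fun y => ‖jostPath p e j k t v y‖) atTop (𝓝 0) := by
    have := (tendsto_pi_nhds (f := fun y => jostPath p e j k t v y) (g := 0)).2 h0
    simpa using this.norm
  have h2 : jostPath p e j k t v (e.sgn * x) = 0 := by
    rw [← norm_le_zero_iff]
    have h3 := h1.mul_const (Real.exp (4 * ‖(detE p e k)⁻¹‖ * T (e.sgn * x)))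
    rw [zero_mul] at h3
    refine ge_of_tendsto h3 ?_
    filter_upwards [eventually_ge_atTop (e.sgn * x)] with L hL
    exact norm_jostPath_le hA hk hT hv hL
  have h4 : jostCoord p e j k x t (v x) = 0 := by
    rwa [jostPath, ← mul_assoc, e.sgn_sq, one_mul] at h2
  obtain ⟨h5, h6⟩ := jostCoord_inv hA hk.1 j x t (v x)
  rw [h4] at h5 h6
  ext i
  revert i
  rw [Fin.forall_fin_two]
  constructor
  · simpa [exp_ne_zero] using h5
  · simpa [exp_ne_zero] using h6

/-- Uniqueness of Jost columns. -/
lemma jost_unique {j : Fin 2} (hk : k ∈ jostRegion p e j) {q : ℝ → ℝ → ℂ} {t : ℝ}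
    {T : ℝ → ℝ} (hT : HasTail (fun y => ‖resid p q e (e.sgn * y) t‖) T) {v w : ℝ → Fin 2 → ℂ}
    (hv : ∀ x, HasDerivAt v ((laxX q k x t).mulVec (v x)) x)
    (hw : ∀ x, HasDerivAt w ((laxX q k x t).mulVec (w x)) x)
    (hv1 : ∀ i, Tendsto (fun y => jostPath p e j k t v y i - (Pi.single j 1 : Fin 2 → ℂ) i)
      atTop (𝓝 0))
    (hw1 : ∀ i, Tendsto (fun y => jostPath p e j k t w y i - (Pi.single j 1 : Fin 2 → ℂ) i)
      atTop (𝓝 0)) (x : ℝ) : v x = w x := by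
  have := eq_zero_of_jostPath_tendsto hA hk hT (v := fun x => v x - w x) (fun x => by
    rw [Matrix.mulVec_sub]; exact (hv x).sub (hw x)) (fun i => by
    have := (hv1 i).sub (hw1 i)
    rw [sub_zero] at this
    refine this.congr fun y => ?_
    rw [jostPath, jostPath, jostPath, jostCoord_sub, Pi.sub_apply]
    ring) x
  exact sub_eq_zero.1 this

end

/-! ### Construction of the Jost solutions at time zero -/

/-- A sequence of functions that is locally uniformly Cauchy converges locally uniformly. -/
lemma exists_tendstoLocallyUniformlyOn {α E : Type*} [TopologicalSpace α] [NormedAddCommGroup E]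
    [CompleteSpace E] {S : Set α} {F : ℕ → α → E}
    (h : ∀ x ∈ S, ∃ U ∈ 𝓝 x, ∃ b : ℕ → ℝ, Tendsto b atTop (𝓝 0) ∧
      ∀ y ∈ U ∩ S, ∀ n m, n ≤ m → ‖F m y - F n y‖ ≤ b n) :
    ∃ f : α → E, TendstoLocallyUniformlyOn F f atTop S := by
  have hc : ∀ x ∈ S, ∃ l, Tendsto (fun n => F n x) atTop (𝓝 l) := by
    intro x hx
    obtain ⟨U, hU, b, hb, hF⟩ := h x hx
    refine cauchySeq_tendsto_of_complete (cauchySeq_of_le_tendsto_0' b (fun n m hnm => ?_) hb)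
    rw [dist_comm, dist_eq_norm]
    exact hF x ⟨mem_of_mem_nhds hU, hx⟩ n m hnm
  choose! f hf using hc
  refine ⟨f, fun u hu x hx => ?_⟩
  obtain ⟨U, hU, b, hb, hF⟩ := h x hx
  obtain ⟨ε, hε, hεu⟩ := Metric.mem_uniformity_dist.1 hu
  refine ⟨S ∩ U, inter_mem_nhdsWithin S hU, ?_⟩
  filter_upwards [hb.eventually (gt_mem_nhds hε)] with n hn y hy
  apply hεu
  rw [dist_eq_norm]
  refine lt_of_le_of_lt ?_ hn
  have h1 := ((hf y hy.1).sub_const (F n y)).norm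
  refine le_of_tendsto h1 ?_
  filter_upwards [eventually_ge_atTop n] with m hm
  exact hF y hy.symm n m hm

lemma HasTail.resid {p : Params} {e : SpatialEnd} {J : Set ℝ} {q : ℝ → ℝ → ℂ}
    (hq : IsClassicalNLS J q) {t : ℝ} (ht : t ∈ J)
    (hi : MeasureTheory.IntegrableOn (fun x : ℝ => q x t - bgWave p e x t) e.halfLine) :
    ∃ T, HasTail (fun y => ‖NLSIST.resid p q e (e.sgn * y) t‖) T := by
  have hbg : Continuous fun x => bgWave p e x t := by unfold bgWave bgPhase; fun_prop
  have hc : Continuous fun y : ℝ => q (e.sgn * y) t - bgWave p e (e.sgn * y) t :=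
    ((hq.continuous_q ht).sub hbg).comp (continuous_const.mul continuous_id)
  simp only [norm_resid]
  exact hasTail_of_integrableOn hc.norm (fun _ => norm_nonneg _) (e.integrableOn_comp hi).norm

section

variable {p : Params} {e : SpatialEnd} {J : Set ℝ} {q : ℝ → ℝ → ℂ}

lemma thetaEnd_zero (k : ℂ) : thetaEnd p e 0 0 k = 0 := by simp [thetaEnd]

/-- Together with `norm_jostCoord_le`, this makes the coordinate norm equivalent to the
exponentially weighted norm of v, with constants depending on k alone. -/
lemma norm_exp_mul_norm_le (hA : p.AmpNonneg) {k : ℂ} (hk : k ∉ branchCut p e) (j : Fin 2)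
    (x t : ℝ) (v : Fin 2 → ℂ) : ‖exp (-(colSign j * (I * thetaEnd p e x t k)))‖ * ‖v‖ ≤
      2 * ‖(dEnd p e k)⁻¹‖ * ‖jostCoord p e j k x t v‖ := by
  obtain ⟨h0, h1⟩ := jostCoord_inv hA hk j x t v
  have hc := norm_cEnd_le_one hA hk
  have hε : ‖epsEnd p e‖ = 1 := norm_epsEnd
  set u := jostCoord p e j k x t v
  have hu0 := norm_le_pi_norm u 0
  have hu1 := norm_le_pi_norm u 1
  rw [← norm_smul, pi_norm_le_iff_of_nonneg (by positivity), Fin.forall_fin_two, Pi.smul_apply,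
    Pi.smul_apply, smul_eq_mul, smul_eq_mul, h0, h1]
  constructor
  · rw [norm_mul, norm_mul, norm_exp_neg_I_bgPhase, one_mul]
    calc _ ≤ ‖(dEnd p e k)⁻¹‖ * (‖u‖ + 1 * 1 * ‖u‖) := by
          gcongr
          refine (norm_add_le _ _).trans (add_le_add hu0 ?_)
          rw [norm_mul, norm_mul, hε]
          gcongr
      _ = _ := by ring
  · rw [norm_mul, norm_mul, norm_exp_I_bgPhase, one_mul]
    calc _ ≤ ‖(dEnd p e k)⁻¹‖ * (‖u‖ + 1 * 1 * ‖u‖) := by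
          gcongr
          refine (norm_add_le _ _).trans (add_le_add hu1 ?_)
          rw [norm_mul, norm_mul, norm_inv, hε, inv_one]
          gcongr
      _ = _ := by ring

lemma norm_single_le (j : Fin 2) : ‖(Pi.single j 1 : Fin 2 → ℂ)‖ = 1 := by
  simp [Pi.norm_single]

/-- The initial vector of the solution that agrees with the background solution at `x = ± n`. -/
def jostApprox (J : Set ℝ) (p : Params) (q : ℝ → ℝ → ℂ) (e : SpatialEnd) (j : Fin 2) (n : ℕ)
    (k : ℂ) : Fin 2 → ℂ :=
  (Psi J q (e.sgn * n) 0 k).adjugate.mulVec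
    (exp (colSign j * (I * thetaEnd p e (e.sgn * n) 0 k)) • jostVec p e j k (e.sgn * n) 0)

lemma differentiableAt_mulVec {M : ℂ → Mat2} {v : ℂ → Fin 2 → ℂ} {k : ℂ}
    (hM : ∀ i j, DifferentiableAt ℂ (fun k => M k i j) k) (hv : DifferentiableAt ℂ v k) :
    DifferentiableAt ℂ (fun k => (M k).mulVec (v k)) k := by
  rw [differentiableAt_pi] at hv ⊢
  intro i
  simp only [Matrix.mulVec, dotProduct, Fin.sum_univ_two]
  exact ((hM i 0).mul (hv 0)).add ((hM i 1).mul (hv 1))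

lemma differentiableAt_jostVec (hA : p.AmpNonneg) {k : ℂ} (hk : k ∉ branchCut p e) (j : Fin 2)
    (x t : ℝ) : DifferentiableAt ℂ (fun k => jostVec p e j k x t) k := by
  have h1 := differentiableAt_cEnd hA hk
  have h2 : DifferentiableAt ℂ (fun k => (dEnd p e k)⁻¹) k :=
    (differentiableAt_dEnd hA hk).inv (dEnd_ne_zero hA hk)
  rw [differentiableAt_pi, Fin.forall_fin_two]
  simp only [jostVec_zero, jostVec_one]
  constructor
  · exact h2.mul (((h1.mul_const _).mul_const _ |>.const_add _).const_mul _)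
  · exact h2.mul (((h1.mul_const _).mul_const _ |>.const_add _).const_mul _)

lemma differentiableAt_jostApprox (hA : p.AmpNonneg) (hJ : IsTimeDomain J)
    (hq : IsClassicalNLS J q) {k : ℂ} (hk : k ∉ branchCut p e) (j : Fin 2) (n : ℕ) :
    DifferentiableAt ℂ (jostApprox J p q e j n) k := by
  have hd := fun i l => differentiable_Psi hJ hq (e.sgn * n) hJ.zero_mem i l
  refine differentiableAt_mulVec (fun i l => ?_) (DifferentiableAt.fun_smul ?_
    (differentiableAt_jostVec hA hk j _ _))
  · simp only [Matrix.adjugate_fin_two]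
    fin_cases i <;> fin_cases l <;> simp
    · exact hd 1 1 k
    · exact hd 0 1 k
    · exact hd 1 0 k
    · exact hd 0 0 k
  · refine DifferentiableAt.cexp (((DifferentiableAt.const_mul ?_ I).const_mul _))
    exact (differentiableAt_lamEnd hA hk).mul (by fun_prop)

/-- Since det Ψ = 1, the adjugate in `jostApprox` is the inverse of Ψ; in this form its entries are
visibly entire in k. -/
lemma jostPath_approx (hA : p.AmpNonneg) (hJ : IsTimeDomain J) (hq : IsClassicalNLS J q) {k : ℂ}
    (hk : k ∉ branchCut p e) (j : Fin 2) (n : ℕ) (i : Fin 2) :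
    jostPath p e j k 0 (fun x => (Psi J q x 0 k).mulVec (jostApprox J p q e j n k)) n i =
      (Pi.single j 1 : Fin 2 → ℂ) i := by
  rw [jostPath, jostApprox, Matrix.mulVec_mulVec, Matrix.mul_adjugate,
    det_Psi hJ hq k _ hJ.zero_mem, one_smul, Matrix.one_mulVec, jostCoord_jostVec hA hk]

lemma Psi_mulVec_eq_x (hJ : IsTimeDomain J) (hq : IsClassicalNLS J q) (k : ℂ) (a : Fin 2 → ℂ)
    (x : ℝ) : HasDerivAt (fun x => (Psi J q x 0 k).mulVec a)
      ((laxX q k x 0).mulVec ((Psi J q x 0 k).mulVec a)) x :=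
  (isLaxSolution_Psi_mulVec hJ hq k a).eq_x x 0 hJ.zero_mem

/-- Two passes from y = m, where the coordinates equal e_j exactly: the growth estimate bounds the
path, and the deviation estimate uses this bound. The result does not depend on m, so it survives
the limit m → ∞. -/
lemma norm_approx_sub_le (hA : p.AmpNonneg) (hJ : IsTimeDomain J) (hq : IsClassicalNLS J q)
    {k : ℂ} {j : Fin 2} (hk : k ∈ jostRegion p e j) {T : ℝ → ℝ}
    (hT : HasTail (fun y => ‖resid p q e (e.sgn * y) 0‖) T) (hT0 : ∀ y, 0 ≤ y → T y ≤ T 0) {m : ℕ}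
    {y : ℝ} (hy0 : 0 ≤ y) (hym : y ≤ m) (i : Fin 2) :
    ‖jostPath p e j k 0 (fun x => (Psi J q x 0 k).mulVec (jostApprox J p q e j m k)) y i -
      (Pi.single j 1 : Fin 2 → ℂ) i‖ ≤
      4 * ‖(detE p e k)⁻¹‖ * Real.exp (4 * ‖(detE p e k)⁻¹‖ * T 0) * T y := by
  have hsol := Psi_mulVec_eq_x hJ hq k (jostApprox J p q e j m k)
  have h1 : jostPath p e j k 0 (fun x => (Psi J q x 0 k).mulVec (jostApprox J p q e j m k)) m =
      Pi.single j 1 := funext fun i => jostPath_approx hA hJ hq hk.1 j m i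
  have hb : ∀ s ∈ Set.Icc y (m : ℝ),
      ‖jostPath p e j k 0 (fun x => (Psi J q x 0 k).mulVec (jostApprox J p q e j m k)) s‖ ≤
        Real.exp (4 * ‖(detE p e k)⁻¹‖ * T 0) := by
    intro s hs
    refine (norm_jostPath_le hA hk hT hsol hs.2).trans ?_
    rw [h1, norm_single_le, one_mul]
    gcongr
    exact hT0 s (hy0.trans hs.1)
  have := norm_jostPath_sub_le hA hk hT hsol hym (Real.exp_pos _).le hb i
  rw [h1] at this
  simpa using this

/-- The supremum over L of the integrals from y to L is the least tail bound and decreases in y,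
which allows tails beyond y to be replaced by the tail at y. -/
lemma HasTail.exists_antitone {n T : ℝ → ℝ} (h : HasTail n T) :
    ∃ T', HasTail n T' ∧ Antitone T' := by
  have hadd : ∀ a b c, ∫ s in a..b, n s = (∫ s in a..c, n s) + ∫ s in c..b, n s := fun a b c =>
    (intervalIntegral.integral_add_adjacent_intervals (h.cont.intervalIntegrable _ _)
      (h.cont.intervalIntegrable _ _)).symm
  have hbdd : ∀ y, BddAbove ((fun L => ∫ s in y..L, n s) '' Set.Ici y) := by
    intro y
    refine ⟨T y, ?_⟩
    rintro _ ⟨L, hL, rfl⟩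
    exact h.le y L hL
  have hne : ∀ y, ((fun L => ∫ s in y..L, n s) '' Set.Ici y).Nonempty := fun y =>
    ⟨_, y, Set.self_mem_Ici, rfl⟩
  have hpos : ∀ a b, a ≤ b → 0 ≤ ∫ s in a..b, n s := fun a b hab =>
    intervalIntegral.integral_nonneg hab fun s _ => h.nonneg s
  refine ⟨fun y => sSup ((fun L => ∫ s in y..L, n s) '' Set.Ici y),
    ⟨h.cont, h.nonneg, fun y L hyL => le_csSup (hbdd y) ⟨L, hyL, rfl⟩, ?_⟩, fun y z hyz => ?_⟩
  · refine squeeze_zero (fun y => ?_) (fun y => ?_) h.tendsto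
    · exact le_csSup (hbdd y) ⟨y, Set.self_mem_Ici, by simp⟩
    · refine csSup_le (hne y) ?_
      rintro _ ⟨L, hL, rfl⟩
      exact h.le y L hL
  · refine csSup_le (hne z) ?_
    rintro _ ⟨L, hL, rfl⟩
    refine le_trans ?_ (le_csSup (hbdd y) ⟨L, hyz.trans hL, rfl⟩)
    simp only
    rw [hadd y L z]
    linarith [hpos y z hyz]

/-- Existence of the Jost columns at time zero: there are initial vectors, continuous in the
spectral parameter and analytic in the interior, of solutions with the required asymptotics. -/
theorem exists_jost_initial (hA : p.AmpNonneg) (hJ : IsTimeDomain J) (hq : IsClassicalNLS J q)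
    (hi : MeasureTheory.IntegrableOn (fun x : ℝ => q x 0 - bgWave p e x 0) e.halfLine)
    (j : Fin 2) : ∃ a : ℂ → Fin 2 → ℂ, ContinuousOn a (jostRegion p e j) ∧
      DifferentiableOn ℂ a {k | k ∉ branchCut p e ∧ 0 < jostSign e j * k.im} ∧
      ∀ k ∈ jostRegion p e j, ∀ i, Tendsto (fun y =>
        jostPath p e j k 0 (fun x => (Psi J q x 0 k).mulVec (a k)) y i -
          (Pi.single j 1 : Fin 2 → ℂ) i) atTop (𝓝 0) := by
  obtain ⟨T₁, hT₁⟩ := HasTail.resid (p := p) (e := e) hq hJ.zero_mem hi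
  obtain ⟨T, hT, hTa⟩ := hT₁.exists_antitone
  have hT0 : ∀ y, 0 ≤ y → T y ≤ T 0 := fun y hy => hTa hy
  have hcauchy : ∀ k ∈ jostRegion p e j, ∃ U ∈ 𝓝 k, ∃ b : ℕ → ℝ, Tendsto b atTop (𝓝 0) ∧
      ∀ κ ∈ U ∩ jostRegion p e j, ∀ n m, n ≤ m →
        ‖jostApprox J p q e j m κ - jostApprox J p q e j n κ‖ ≤ b n := by
    intro k hk
    have c1 : ContinuousAt (fun κ => ‖(detE p e κ)⁻¹‖) k :=
      ((differentiableAt_detE hA hk.1).inv (detE_ne_zero hA hk.1)).continuousAt.norm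
    have c2 : ContinuousAt (fun κ => ‖(dEnd p e κ)⁻¹‖) k :=
      ((differentiableAt_dEnd hA hk.1).inv (dEnd_ne_zero hA hk.1)).continuousAt.norm
    set C := ‖(detE p e k)⁻¹‖ + 1
    set C' := ‖(dEnd p e k)⁻¹‖ + 1
    have hU : {κ | ‖(detE p e κ)⁻¹‖ < C ∧ ‖(dEnd p e κ)⁻¹‖ < C'} ∈ 𝓝 k :=
      (c1.eventually (gt_mem_nhds (lt_add_one _))).and (c2.eventually (gt_mem_nhds (lt_add_one _)))
    -- At y = n the n-th path is e_j and the m-th is within the tail estimate of it. One exponential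
    -- comes from that estimate, the other from transporting the difference to y = 0; the factor 2C'
    -- converts coordinates back to initial vectors.
    refine ⟨_, hU, fun n => 2 * C' * (4 * C * Real.exp (4 * C * T 0) * T n *
      Real.exp (4 * C * T 0)), ?_, ?_⟩
    · have := (((hT.tendsto.comp tendsto_natCast_atTop_atTop).const_mul
        (4 * C * Real.exp (4 * C * T 0))).mul_const (Real.exp (4 * C * T 0))).const_mul (2 * C')
      simpa using this
    · rintro κ ⟨⟨hκ1, hκ2⟩, hκ⟩ n m hnm
      have hnm' : (n : ℝ) ≤ m := Nat.cast_le.2 hnm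
      have hn0 : (0 : ℝ) ≤ n := Nat.cast_nonneg n
      have hTn := hT.tail_nonneg n
      have hT00 := hT.tail_nonneg 0
      set am := jostApprox J p q e j m κ
      set an := jostApprox J p q e j n κ
      have hsol := Psi_mulVec_eq_x hJ hq κ (am - an)
      have hlin : ∀ y, jostPath p e j κ 0 (fun x => (Psi J q x 0 κ).mulVec (am - an)) y =
          jostPath p e j κ 0 (fun x => (Psi J q x 0 κ).mulVec am) y -
          jostPath p e j κ 0 (fun x => (Psi J q x 0 κ).mulVec an) y := by
        intro y
        simp only [jostPath, Matrix.mulVec_sub, jostCoord_sub]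
      have h1 : ‖jostPath p e j κ 0 (fun x => (Psi J q x 0 κ).mulVec (am - an)) n‖ ≤
          4 * C * Real.exp (4 * C * T 0) * T n := by
        rw [pi_norm_le_iff_of_nonneg (by positivity)]
        intro i
        rw [hlin, Pi.sub_apply, jostPath_approx hA hJ hq hκ.1 j n i]
        refine (norm_approx_sub_le hA hJ hq hκ hT hT0 hn0 hnm' i).trans ?_
        gcongr
      have h2 : ‖jostPath p e j κ 0 (fun x => (Psi J q x 0 κ).mulVec (am - an)) 0‖ ≤
          4 * C * Real.exp (4 * C * T 0) * T n * Real.exp (4 * C * T 0) := by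
        refine (norm_jostPath_le hA hκ hT hsol hn0).trans ?_
        gcongr
      have h3 := norm_exp_mul_norm_le hA hκ.1 j 0 0 (am - an)
      rw [thetaEnd_zero, mul_zero, mul_zero, neg_zero, exp_zero, norm_one, one_mul] at h3
      have h4 : jostPath p e j κ 0 (fun x => (Psi J q x 0 κ).mulVec (am - an)) 0 =
          jostCoord p e j κ 0 0 (am - an) := by
        simp [jostPath, Psi_zero hJ hq]
      rw [h4] at h2
      refine h3.trans ?_
      beta_reduce
      gcongr
  obtain ⟨a, ha⟩ := exists_tendstoLocallyUniformlyOn hcauchy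
  refine ⟨a, ha.continuousOn (Frequently.of_forall fun n k hk =>
      (differentiableAt_jostApprox hA hJ hq hk.1 j n).continuousAt.continuousWithinAt),
    (ha.mono fun k hk => ⟨hk.1, le_of_lt hk.2⟩).differentiableOn (Eventually.of_forall fun n k hk =>
      (differentiableAt_jostApprox hA hJ hq hk.1 j n).differentiableWithinAt)
      (isClosed_branchCut.isOpen_compl.inter (isOpen_lt continuous_const
        (continuous_const.mul continuous_im))), fun k hk i => ?_⟩
  refine squeeze_zero_norm' (a := fun y =>
    4 * ‖(detE p e k)⁻¹‖ * Real.exp (4 * ‖(detE p e k)⁻¹‖ * T 0) * T y) ?_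
    (by simpa using hT.tendsto.const_mul _)
  filter_upwards [eventually_ge_atTop 0] with y hy
  have hlim : Tendsto (fun n => jostApprox J p q e j n k) atTop (𝓝 (a k)) := ha.tendsto_at hk
  have hcont : Continuous fun b : Fin 2 → ℂ =>
      jostPath p e j k 0 (fun x => (Psi J q x 0 k).mulVec b) y i := by
    have h1 : Continuous fun b : Fin 2 → ℂ => (Psi J q (e.sgn * y) 0 k).mulVec b := by fun_prop
    rw [continuous_pi_iff] at h1
    have h10 := h1 0
    have h11 := h1 1
    unfold jostPath jostCoord
    fin_cases i <;> simp <;> fun_prop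
  have h2 := (((hcont.tendsto (a k)).comp hlim).sub_const ((Pi.single j 1 : Fin 2 → ℂ) i)).norm
  refine le_of_tendsto h2 ?_
  -- For fixed y the estimate holds for all m ≥ y, and the path at y depends continuously on the
  -- initial vector, so the bound passes to the limit.
  obtain ⟨N, hN⟩ := exists_nat_ge y
  filter_upwards [eventually_ge_atTop N] with m hm
  exact norm_approx_sub_le hA hJ hq hk hT hT0 hy (hN.trans (Nat.cast_le.2 hm)) i

end

/-! ### Vanishing at infinity of time increments -/

lemma SpatialEnd.eventually_Icc (e : SpatialEnd) {P : ℝ → Prop} (h : ∀ᶠ x in e.toFilter, P x) :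
    ∀ᶠ x in e.toFilter, ∀ z ∈ Set.Icc (x - 1) (x + 1), P z := by
  cases e
  · obtain ⟨N, hN⟩ := eventually_atTop.1 h
    exact eventually_atTop.2 ⟨N + 1, fun x hx z hz => hN z (by linarith [hz.1])⟩
  · obtain ⟨N, hN⟩ := eventually_atBot.1 h
    exact eventually_atBot.2 ⟨N - 1, fun x hx z hz => hN z (by linarith [hz.2])⟩

lemma SpatialEnd.tendsto_add_one (e : SpatialEnd) :
    Tendsto (fun x : ℝ => x + 1) e.toFilter e.toFilter := by
  cases e
  · exact tendsto_atTop_add_const_right _ _ tendsto_id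
  · exact tendsto_atBot_add_const_right _ _ tendsto_id

instance (e : SpatialEnd) : e.toFilter.IsCountablyGenerated := by
  cases e
  · exact inferInstanceAs (atTop : Filter ℝ).IsCountablyGenerated
  · exact inferInstanceAs (atBot : Filter ℝ).IsCountablyGenerated

/-- A slowly varying function that is, up to a vanishing error, the derivative of a vanishing
function, vanishes at infinity. -/
lemma tendsto_zero_of_slowly_varying (e : SpatialEnd) {Φ Φ' H R : ℝ → ℂ}
    (hH : ∀ᶠ x in e.toFilter, HasDerivAt H (Φ x - R x) x) (hH0 : Tendsto H e.toFilter (𝓝 0))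
    (hR0 : Tendsto R e.toFilter (𝓝 0)) (hΦ : ∀ x, HasDerivAt Φ (Φ' x) x)
    (hΦ' : Tendsto Φ' e.toFilter (𝓝 0)) : Tendsto Φ e.toFilter (𝓝 0) := by
  rw [Metric.tendsto_nhds]
  intro ε hε
  have small : ∀ {f : ℝ → ℂ}, Tendsto f e.toFilter (𝓝 0) → ∀ᶠ x in e.toFilter, ‖f x‖ < ε / 5 := by
    intro f hf
    have := hf.norm
    rw [norm_zero] at this
    exact this.eventually (gt_mem_nhds (by positivity))
  filter_upwards [e.eventually_Icc hH, e.eventually_Icc (small hR0), e.eventually_Icc (small hΦ'),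
    small hH0, e.tendsto_add_one.eventually (small hH0)] with x h1 h2 h3 h4 h5
  have hsub : ∀ z ∈ Set.Icc x (x + 1), z ∈ Set.Icc (x - 1) (x + 1) := fun z hz =>
    ⟨by linarith [hz.1], hz.2⟩
  have hx1 : x + 1 ∈ Set.Icc x (x + 1) := ⟨by linarith, le_rfl⟩
  have hx0 : x ∈ Set.Icc x (x + 1) := ⟨le_rfl, by linarith⟩
  have hvar : ∀ z ∈ Set.Icc x (x + 1), ‖Φ z - Φ x‖ ≤ ε / 5 := by
    intro z hz
    have := (convex_Icc x (x + 1)).norm_image_sub_le_of_norm_hasDerivWithin_le (f := Φ) (f' := Φ')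
      (C := ε / 5) (fun w _ => (hΦ w).hasDerivWithinAt) (fun w hw => (h3 w (hsub w hw)).le) hx0 hz
    refine this.trans ?_
    have : ‖z - x‖ ≤ 1 := by
      rw [Real.norm_eq_abs, abs_le]; constructor <;> linarith [hz.1, hz.2]
    nlinarith
  -- On a unit interval Φ is nearly constant, so H(x+1) - H(x) differs from Φ(x) by at most 2ε/5. As
  -- H itself is small at both ends, |Φ(x)| < 4ε/5.
  have hmv := (convex_Icc x (x + 1)).norm_image_sub_le_of_norm_hasDerivWithin_le
    (f := fun z => H z - ((z : ℝ) : ℂ) * Φ x) (f' := fun z => Φ z - R z - Φ x)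
    (C := 2 * (ε / 5)) (fun w hw => by
      have h6 : HasDerivAt (fun z : ℝ => ((z : ℝ) : ℂ) * Φ x) (Φ x) w := by
        simpa using (hasDerivAt_id w).ofReal_comp.mul_const (Φ x)
      exact ((h1 w (hsub w hw)).sub h6).hasDerivWithinAt) (fun w hw => by
      calc ‖Φ w - R w - Φ x‖ = ‖(Φ w - Φ x) - R w‖ := by congr 1; ring
        _ ≤ ε / 5 + ε / 5 := (norm_sub_le _ _).trans
            (add_le_add (hvar w hw) (h2 w (hsub w hw)).le)
        _ = _ := by ring) hx0 hx1
  have e1 : H (x + 1) - ((x + 1 : ℝ) : ℂ) * Φ x - (H x - ((x : ℝ) : ℂ) * Φ x) =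
      (H (x + 1) - H x) - Φ x := by push_cast; ring
  rw [e1, add_sub_cancel_left, norm_one, mul_one] at hmv
  rw [dist_zero_right]
  have h7 : ‖Φ x‖ ≤ ‖H (x + 1) - H x‖ + ‖(H (x + 1) - H x) - Φ x‖ := by
    have := norm_sub_le (H (x + 1) - H x) ((H (x + 1) - H x) - Φ x)
    rwa [sub_sub_cancel] at this
  have h8 := norm_sub_le (H (x + 1)) (H x)
  linarith

lemma IsTimeDomain.Ici_subset {J : Set ℝ} (hJ : IsTimeDomain J) {s : ℝ} (hs : s ∈ J) :
    Set.Ici s ⊆ J := by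
  rcases hJ with rfl | rfl
  · exact Set.Ici_subset_Ici.2 hs
  · exact Set.subset_univ _

lemma IsTimeDomain.uIcc_subset {J : Set ℝ} (hJ : IsTimeDomain J) {t : ℝ} (ht : t ∈ J) :
    Set.uIcc 0 t ⊆ J := by
  rw [← segment_eq_uIcc]
  exact hJ.convex.segment_subset hJ.zero_mem ht

/-- If `W_t = P_x + R` where `P` and `R` vanish at a spatial end, boundedly on finite time
intervals, and if `W_x` vanishes there, then so do the time increments of `W`. -/
lemma tendsto_increment_zero (e : SpatialEnd) {J : Set ℝ} (hJ : IsTimeDomain J) {t : ℝ} (ht : t ∈ J)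
    {W P Wt Px : ℝ → ℝ → ℂ} {Φ' : ℝ → ℂ} {C : ℝ}
    (hW : ∀ x, ∀ s ∈ J, HasDerivWithinAt (W x) (Wt x s) J s)
    (hP : ∀ x, ∀ s ∈ J, HasDerivAt (fun x => P x s) (Px x s) x)
    (cW : ∀ x, ContinuousOn (Wt x) J) (cP : ∀ x, ContinuousOn (P x) J)
    (cPx : ∀ x, ContinuousOn (Px x) J)
    (hloc : ∀ᶠ x in e.toFilter, ∃ M, ∀ z ∈ Metric.ball x 1, ∀ s ∈ Set.uIcc 0 t, ‖Px z s‖ ≤ M)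
    (hPb : ∀ᶠ x in e.toFilter, ∀ s ∈ Set.uIcc 0 t, ‖P x s‖ ≤ C)
    (hRb : ∀ᶠ x in e.toFilter, ∀ s ∈ Set.uIcc 0 t, ‖Wt x s - Px x s‖ ≤ C)
    (hP0 : ∀ s ∈ Set.uIcc 0 t, Tendsto (fun x => P x s) e.toFilter (𝓝 0))
    (hR0 : ∀ s ∈ Set.uIcc 0 t, Tendsto (fun x => Wt x s - Px x s) e.toFilter (𝓝 0))
    (hΦ : ∀ x, HasDerivAt (fun x => W x t - W x 0) (Φ' x) x)
    (hΦ' : Tendsto Φ' e.toFilter (𝓝 0)) :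
    Tendsto (fun x => W x t - W x 0) e.toFilter (𝓝 0) := by
  have hsub := hJ.uIcc_subset ht
  have hsub' : Set.uIoc 0 t ⊆ Set.uIcc 0 t := Set.uIoc_subset_uIcc
  have hint : ∀ {f : ℝ → ℂ}, ContinuousOn f J →
      IntervalIntegrable f MeasureTheory.volume 0 t := fun hf =>
    (hf.mono hsub).intervalIntegrable
  have hmeas : ∀ {f : ℝ → ℂ}, ContinuousOn f J → MeasureTheory.AEStronglyMeasurable f
      (MeasureTheory.volume.restrict (Set.uIoc 0 t)) := fun hf =>
    ((hint hf).def').aestronglyMeasurable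
  -- Pointwise decay in s with a bound uniform in s suffices, by dominated convergence; no uniform
  -- decay in time is available.
  have hdct : ∀ {F : ℝ → ℝ → ℂ}, (∀ x, ContinuousOn (F x) J) →
      (∀ᶠ x in e.toFilter, ∀ s ∈ Set.uIcc 0 t, ‖F x s‖ ≤ C) →
      (∀ s ∈ Set.uIcc 0 t, Tendsto (fun x => F x s) e.toFilter (𝓝 0)) →
      Tendsto (fun x => ∫ s in (0 : ℝ)..t, F x s) e.toFilter (𝓝 0) := by
    intro F hF hb h0
    have := intervalIntegral.tendsto_integral_filter_of_dominated_convergence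
      (μ := MeasureTheory.volume) (a := 0) (b := t) (F := F) (f := fun _ => (0 : ℂ))
      (l := e.toFilter) (fun _ => C)
      (Eventually.of_forall fun x => hmeas (hF x))
      (hb.mono fun x hx => Eventually.of_forall fun s hs => hx s (hsub' hs))
      intervalIntegrable_const
      (Eventually.of_forall fun s hs => h0 s (hsub' hs))
    simpa using this
  -- Integrating W_t = P_x + R in time exhibits the increment of W as H_x plus an error, where H is
  -- the time integral of P. Thus only P, and not P_x, has to decay.
  refine tendsto_zero_of_slowly_varying e (H := fun x => ∫ s in (0 : ℝ)..t, P x s)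
    (R := fun x => ∫ s in (0 : ℝ)..t, (Wt x s - Px x s)) ?_ (hdct cP hPb hP0)
    (hdct (fun x => (cW x).sub (cPx x)) hRb hR0) hΦ hΦ'
  filter_upwards [hloc] with x hx
  obtain ⟨M, hM⟩ := hx
  have h1 := (intervalIntegral.hasDerivAt_integral_of_dominated_loc_of_deriv_le
    (μ := MeasureTheory.volume) (a := 0) (b := t) (F := P) (F' := Px) (x₀ := x)
    (bound := fun _ => M) (Metric.ball_mem_nhds x one_pos)
    (Eventually.of_forall fun z => hmeas (cP z)) (hint (cP x)) (hmeas (cPx x))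
    (Eventually.of_forall fun s hs z hz => hM z hz s (hsub' hs)) intervalIntegrable_const
    (Eventually.of_forall fun s hs z _ => hP z s (hsub (hsub' hs)))).2
  refine h1.congr_deriv ?_
  rw [intervalIntegral.integral_sub (hint (cW x)) (hint (cPx x))]
  have h2 : ∫ s in (0 : ℝ)..t, Wt x s = W x t - W x 0 := by
    refine intervalIntegral.integral_eq_sub_of_hasDeriv_right
      (fun s hs => ((hW x s (hsub hs)).mono hsub).continuousWithinAt) (fun s hs => ?_)
      (hint (cW x))
    have hs' : s ∈ Set.uIcc 0 t := ⟨hs.1.le, hs.2.le⟩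
    exact (hW x s (hsub hs')).mono (Set.Ioi_subset_Ici_self.trans (hJ.Ici_subset (hsub hs')))
  rw [h2]
  ring

/-! ### Time evolution of one coordinate -/

lemma exists_bound_of_continuous {f : ℂ × ℂ × ℂ × ℂ → ℂ} (hf : Continuous f) (D : ℝ) :
    ∃ M, ∀ a b c d, ‖a‖ ≤ D → ‖b‖ ≤ D → ‖c‖ ≤ D → ‖d‖ ≤ D → ‖f (a, b, c, d)‖ ≤ M := by
  obtain ⟨M, hM⟩ := (isCompact_closedBall (0 : ℂ × ℂ × ℂ × ℂ) D).exists_bound_of_continuousOn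
    hf.continuousOn
  refine ⟨M, fun a b c d ha hb hc hd => hM _ ?_⟩
  rw [mem_closedBall_zero_iff, Prod.norm_def, Prod.norm_def, Prod.norm_def]
  exact max_le ha (max_le hb (max_le hc hd))

/-- A combination of the coordinates of a solution of the Lax pair that is an eigenvector of the
background part of both equations is asymptotically constant in time. -/
lemma tendsto_combination_increment (e : SpatialEnd) {J : Set ℝ} (hJ : IsTimeDomain J) {t : ℝ}
    (ht : t ∈ J) {H0 H1 r rx : ℝ → ℝ → ℂ} {κ ν μ α β b b' : ℂ} {B C : ℝ}
    (hH0x : ∀ x, ∀ s ∈ J, HasDerivAt (fun x => H0 x s)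
      ((I * κ - μ) * H0 x s + (b + r x s) * H1 x s) x)
    (hH1x : ∀ x, ∀ s ∈ J, HasDerivAt (fun x => H1 x s)
      (-(I * κ + μ) * H1 x s - (b' + starRingEnd ℂ (r x s)) * H0 x s) x)
    (hH0t : ∀ x, ∀ s ∈ J, HasDerivWithinAt (H0 x)
      ((2 * ν * μ + I * (-2 * κ * ν - b * b' + (b + r x s) * (b' + starRingEnd ℂ (r x s)))) * H0 x s
        + (I * rx x s - 2 * ν * (b + r x s)) * H1 x s) J s)
    (hH1t : ∀ x, ∀ s ∈ J, HasDerivWithinAt (H1 x)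
      ((2 * ν * μ - I * (-2 * κ * ν - b * b' + (b + r x s) * (b' + starRingEnd ℂ (r x s)))) * H1 x s
        + (I * starRingEnd ℂ (rx x s) + 2 * ν * (b' + starRingEnd ℂ (r x s))) * H0 x s) J s)
    (hrx : ∀ x, ∀ s ∈ J, HasDerivAt (fun x => r x s) (rx x s) x)
    (rel1 : α * (I * κ) - β * b' = μ * α) (rel2 : α * b - β * (I * κ) = μ * β)
    (cr : ∀ x, ContinuousOn (r x) J) (crx : ∀ x, ContinuousOn (rx x) J)
    (hr0 : ∀ s ∈ J, Tendsto (fun x => r x s) e.toFilter (𝓝 0))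
    (hrB : ∀ x, ∀ s ∈ J, ‖r x s‖ ≤ B)
    (hrxB : ∀ x, ∃ M, ∀ z ∈ Metric.ball x 1, ∀ s ∈ Set.uIcc 0 t, ‖rx z s‖ ≤ M)
    (hH0 : ∀ᶠ x in e.toFilter, ∀ s ∈ Set.uIcc 0 t, ‖H0 x s‖ ≤ C)
    (hH1 : ∀ᶠ x in e.toFilter, ∀ s ∈ Set.uIcc 0 t, ‖H1 x s‖ ≤ C) :
    Tendsto (fun x => (α * H0 x t + β * H1 x t) - (α * H0 x 0 + β * H1 x 0))
      e.toFilter (𝓝 0) := by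
  have hsub := hJ.uIcc_subset ht
  have cH0 : ∀ x, ContinuousOn (H0 x) J := fun x s hs => (hH0t x s hs).continuousWithinAt
  have cH1 : ∀ x, ContinuousOn (H1 x) J := fun x s hs => (hH1t x s hs).continuousWithinAt
  have crc : ∀ x, ContinuousOn (fun s => starRingEnd ℂ (r x s)) J := fun x =>
    continuous_conj.comp_continuousOn (cr x)
  have crxc : ∀ x, ContinuousOn (fun s => starRingEnd ℂ (rx x s)) J := fun x =>
    continuous_conj.comp_continuousOn (crx x)
  set H0x : ℝ → ℝ → ℂ := fun x s => (I * κ - μ) * H0 x s + (b + r x s) * H1 x s with hH0xd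
  set H1x : ℝ → ℝ → ℂ := fun x s =>
    -(I * κ + μ) * H1 x s - (b' + starRingEnd ℂ (r x s)) * H0 x s with hH1xd
  set Px : ℝ → ℝ → ℂ := fun x s => I * (α * (rx x s * H1 x s + r x s * H1x x s) +
    β * (starRingEnd ℂ (rx x s) * H0 x s + starRingEnd ℂ (r x s) * H0x x s)) with hPx
  set Wt : ℝ → ℝ → ℂ := fun x s =>
    I * (b * starRingEnd ℂ (r x s) + b' * r x s + r x s * starRingEnd ℂ (r x s)) *
      (α * H0 x s - β * H1 x s) + I * (α * rx x s * H1 x s + β * starRingEnd ℂ (rx x s) * H0 x s)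
      - 2 * ν * (α * r x s * H1 x s - β * starRingEnd ℂ (r x s) * H0 x s) with hWt
  -- The terms of W_t containing r_x are not known to decay pointwise. They are removed by writing
  -- them as the x-derivative of `P`, at the price of terms in which r multiplies x-derivatives of
  -- the coordinates.
  set P : ℝ → ℝ → ℂ := fun x s =>
    r x s * (I * α * H1 x s) + starRingEnd ℂ (r x s) * (I * β * H0 x s) with hP
  have cH0x : ∀ x, ContinuousOn (H0x x) J := fun x =>
    (continuousOn_const.mul (cH0 x)).add ((continuousOn_const.add (cr x)).mul (cH1 x))
  have cH1x : ∀ x, ContinuousOn (H1x x) J := fun x =>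
    (continuousOn_const.mul (cH1 x)).sub ((continuousOn_const.add (crc x)).mul (cH0 x))
  -- `S1` and `S2` are the bounded cofactors of r and of its conjugate in W_t - P_x, so that
  -- difference decays with r.
  set S1 : ℝ → ℝ → ℂ := fun x s => I * (b' + starRingEnd ℂ (r x s)) * (α * H0 x s - β * H1 x s)
    - 2 * ν * α * H1 x s - I * α * H1x x s with hS1
  set S2 : ℝ → ℝ → ℂ := fun x s => I * b * (α * H0 x s - β * H1 x s)
    + 2 * ν * β * H0 x s - I * β * H0x x s with hS2
  have hR : ∀ x s, Wt x s - Px x s = r x s * S1 x s + starRingEnd ℂ (r x s) * S2 x s := by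
    intro x s
    simp only [hWt, hPx, hS1, hS2]
    ring
  obtain ⟨D, hD⟩ : ∃ D, max B C ≤ D := ⟨_, le_rfl⟩
  have hBD := (le_max_left B C).trans hD
  have hCD := (le_max_right B C).trans hD
  have bound : ∀ f : ℂ × ℂ × ℂ × ℂ → ℂ, Continuous f → ∃ M, ∀ᶠ x in e.toFilter,
      ∀ s ∈ Set.uIcc 0 t, ‖f (r x s, starRingEnd ℂ (r x s), H0 x s, H1 x s)‖ ≤ M := by
    intro f hf
    obtain ⟨M, hM⟩ := exists_bound_of_continuous hf D
    refine ⟨M, ?_⟩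
    filter_upwards [hH0, hH1] with x h0 h1 s hs
    exact hM _ _ _ _ ((hrB x s (hsub hs)).trans hBD)
      ((RCLike.norm_conj _).trans_le ((hrB x s (hsub hs)).trans hBD)) ((h0 s hs).trans hCD)
      ((h1 s hs).trans hCD)
  obtain ⟨M1, hM1⟩ := bound (fun z => I * (b' + z.2.1) * (α * z.2.2.1 - β * z.2.2.2)
    - 2 * ν * α * z.2.2.2 - I * α * (-(I * κ + μ) * z.2.2.2 - (b' + z.2.1) * z.2.2.1)) (by fun_prop)
  obtain ⟨M2, hM2⟩ := bound (fun z => I * b * (α * z.2.2.1 - β * z.2.2.2)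
    + 2 * ν * β * z.2.2.1 - I * β * ((I * κ - μ) * z.2.2.1 + (b + z.1) * z.2.2.2)) (by fun_prop)
  obtain ⟨M3, hM3⟩ := bound (fun z => I * α * z.2.2.2) (by fun_prop)
  obtain ⟨M4, hM4⟩ := bound (fun z => I * β * z.2.2.1) (by fun_prop)
  obtain ⟨M5, hM5⟩ := bound (fun z => I * (α * (z.1 * (-(I * κ + μ) * z.2.2.2 -
    (b' + z.2.1) * z.2.2.1)) + β * (z.2.1 * ((I * κ - μ) * z.2.2.1 + (b + z.1) * z.2.2.2))))
    (by fun_prop)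
  have hcomb : ∀ {s1 s2 : ℂ} {m1 m2 : ℝ} (z : ℂ), ‖s1‖ ≤ m1 → ‖s2‖ ≤ m2 →
      ‖z * s1 + starRingEnd ℂ z * s2‖ ≤ ‖z‖ * (|m1| + |m2|) := by
    intro s1 s2 m1 m2 z h1 h2
    calc _ ≤ ‖z * s1‖ + ‖starRingEnd ℂ z * s2‖ := norm_add_le _ _
      _ = ‖z‖ * ‖s1‖ + ‖z‖ * ‖s2‖ := by rw [norm_mul, norm_mul, RCLike.norm_conj]
      _ ≤ ‖z‖ * |m1| + ‖z‖ * |m2| := by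
        gcongr
        · exact h1.trans (le_abs_self _)
        · exact h2.trans (le_abs_self _)
      _ = _ := by ring
  have hvan : ∀ {s1 s2 : ℝ → ℂ} {m1 m2 s : ℝ}, s ∈ J → (∀ᶠ x in e.toFilter, ‖s1 x‖ ≤ m1) →
      (∀ᶠ x in e.toFilter, ‖s2 x‖ ≤ m2) →
      Tendsto (fun x => r x s * s1 x + starRingEnd ℂ (r x s) * s2 x) e.toFilter (𝓝 0) := by
    intro s1 s2 m1 m2 s hs h1 h2
    refine squeeze_zero_norm' (a := fun x => ‖r x s‖ * (|m1| + |m2|)) ?_ ?_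
    · filter_upwards [h1, h2] with x hx1 hx2
      exact hcomb _ hx1 hx2
    · simpa using (hr0 s hs).norm.mul_const (|m1| + |m2|)
  have hbdd : ∀ {s1 s2 : ℝ → ℝ → ℂ} {m1 m2 : ℝ},
      (∀ᶠ x in e.toFilter, ∀ s ∈ Set.uIcc 0 t, ‖s1 x s‖ ≤ m1) →
      (∀ᶠ x in e.toFilter, ∀ s ∈ Set.uIcc 0 t, ‖s2 x s‖ ≤ m2) →
      ∀ᶠ x in e.toFilter, ∀ s ∈ Set.uIcc 0 t,
        ‖r x s * s1 x s + starRingEnd ℂ (r x s) * s2 x s‖ ≤ B * (|m1| + |m2|) := by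
    intro s1 s2 m1 m2 h1 h2
    filter_upwards [h1, h2] with x hx1 hx2 s hs
    exact (hcomb _ (hx1 s hs) (hx2 s hs)).trans
      (mul_le_mul_of_nonneg_right (hrB x s (hsub hs)) (by positivity))
  have h0t : (0 : ℝ) ∈ Set.uIcc 0 t := Set.left_mem_uIcc
  have htt : t ∈ Set.uIcc 0 t := Set.right_mem_uIcc
  have hpt : ∀ {f : ℝ → ℝ → ℂ} {m s : ℝ}, s ∈ Set.uIcc 0 t →
      (∀ᶠ x in e.toFilter, ∀ s ∈ Set.uIcc 0 t, ‖f x s‖ ≤ m) →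
      ∀ᶠ x in e.toFilter, ‖f x s‖ ≤ m := fun hs h => h.mono fun x hx => hx _ hs
  refine tendsto_increment_zero e hJ ht (W := fun x s => α * H0 x s + β * H1 x s) (P := P)
    (Wt := Wt) (Px := Px) (C := max (B * (|M3| + |M4|)) (B * (|M1| + |M2|)))
    (Φ' := fun x => (r x t * (α * H1 x t) + starRingEnd ℂ (r x t) * (-β * H0 x t)) -
      (r x 0 * (α * H1 x 0) + starRingEnd ℂ (r x 0) * (-β * H0 x 0)))
    (fun x s hs => ?_) (fun x s hs => ?_) (fun x => ?_) (fun x => ?_) (fun x => ?_) ?_ ?_ ?_ ?_ ?_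
    ?_ ?_
  · refine (((hH0t x s hs).const_mul α).add ((hH1t x s hs).const_mul β)).congr_deriv ?_
    simp only [hWt]
    -- By `rel1` and `rel2`, (α, β) is a left eigenvector of the background matrix with eigenvalue
    -- μ, which cancels every term free of r.
    linear_combination (-2 * ν * H0 x s) * rel1 - (2 * ν * H1 x s) * rel2
  · refine (((hrx x s hs).mul ((hH1x x s hs).const_mul (I * α))).add
      ((hasDerivAt_conj (hrx x s hs)).mul ((hH0x x s hs).const_mul (I * β)))).congr_deriv ?_
    simp only [hPx, hH0xd, hH1xd]
    ring
  · exact (((continuousOn_const.mul (((continuousOn_const.mul (crc x)).add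
      (continuousOn_const.mul (cr x))).add ((cr x).mul (crc x)))).mul
      ((continuousOn_const.mul (cH0 x)).sub (continuousOn_const.mul (cH1 x)))).add
      (continuousOn_const.mul (((continuousOn_const.mul (crx x)).mul (cH1 x)).add
        ((continuousOn_const.mul (crxc x)).mul (cH0 x))))).sub
      (continuousOn_const.mul (((continuousOn_const.mul (cr x)).mul (cH1 x)).sub
        ((continuousOn_const.mul (crc x)).mul (cH0 x))))
  · exact ((cr x).mul (continuousOn_const.mul (cH1 x))).add
      ((crc x).mul (continuousOn_const.mul (cH0 x)))
  · exact continuousOn_const.mul ((continuousOn_const.mul (((crx x).mul (cH1 x)).add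
      ((cr x).mul (cH1x x)))).add (continuousOn_const.mul (((crxc x).mul (cH0 x)).add
      ((crc x).mul (cH0x x)))))
  · filter_upwards [e.eventually_Icc hM3, e.eventually_Icc hM4, e.eventually_Icc hM5]
      with x h3 h4 h5
    -- Only a local bound on r_x enters here, for differentiation under the time integral; it may
    -- depend on x.
    obtain ⟨M, hM⟩ := hrxB x
    refine ⟨M * (|M3| + |M4|) + M5, fun z hz s hs => ?_⟩
    have hz' : z ∈ Set.Icc (x - 1) (x + 1) := by
      rw [Real.ball_eq_Ioo] at hz; exact Set.Ioo_subset_Icc_self hz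
    have e1 : Px z s = (rx z s * (I * α * H1 z s) + starRingEnd ℂ (rx z s) * (I * β * H0 z s)) +
        I * (α * (r z s * H1x z s) + β * (starRingEnd ℂ (r z s) * H0x z s)) := by
      simp only [hPx]; ring
    rw [e1]
    refine (norm_add_le _ _).trans (add_le_add ?_ (h5 z hz' s hs))
    exact (hcomb _ (h3 z hz' s hs) (h4 z hz' s hs)).trans
      (mul_le_mul_of_nonneg_right (hM z hz s hs) (by positivity))
  · filter_upwards [hbdd hM3 hM4] with x hx s hs
    exact (hx s hs).trans (le_max_left _ _)
  · filter_upwards [hbdd hM1 hM2] with x hx s hs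
    rw [hR]
    exact (hx s hs).trans (le_max_right _ _)
  · exact fun s hs => hvan (hsub hs) (hpt hs hM3) (hpt hs hM4)
  · intro s hs
    refine (hvan (hsub hs) (hpt hs hM1) (hpt hs hM2)).congr fun x => (hR x s).symm
  · have key : ∀ x, ∀ s ∈ J, HasDerivAt (fun x => α * H0 x s + β * H1 x s)
        (r x s * (α * H1 x s) + starRingEnd ℂ (r x s) * (-β * H0 x s)) x := by
      intro x s hs
      refine (((hH0x x s hs).const_mul α).add ((hH1x x s hs).const_mul β)).congr_deriv ?_
      linear_combination H0 x s * rel1 + H1 x s * rel2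
    exact fun x => (key x t ht).sub (key x 0 hJ.zero_mem)
  · obtain ⟨M6, hM6⟩ := bound (fun z => α * z.2.2.2) (by fun_prop)
    obtain ⟨M7, hM7⟩ := bound (fun z => -β * z.2.2.1) (by fun_prop)
    have := (hvan ht (hpt htt hM6) (hpt htt hM7)).sub
      (hvan hJ.zero_mem (hpt h0t hM6) (hpt h0t hM7))
    rwa [sub_zero] at this

/-! ### The Lax pair in the frame of a background wave -/

section

variable {p : Params} {e : SpatialEnd} {J : Set ℝ} {q : ℝ → ℝ → ℂ} {k : ℂ}

lemma hasDerivAt_bgWave_x (p : Params) (e : SpatialEnd) (x t : ℝ) :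
    HasDerivAt (fun y => bgWave p e y t)
      (-(I * ((e.sgn * p.V : ℝ) : ℂ)) * bgWave p e x t) x := by
  have h := ((((hasDerivAt_bgPhase_x p e x t).ofReal_comp).const_mul (-2 * I)).add_const
    (I * ((e.sgn * p.δ : ℝ) : ℂ))).cexp.const_mul (p.amp e : ℂ)
  refine h.congr_deriv ?_
  rw [bgWave]
  push_cast
  ring

lemma hasDerivAt_diff (hq : IsClassicalNLS J q) {t : ℝ} (ht : t ∈ J) (x : ℝ) :
    HasDerivAt (fun y => q y t - bgWave p e y t)
      (dX (fun y s => q y s - bgWave p e y s) x t) x :=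
  ((hq.diff_x x t ht).sub (hasDerivAt_bgWave_x p e x t).differentiableAt).hasDerivAt

lemma dX_diff (hq : IsClassicalNLS J q) {t : ℝ} (ht : t ∈ J) (x : ℝ) :
    dX (fun y s => q y s - bgWave p e y s) x t =
      dX q x t + I * ((e.sgn * p.V : ℝ) : ℂ) * bgWave p e x t := by
  refine ((hasDerivAt_diff hq ht x).unique
    ((hq.hasDerivAt_q ht x).sub (hasDerivAt_bgWave_x p e x t))).trans ?_
  ring

/-- The `x`-derivative of `resid`. -/
def residX (p : Params) (q : ℝ → ℝ → ℂ) (e : SpatialEnd) (x t : ℝ) : ℂ :=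
  dX (fun y s => q y s - bgWave p e y s) x t * exp (2 * I * (bgPhase p e x t : ℂ)) +
    I * ((e.sgn * p.V : ℝ) : ℂ) * resid p q e x t

lemma hasDerivAt_resid (hq : IsClassicalNLS J q) {t : ℝ} (ht : t ∈ J) (x : ℝ) :
    HasDerivAt (fun y => resid p q e y t) (residX p q e x t) x := by
  have h := (hasDerivAt_diff (p := p) (e := e) hq ht x).mul
    (((hasDerivAt_bgPhase_x p e x t).ofReal_comp.const_mul (2 * I)).cexp)
  refine h.congr_deriv ?_
  rw [residX, resid]
  push_cast
  ring

lemma dX_eq (hq : IsClassicalNLS J q) {t : ℝ} (ht : t ∈ J) (x : ℝ) :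
    dX q x t = (residX p q e x t - I * ((e.sgn * p.V : ℝ) : ℂ) *
      ((p.amp e : ℂ) * epsEnd p e + resid p q e x t)) *
        exp (-(I * (bgPhase p e x t : ℂ))) ^ 2 := by
  have h1 : exp (2 * I * (bgPhase p e x t : ℂ)) * exp (-(I * (bgPhase p e x t : ℂ))) ^ 2 = 1 := by
    rw [← exp_nat_mul, ← exp_add, ← exp_zero]
    congr 1; push_cast; ring
  have h2 : exp (-2 * I * (bgPhase p e x t : ℂ)) = exp (-(I * (bgPhase p e x t : ℂ))) ^ 2 := by
    rw [← exp_nat_mul]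
    congr 1; push_cast; ring
  rw [residX, dX_diff hq ht, bgWave, exp_add, h2, epsEnd]
  linear_combination -(dX q x t + I * ((e.sgn * p.V : ℝ) : ℂ) * ((p.amp e : ℂ) *
    (exp (-(I * (bgPhase p e x t : ℂ))) ^ 2 * exp (I * ((e.sgn * p.δ : ℝ) : ℂ))))) * h1

lemma conj_dX_eq (hq : IsClassicalNLS J q) {t : ℝ} (ht : t ∈ J) (x : ℝ) :
    starRingEnd ℂ (dX q x t) = (starRingEnd ℂ (residX p q e x t) + I * ((e.sgn * p.V : ℝ) : ℂ) *
      ((p.amp e : ℂ) * (epsEnd p e)⁻¹ + starRingEnd ℂ (resid p q e x t))) *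
        exp (I * (bgPhase p e x t : ℂ)) ^ 2 := by
  rw [dX_eq (p := p) (e := e) hq ht x, map_mul, map_sub, map_mul, map_mul, map_add, map_mul,
    conj_epsEnd, conj_ofReal, conj_ofReal, map_pow, ← exp_conj, conj_I]
  simp

lemma hasDerivAt_bgPhase_t (p : Params) (e : SpatialEnd) (x t : ℝ) :
    HasDerivAt (fun s => bgPhase p e x s) ((p.V ^ 2 - 2 * p.amp e ^ 2) / 2) t := by
  unfold bgPhase
  have := (((hasDerivAt_id t).const_mul (p.V ^ 2 - 2 * p.amp e ^ 2)).const_add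
    (e.sgn * p.V * x)).div_const 2
  simpa using this

lemma hasDerivAt_thetaEnd_t (p : Params) (e : SpatialEnd) (k : ℂ) (x t : ℝ) :
    HasDerivAt (fun s : ℝ => thetaEnd p e x s k)
      (-2 * lamEnd p e k * (k - ((e.sgn * p.V / 2 : ℝ) : ℂ))) t := by
  unfold thetaEnd
  have := (((hasDerivAt_id t).ofReal_comp.const_mul
    (2 * (k - ((e.sgn * p.V / 2 : ℝ) : ℂ)))).const_sub (x : ℂ)).const_mul (lamEnd p e k)
  refine this.congr_deriv ?_
  push_cast
  ring

/-- The `t`-equation in the frame `e^{-i f_± σ₃}`. -/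
lemma hasDerivWithinAt_frame (hq : IsClassicalNLS J q) {v : ℝ → Fin 2 → ℂ} {x t : ℝ} (ht : t ∈ J)
    (hv : HasDerivWithinAt v ((laxT q k x t).mulVec (v t)) J t) :
    HasDerivWithinAt (fun s => exp (I * (bgPhase p e x s : ℂ)) * v s 0)
        (I * (-2 * kShift p e k * (k - ((e.sgn * p.V / 2 : ℝ) : ℂ))
            - (p.amp e * epsEnd p e) * (p.amp e * (epsEnd p e)⁻¹) +
            (p.amp e * epsEnd p e + resid p q e x t) *
              (p.amp e * (epsEnd p e)⁻¹ + starRingEnd ℂ (resid p q e x t))) *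
          (exp (I * (bgPhase p e x t : ℂ)) * v t 0) +
          (I * residX p q e x t - 2 * (k - ((e.sgn * p.V / 2 : ℝ) : ℂ)) *
            (p.amp e * epsEnd p e + resid p q e x t)) *
            (exp (-(I * (bgPhase p e x t : ℂ))) * v t 1)) J t ∧
      HasDerivWithinAt (fun s => exp (-(I * (bgPhase p e x s : ℂ))) * v s 1)
        (-(I * (-2 * kShift p e k * (k - ((e.sgn * p.V / 2 : ℝ) : ℂ))
            - (p.amp e * epsEnd p e) * (p.amp e * (epsEnd p e)⁻¹) +
            (p.amp e * epsEnd p e + resid p q e x t) *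
              (p.amp e * (epsEnd p e)⁻¹ + starRingEnd ℂ (resid p q e x t))) *
          (exp (-(I * (bgPhase p e x t : ℂ))) * v t 1)) +
          (I * starRingEnd ℂ (residX p q e x t) + 2 * (k - ((e.sgn * p.V / 2 : ℝ) : ℂ)) *
            (p.amp e * (epsEnd p e)⁻¹ + starRingEnd ℂ (resid p q e x t))) *
            (exp (I * (bgPhase p e x t : ℂ)) * v t 0)) J t := by
  rw [laxT_mulVec, hasDerivWithinAt_pair, conj_q_eq p q e x t,
    conj_dX_eq (p := p) (e := e) hq ht x, dX_eq (p := p) (e := e) hq ht x] at hv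
  rw [q_eq p q e x t] at hv
  obtain ⟨hv0, hv1⟩ := hv
  have hf := ((hasDerivAt_bgPhase_t p e x t).ofReal_comp.const_mul I).hasDerivWithinAt (s := J)
  have hinv : exp (I * (bgPhase p e x t : ℂ)) * exp (-(I * (bgPhase p e x t : ℂ))) = 1 := by
    rw [← exp_add]; simp
  have hκ : kShift p e k = k + ((e.sgn * p.V / 2 : ℝ) : ℂ) := rfl
  have hε := mul_inv_cancel₀ (epsEnd_ne_zero (p := p) (e := e))
  have hs : ((e.sgn : ℂ)) * e.sgn = 1 := by exact_mod_cast e.sgn_sq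
  generalize hE : exp (I * (bgPhase p e x t : ℂ)) = E at hinv hv0 hv1 ⊢
  generalize hF : exp (-(I * (bgPhase p e x t : ℂ))) = F at hinv hv0 hv1 ⊢
  generalize resid p q e x t = r at hv0 hv1 ⊢
  generalize residX p q e x t = r' at hv0 hv1 ⊢
  have hEF2 : E ^ 2 * F ^ 2 = 1 := by rw [← mul_pow, hinv, one_pow]
  generalize starRingEnd ℂ r = rc at hv0 hv1 ⊢
  generalize starRingEnd ℂ r' = rc' at hv0 hv1 ⊢
  constructor
  · refine (hf.cexp.mul hv0).congr_deriv ?_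
    rw [hκ, hE]
    push_cast
    linear_combination (E * v t 0 * I * (p.amp e * epsEnd p e + r) *
      (p.amp e * (epsEnd p e)⁻¹ + rc)) * hEF2 + (v t 1 * F * (I * (r' - I * (e.sgn * p.V) *
      (p.amp e * epsEnd p e + r)) - 2 * k * (p.amp e * epsEnd p e + r))) * hinv
      - (v t 1 * F * (e.sgn * p.V) * (p.amp e * epsEnd p e + r)) * I_sq
      + (I * E * v t 0 * (p.amp e : ℂ) ^ 2) * hε - (I * E * v t 0 * (p.V : ℂ) ^ 2 / 2) * hs
  · refine (hf.neg.cexp.mul hv1).congr_deriv ?_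
    rw [hκ]
    simp only [Pi.neg_apply]
    rw [hF]
    push_cast
    linear_combination (-F * v t 1 * I * (p.amp e * epsEnd p e + r) *
      (p.amp e * (epsEnd p e)⁻¹ + rc)) * hEF2 + (v t 0 * E * (I * (rc' + I * (e.sgn * p.V) *
      (p.amp e * (epsEnd p e)⁻¹ + rc)) + 2 * k * (p.amp e * (epsEnd p e)⁻¹ + rc))) * hinv
      + (v t 0 * E * (e.sgn * p.V) * (p.amp e * (epsEnd p e)⁻¹ + rc)) * I_sq
      - (I * F * v t 1 * (p.amp e : ℂ) ^ 2) * hε + (I * F * v t 1 * (p.V : ℂ) ^ 2 / 2) * hs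

/-! ### Decay and continuity of the deviation from the background -/

/-- An integrable function with integrable derivative has a limit, which must be zero. The deviation
differs from q - q_± only by a unimodular factor. -/
lemma tendsto_resid_zero (hq : IsClassicalNLS J q) {t : ℝ} (ht : t ∈ J)
    (hi : MeasureTheory.IntegrableOn (fun x : ℝ => q x t - bgWave p e x t) e.halfLine)
    (hix : MeasureTheory.IntegrableOn (dX (fun y s => q y s - bgWave p e y s) · t) e.halfLine) :
    Tendsto (fun x => resid p q e x t) e.toFilter (𝓝 0) := by
  rw [tendsto_zero_iff_norm_tendsto_zero]
  simp only [norm_resid]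
  rw [← tendsto_zero_iff_norm_tendsto_zero]
  cases e
  · exact MeasureTheory.tendsto_zero_of_hasDerivAt_of_integrableOn_Ioi
      (fun x _ => hasDerivAt_diff hq ht x) hix hi
  · refine MeasureTheory.tendsto_zero_of_hasDerivAt_of_integrableOn_Iic (a := 0)
      (fun x _ => hasDerivAt_diff hq ht x) ?_ ?_
    · exact (integrableOn_Iic_iff_integrableOn_Iio (by simp)).2 hix
    · exact (integrableOn_Iic_iff_integrableOn_Iio (by simp)).2 hi

lemma continuous_bgWave (p : Params) (e : SpatialEnd) :
    Continuous fun z : ℝ × ℝ => bgWave p e z.1 z.2 := by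
  unfold bgWave bgPhase; fun_prop

lemma continuousOn_resid (hq : IsClassicalNLS J q) :
    ContinuousOn (fun z : ℝ × ℝ => resid p q e z.1 z.2) (Set.univ ×ˢ J) := by
  have : Continuous fun z : ℝ × ℝ => exp (2 * I * (bgPhase p e z.1 z.2 : ℂ)) := by
    unfold bgPhase; fun_prop
  exact (hq.cont.sub (continuous_bgWave p e).continuousOn).mul this.continuousOn

lemma continuousOn_residX (hq : IsClassicalNLS J q) :
    ContinuousOn (fun z : ℝ × ℝ => residX p q e z.1 z.2) (Set.univ ×ˢ J) := by
  have h1 : Continuous fun z : ℝ × ℝ => exp (2 * I * (bgPhase p e z.1 z.2 : ℂ)) := by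
    unfold bgPhase; fun_prop
  have h2 : ContinuousOn (fun z : ℝ × ℝ => (dX q z.1 z.2 +
      I * ((e.sgn * p.V : ℝ) : ℂ) * bgWave p e z.1 z.2) * exp (2 * I * (bgPhase p e z.1 z.2 : ℂ)) +
      I * ((e.sgn * p.V : ℝ) : ℂ) * resid p q e z.1 z.2) (Set.univ ×ˢ J) :=
    ((hq.cont_x.add (continuousOn_const.mul (continuous_bgWave p e).continuousOn)).mul
      h1.continuousOn).add (continuousOn_const.mul (continuousOn_resid hq))
  exact h2.congr fun z hz => by simp only [residX, dX_diff hq hz.2]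

lemma norm_resid_le {B : ℝ} (hB : ∀ x : ℝ, ∀ t ∈ J, ‖q x t‖ ≤ B) (x : ℝ) {t : ℝ} (ht : t ∈ J) :
    ‖resid p q e x t‖ ≤ B + |p.amp e| := by
  rw [norm_resid]
  refine (norm_sub_le _ _).trans (add_le_add (hB x t ht) ?_)
  rw [bgWave, norm_mul, norm_real, Real.norm_eq_abs, norm_exp]
  simp

/-! ### Growth in time -/

/-- The part of T containing q_x and |q|² is anti-Hermitian, so it drops out of the t-derivative of
|v|². Only terms in k² and kq remain, which gives a growth rate independent of x although q_x may be
unbounded. -/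
lemma IsLaxSolution.exists_norm_le (hJ : IsTimeDomain J) {B : ℝ}
    (hB : ∀ x : ℝ, ∀ t ∈ J, ‖q x t‖ ≤ B) {v : ℝ → ℝ → Fin 2 → ℂ} (hv : IsLaxSolution J q k v)
    {t : ℝ} (ht : t ∈ J) : ∃ C, 0 ≤ C ∧ ∀ x, ∀ s ∈ Set.uIcc 0 t, ‖v x s‖ ≤ C * ‖v x 0‖ := by
  set K := 4 * ‖k‖ ^ 2 + 4 * ‖k‖ * B with hK
  have hB0 : 0 ≤ B := (norm_nonneg _).trans (hB 0 t ht)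
  -- Grönwall bounds |v₀|² + |v₁|² with rate `K`, and the initial value is at most 2‖v‖² in the sup
  -- norm; the factor before ‖v x 0‖ is a convenient majorant of the square root.
  refine ⟨2 * Real.exp (K * |t|), by positivity, fun x s hs => ?_⟩
  have hsJ := hJ.uIcc_subset ht hs
  have hst : |s| ≤ |t| := by
    rcases Set.mem_uIcc.1 hs with h | h
    · rw [abs_of_nonneg h.1, abs_of_nonneg (h.1.trans h.2)]; exact h.2
    · rw [abs_of_nonpos h.2, abs_of_nonpos (h.1.trans h.2)]; linarith [h.1]
  have hnf : ∀ u : Fin 2 → ℂ, ‖u 0 * starRingEnd ℂ (u 0) + u 1 * starRingEnd ℂ (u 1)‖ =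
      ‖u 0‖ ^ 2 + ‖u 1‖ ^ 2 := by
    intro u
    rw [mul_conj', mul_conj', ← ofReal_pow, ← ofReal_pow, ← ofReal_add, norm_real, Real.norm_eq_abs,
      abs_of_nonneg (by positivity)]
  have h := hJ.norm_le_exp (f := fun s => v x s 0 * starRingEnd ℂ (v x s 0) +
      v x s 1 * starRingEnd ℂ (v x s 1))
    (f' := fun s => 2 * I * (starRingEnd ℂ k ^ 2 - k ^ 2) *
        (v x s 0 * starRingEnd ℂ (v x s 0) - v x s 1 * starRingEnd ℂ (v x s 1)) +
      2 * (starRingEnd ℂ k - k) * (q x s * v x s 1 * starRingEnd ℂ (v x s 0)) +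
      2 * (k - starRingEnd ℂ k) * (starRingEnd ℂ (q x s) * v x s 0 * starRingEnd ℂ (v x s 1)))
    (K := K) hsJ (fun s hs => by
      have h1 := hv.eq_t x s hs
      rw [laxT_mulVec, hasDerivWithinAt_pair] at h1
      obtain ⟨h10, h11⟩ := h1
      refine ((h10.mul h10.star).add (h11.mul h11.star)).congr_deriv ?_
      simp only [Complex.star_def, map_add, map_mul, map_sub, map_neg, conj_I, conj_conj, map_pow,
        map_ofNat]
      ring) (fun s hs _ => by
      rw [hnf]
      have hq' := hB x s hs
      have hkk : ‖starRingEnd ℂ k - k‖ ≤ 2 * ‖k‖ := by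
        refine (norm_sub_le _ _).trans ?_
        rw [RCLike.norm_conj]; linarith
      have hkk' : ‖k - starRingEnd ℂ k‖ ≤ 2 * ‖k‖ := by rwa [norm_sub_rev]
      have hk2 : ‖starRingEnd ℂ k ^ 2 - k ^ 2‖ ≤ 2 * ‖k‖ ^ 2 := by
        refine (norm_sub_le _ _).trans ?_
        rw [norm_pow, norm_pow, RCLike.norm_conj]; linarith
      set a := ‖v x s 0‖ with ha
      set b := ‖v x s 1‖ with hb
      have n1 : ‖v x s 0 * starRingEnd ℂ (v x s 0) - v x s 1 * starRingEnd ℂ (v x s 1)‖ ≤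
          a ^ 2 + b ^ 2 := by
        refine (norm_sub_le _ _).trans ?_
        rw [norm_mul, norm_mul, RCLike.norm_conj, RCLike.norm_conj]
        nlinarith
      have n2 : ‖q x s * v x s 1 * starRingEnd ℂ (v x s 0)‖ ≤ B * b * a := by
        rw [norm_mul, norm_mul, RCLike.norm_conj]
        gcongr
      have n3 : ‖starRingEnd ℂ (q x s) * v x s 0 * starRingEnd ℂ (v x s 1)‖ ≤ B * a * b := by
        rw [norm_mul, norm_mul, RCLike.norm_conj, RCLike.norm_conj]
        gcongr
      have m1 : ‖2 * I * (starRingEnd ℂ k ^ 2 - k ^ 2) * (v x s 0 * starRingEnd ℂ (v x s 0) -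
          v x s 1 * starRingEnd ℂ (v x s 1))‖ ≤ 2 * (2 * ‖k‖ ^ 2) * (a ^ 2 + b ^ 2) := by
        rw [norm_mul, norm_mul, norm_mul, norm_I, mul_one, norm_ofNat]
        gcongr
      have m2 : ‖2 * (starRingEnd ℂ k - k) * (q x s * v x s 1 * starRingEnd ℂ (v x s 0))‖ ≤
          2 * (2 * ‖k‖) * (B * b * a) := by
        rw [norm_mul, norm_mul, norm_ofNat]
        gcongr
      have m3 : ‖2 * (k - starRingEnd ℂ k) * (starRingEnd ℂ (q x s) * v x s 0 *
          starRingEnd ℂ (v x s 1))‖ ≤ 2 * (2 * ‖k‖) * (B * a * b) := by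
        rw [norm_mul, norm_mul, norm_ofNat]
        gcongr
      refine (norm_add₃_le).trans ((add_le_add (add_le_add m1 m2) m3).trans ?_)
      rw [hK]
      have : 0 ≤ ‖k‖ * B * (a - b) ^ 2 := by positivity
      nlinarith)
  rw [hnf, hnf] at h
  have hK0 : 0 ≤ K := by positivity
  have h2 : Real.exp (K * |s|) ≤ Real.exp (K * |t|) := by gcongr
  have hE1 : 1 ≤ Real.exp (K * |t|) := Real.one_le_exp (by positivity)
  have h0 := norm_le_pi_norm (v x 0) 0
  have h1 := norm_le_pi_norm (v x 0) 1
  set N := ‖v x 0‖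
  have hN : 0 ≤ N := norm_nonneg _
  have h3 : ‖v x s 0‖ ^ 2 + ‖v x s 1‖ ^ 2 ≤ (2 * Real.exp (K * |t|) * N) ^ 2 := by
    calc _ ≤ (N ^ 2 + N ^ 2) * Real.exp (K * |t|) := h.trans (by gcongr)
      _ ≤ _ := by
        have : N ^ 2 * Real.exp (K * |t|) * 1 ≤ N ^ 2 * Real.exp (K * |t|) * Real.exp (K * |t|) := by
          gcongr
        nlinarith [mul_nonneg (sq_nonneg N) (Real.exp_pos (K * |t|)).le]
  rw [pi_norm_le_iff_of_nonneg (by positivity), Fin.forall_fin_two]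
  constructor
  · exact abs_le_of_sq_le_sq' (by nlinarith [sq_nonneg ‖v x s 1‖]) (by positivity) |>.2
  · exact abs_le_of_sq_le_sq' (by nlinarith [sq_nonneg ‖v x s 0‖]) (by positivity) |>.2

end

/-! ### The Jost solutions at all times -/

/-- `q` is a bounded classical solution of the focusing NLS equation on `ℝ × J` that approaches the
background plane waves in `L¹`, together with its `x`-derivative. -/
structure HasBackground (J : Set ℝ) (p : Params) (q : ℝ → ℝ → ℂ) : Prop where
  amp : p.AmpNonneg
  dom : IsTimeDomain J
  nls : IsClassicalNLS J q
  bdd : ∃ B : ℝ, ∀ x : ℝ, ∀ t ∈ J, ‖q x t‖ ≤ B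
  int : ∀ t ∈ J, ∀ e : SpatialEnd,
    MeasureTheory.IntegrableOn (fun x : ℝ => q x t - bgWave p e x t) e.halfLine
  intX : ∀ t ∈ J, ∀ e : SpatialEnd,
    MeasureTheory.IntegrableOn (dX (fun y s => q y s - bgWave p e y s) · t) e.halfLine

section

variable {p : Params} {e : SpatialEnd} {J : Set ℝ} {q : ℝ → ℝ → ℂ} {k : ℂ}

/-- Each coordinate is a combination, with coefficients constant in x and t, of two normalized frame
components. This is the shape to which `tendsto_combination_increment` applies. -/
lemma jostCoord_eq (p : Params) (e : SpatialEnd) (j : Fin 2) (k : ℂ) (x t : ℝ) (v : Fin 2 → ℂ)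
    (i : Fin 2) : jostCoord p e j k x t v i =
      (if i = 0 then 1 else -(cEnd p e k * (epsEnd p e)⁻¹)) *
        ((dEnd p e k)⁻¹ * exp (-(colSign j * (I * thetaEnd p e x t k))) *
          (exp (I * (bgPhase p e x t : ℂ)) * v 0)) +
      (if i = 0 then -(cEnd p e k * epsEnd p e) else 1) *
        ((dEnd p e k)⁻¹ * exp (-(colSign j * (I * thetaEnd p e x t k))) *
          (exp (-(I * (bgPhase p e x t : ℂ))) * v 1)) := by
  fin_cases i <;> simp [jostCoord] <;> ring

lemma norm_jostCoord_le (hA : p.AmpNonneg) (hk : k ∉ branchCut p e) (j : Fin 2) (x t : ℝ)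
    (v : Fin 2 → ℂ) : ‖jostCoord p e j k x t v‖ ≤
      2 * ‖(dEnd p e k)⁻¹‖ * (‖exp (-(colSign j * (I * thetaEnd p e x t k)))‖ * ‖v‖) := by
  have hc := norm_cEnd_le_one hA hk
  have hε : ‖epsEnd p e‖ = 1 := norm_epsEnd
  rw [pi_norm_le_iff_of_nonneg (by positivity)]
  intro i
  have ha : ‖(if i = 0 then 1 else -(cEnd p e k * (epsEnd p e)⁻¹) : ℂ)‖ ≤ 1 := by
    split_ifs
    · simp
    · rwa [norm_neg, norm_mul, norm_inv, hε, inv_one, mul_one]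
  have hb : ‖(if i = 0 then -(cEnd p e k * epsEnd p e) else 1 : ℂ)‖ ≤ 1 := by
    split_ifs
    · rwa [norm_neg, norm_mul, hε, mul_one]
    · simp
  rw [jostCoord_eq]
  refine (norm_add_le _ _).trans ?_
  simp only [norm_mul, norm_exp_I_bgPhase, norm_exp_neg_I_bgPhase, one_mul]
  calc _ ≤ 1 * (‖(dEnd p e k)⁻¹‖ * ‖exp (-(colSign j * (I * thetaEnd p e x t k)))‖ * ‖v‖) +
      1 * (‖(dEnd p e k)⁻¹‖ * ‖exp (-(colSign j * (I * thetaEnd p e x t k)))‖ * ‖v‖) := by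
        gcongr
        · exact norm_le_pi_norm v 0
        · exact norm_le_pi_norm v 1
    _ = _ := by ring

lemma thetaEnd_sub (x s : ℝ) (k : ℂ) : thetaEnd p e x s k = thetaEnd p e x 0 k -
    2 * lamEnd p e k * (k - ((e.sgn * p.V / 2 : ℝ) : ℂ)) * s := by
  rw [thetaEnd, thetaEnd, ofReal_zero]; ring

/-- Moving from time 0 to s multiplies the weight by an exponential that does not involve x, and |v|
by a factor bounded uniformly in x; so a bound at time zero holds on the whole time interval. -/
lemma exists_bound_exp_mul (hJ : IsTimeDomain J) (hB : ∃ B : ℝ, ∀ x : ℝ, ∀ t ∈ J, ‖q x t‖ ≤ B)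
    {v : ℝ → ℝ → Fin 2 → ℂ} (hv : IsLaxSolution J q k v) (i : Fin 2) {t : ℝ} (ht : t ∈ J)
    (h0 : ∃ C, ∀ᶠ x in e.toFilter,
      ‖exp (-(colSign i * (I * thetaEnd p e x 0 k)))‖ * ‖v x 0‖ ≤ C) :
    ∃ C, ∀ᶠ x in e.toFilter, ∀ s ∈ Set.uIcc 0 t,
      ‖exp (-(colSign i * (I * thetaEnd p e x s k)))‖ * ‖v x s‖ ≤ C := by
  obtain ⟨B, hB⟩ := hB
  obtain ⟨C1, hC1⟩ := h0
  obtain ⟨C2, hC20, hC2⟩ := hv.exists_norm_le hJ hB ht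
  set w : ℂ := colSign i * (I * (2 * lamEnd p e k * (k - ((e.sgn * p.V / 2 : ℝ) : ℂ)))) with hw
  refine ⟨Real.exp (‖w‖ * |t|) * C2 * C1, ?_⟩
  filter_upwards [hC1] with x hx s hs
  have hst : |s| ≤ |t| := by
    have := Set.abs_sub_left_of_mem_uIcc hs
    simpa using this
  have h1 : ‖exp (w * s)‖ ≤ Real.exp (‖w‖ * |t|) := by
    refine (norm_exp_le_exp_norm _).trans (Real.exp_le_exp.2 ?_)
    rw [norm_mul, norm_real, Real.norm_eq_abs]
    gcongr
  have e1 : exp (-(colSign i * (I * thetaEnd p e x s k))) =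
      exp (w * s) * exp (-(colSign i * (I * thetaEnd p e x 0 k))) := by
    rw [← exp_add, thetaEnd_sub, hw]
    congr 1; ring
  rw [e1, norm_mul]
  calc _ ≤ Real.exp (‖w‖ * |t|) * ‖exp (-(colSign i * (I * thetaEnd p e x 0 k)))‖ *
        (C2 * ‖v x 0‖) := by
          gcongr
          exact hC2 x s hs
    _ = Real.exp (‖w‖ * |t|) * C2 *
        (‖exp (-(colSign i * (I * thetaEnd p e x 0 k)))‖ * ‖v x 0‖) := by ring
    _ ≤ _ := by gcongr

/-- A coordinate of a solution, normalized by its own exponential factor, is asymptotically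
constant in time as long as it is bounded at time zero. -/
lemma HasBackground.tendsto_jostCoord_increment (hb : HasBackground J p q)
    (hk : k ∉ branchCut p e) {v : ℝ → ℝ → Fin 2 → ℂ} (hv : IsLaxSolution J q k v) (i : Fin 2)
    {t : ℝ} (ht : t ∈ J) (h0 : ∃ C, ∀ᶠ x in e.toFilter,
      ‖exp (-(colSign i * (I * thetaEnd p e x 0 k)))‖ * ‖v x 0‖ ≤ C) :
    Tendsto (fun x => jostCoord p e i k x t (v x t) i - jostCoord p e i k x 0 (v x 0) i)
      e.toFilter (𝓝 0) := by
  have hA := hb.amp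
  obtain ⟨C, hC⟩ := exists_bound_exp_mul hb.dom hb.bdd hv i ht h0
  obtain ⟨B, hB⟩ := hb.bdd
  have hε := mul_inv_cancel₀ (epsEnd_ne_zero (p := p) (e := e))
  have hc1 := amp_mul_cEnd hA hk
  have hc2 := cEnd_mul_add hA hk
  have hl1 : cEnd p e k * p.amp e = I * (lamEnd p e k - kShift p e k) := by
    linear_combination (-I) * hc1 + (cEnd p e k * p.amp e) * I_sq
  have hl2 : (p.amp e : ℂ) = -(I * cEnd p e k * (lamEnd p e k + kShift p e k)) := by
    linear_combination I * hc2 + (p.amp e : ℂ) * I_sq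
  have hhx : ∀ x s, HasDerivAt (fun x : ℝ => (dEnd p e k)⁻¹ *
      exp (-(colSign i * (I * thetaEnd p e x s k)))) (-(colSign i * (I * lamEnd p e k)) *
        ((dEnd p e k)⁻¹ * exp (-(colSign i * (I * thetaEnd p e x s k))))) x := fun x s => by
    refine ((((hasDerivAt_thetaEnd_x p e k x s).const_mul I).const_mul
      (colSign i)).neg.cexp.const_mul (dEnd p e k)⁻¹).congr_deriv ?_
    simp only [Pi.neg_apply]
    ring
  have hht : ∀ x s, HasDerivWithinAt (fun s : ℝ => (dEnd p e k)⁻¹ *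
      exp (-(colSign i * (I * thetaEnd p e x s k)))) (2 * (k - ((e.sgn * p.V / 2 : ℝ) : ℂ)) *
        (colSign i * (I * lamEnd p e k)) *
        ((dEnd p e k)⁻¹ * exp (-(colSign i * (I * thetaEnd p e x s k))))) J s := fun x s => by
    refine (((((hasDerivAt_thetaEnd_t p e k x s).const_mul I).const_mul
      (colSign i)).neg.cexp.const_mul (dEnd p e k)⁻¹).congr_deriv ?_).hasDerivWithinAt
    simp only [Pi.neg_apply]
    ring
  simp only [jostCoord_eq]
  refine tendsto_combination_increment e hb.dom ht
    (H0 := fun x s => (dEnd p e k)⁻¹ * exp (-(colSign i * (I * thetaEnd p e x s k))) *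
          (exp (I * (bgPhase p e x s : ℂ)) * v x s 0))
    (H1 := fun x s => (dEnd p e k)⁻¹ * exp (-(colSign i * (I * thetaEnd p e x s k))) *
          (exp (-(I * (bgPhase p e x s : ℂ))) * v x s 1))
    (r := resid p q e) (rx := residX p q e) (κ := kShift p e k)
    (ν := k - ((e.sgn * p.V / 2 : ℝ) : ℂ)) (μ := colSign i * (I * lamEnd p e k))
    (b := p.amp e * epsEnd p e) (b' := p.amp e * (epsEnd p e)⁻¹) (B := B + |p.amp e|)
    (C := ‖(dEnd p e k)⁻¹‖ * C)
    (fun x s hs => ?_) (fun x s hs => ?_) (fun x s hs => ?_) (fun x s hs => ?_)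
    (fun x s hs => hasDerivAt_resid hb.nls hs x) ?_ ?_ (fun x => ?_) (fun x => ?_)
    (fun s hs => tendsto_resid_zero hb.nls hs (hb.int s hs e) (hb.intX s hs e))
    (fun x s hs => norm_resid_le hB x hs) (fun x => ?_) ?_ ?_
  · refine ((hhx x s).mul (hasDerivAt_frame (p := p) (e := e) (hv.eq_x x s hs)).1).congr_deriv ?_
    ring
  · refine ((hhx x s).mul (hasDerivAt_frame (p := p) (e := e) (hv.eq_x x s hs)).2).congr_deriv ?_
    ring
  · refine ((hht x s).mul (hasDerivWithinAt_frame (p := p) (e := e) hb.nls hs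
      (hv.eq_t x s hs)).1).congr_deriv ?_
    ring
  · refine ((hht x s).mul (hasDerivWithinAt_frame (p := p) (e := e) hb.nls hs
      (hv.eq_t x s hs)).2).congr_deriv ?_
    ring
  · fin_cases i
    · simp only [colSign, Fin.zero_eta, if_true]
      linear_combination hl1 + cEnd p e k * p.amp e * hε
    · simp [colSign]
      linear_combination -(epsEnd p e)⁻¹ * hl2
  · fin_cases i
    · simp only [colSign, Fin.zero_eta, if_true]
      linear_combination epsEnd p e * hl2
    · simp [colSign]
      linear_combination -hl1 - cEnd p e k * p.amp e * hε
  · exact (continuousOn_resid hb.nls).comp (f := fun s => (x, s)) (by fun_prop)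
      fun s hs => ⟨trivial, hs⟩
  · exact (continuousOn_residX hb.nls).comp (f := fun s => (x, s)) (by fun_prop)
      fun s hs => ⟨trivial, hs⟩
  · obtain ⟨M, hM⟩ := (isCompact_Icc.prod isCompact_uIcc).exists_bound_of_continuousOn
      ((continuousOn_residX (p := p) (e := e) hb.nls).mono (Set.prod_mono
        (Set.subset_univ (Set.Icc (x - 1) (x + 1))) (hb.dom.uIcc_subset ht)))
    refine ⟨M, fun z hz s hs => hM (z, s) ⟨?_, hs⟩⟩
    rw [Real.ball_eq_Ioo] at hz
    exact Set.Ioo_subset_Icc_self hz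
  · filter_upwards [hC] with x hx s hs
    rw [norm_mul, norm_mul, norm_mul, norm_exp_I_bgPhase, one_mul, mul_assoc]
    gcongr
    exact (mul_le_mul_of_nonneg_left (norm_le_pi_norm _ _) (norm_nonneg _)).trans (hx s hs)
  · filter_upwards [hC] with x hx s hs
    rw [norm_mul, norm_mul, norm_mul, norm_exp_neg_I_bgPhase, one_mul, mul_assoc]
    gcongr
    exact (mul_le_mul_of_nonneg_left (norm_le_pi_norm _ _) (norm_nonneg _)).trans (hx s hs)

lemma norm_exp_thetaEnd_of_real (hA : p.AmpNonneg) (hk : k ∉ branchCut p e) (hk0 : k.im = 0)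
    (x t : ℝ) (j : Fin 2) : ‖exp (-(colSign j * (I * thetaEnd p e x t k)))‖ = 1 := by
  have h1 : (lamEnd p e k).im = 0 := (lamEnd_im_sign hA hk).2.2 hk0
  have h2 : (thetaEnd p e x t k).im = 0 := by
    rw [thetaEnd, mul_im, h1]
    simp [hk0]
  rw [norm_exp, colSign_eq]
  simp [h2]

/-- The asymptotic condition of the Jost columns propagates in time. -/
theorem HasBackground.tendsto_jostPath (hb : HasBackground J p q) {j : Fin 2}
    (hk : k ∈ jostRegion p e j) {v : ℝ → ℝ → Fin 2 → ℂ} (hv : IsLaxSolution J q k v)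
    (h0 : ∀ i, Tendsto (fun y => jostPath p e j k 0 (fun x => v x 0) y i -
      (Pi.single j 1 : Fin 2 → ℂ) i) atTop (𝓝 0)) {t : ℝ} (ht : t ∈ J) (i : Fin 2) :
    Tendsto (fun y => jostPath p e j k t (fun x => v x t) y i - (Pi.single j 1 : Fin 2 → ℂ) i)
      atTop (𝓝 0) := by
  have hA := hb.amp
  have h0' : ∀ i, Tendsto (fun x => jostCoord p e j k x 0 (v x 0) i) e.toFilter
      (𝓝 ((Pi.single j 1 : Fin 2 → ℂ) i)) := by
    intro i
    rw [e.tendsto_iff]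
    have := (h0 i).add_const ((Pi.single j 1 : Fin 2 → ℂ) i)
    simp only [sub_add_cancel, zero_add] at this
    exact this
  suffices h : Tendsto (fun x => jostCoord p e j k x t (v x t) i) e.toFilter
      (𝓝 ((Pi.single j 1 : Fin 2 → ℂ) i)) by
    rw [e.tendsto_iff] at h
    have := h.sub_const ((Pi.single j 1 : Fin 2 → ℂ) i)
    rw [sub_self] at this
    exact this
  have hbd : ∃ C, ∀ᶠ x in e.toFilter,
      ‖exp (-(colSign j * (I * thetaEnd p e x 0 k)))‖ * ‖v x 0‖ ≤ C := by
    have h1 := (tendsto_pi_nhds (f := fun x => jostCoord p e j k x 0 (v x 0))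
      (g := Pi.single j 1)).2 h0'
    have h2 := h1.norm.eventually (ge_mem_nhds (lt_add_one _))
    refine ⟨2 * ‖(dEnd p e k)⁻¹‖ * (‖(Pi.single j 1 : Fin 2 → ℂ)‖ + 1), ?_⟩
    filter_upwards [h2] with x hx
    refine (norm_exp_mul_norm_le hA hk.1 j x 0 _).trans ?_
    gcongr
  -- The j-th coordinate carries its own exponential, so its time increment vanishes at infinity.
  -- The other coordinate needs a different argument according to whether k is real.
  by_cases hij : i = j
  · subst hij
    have := (hb.tendsto_jostCoord_increment hk.1 hv i ht hbd).add (h0' i)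
    simpa using this
  rw [Pi.single_eq_of_ne hij]
  have h0i := h0' i
  rw [Pi.single_eq_of_ne hij] at h0i
  by_cases hk0 : k.im = 0
  -- For real k all exponentials are unimodular, so the other coordinate may be renormalized by its
  -- own exponential without changing its modulus.
  · have hone := norm_exp_thetaEnd_of_real (p := p) (e := e) hA hk.1 hk0
    have hconv : ∀ x s, ‖jostCoord p e j k x s (v x s) i‖ = ‖jostCoord p e i k x s (v x s) i‖ := by
      intro x s
      have e1 : ∀ l, jostCoord p e l k x s (v x s) i =
          exp (-(colSign l * (I * thetaEnd p e x s k))) * ((dEnd p e k)⁻¹ *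
            ((if i = 0 then 1 else -(cEnd p e k * (epsEnd p e)⁻¹)) *
              (exp (I * (bgPhase p e x s : ℂ)) * v x s 0) +
            (if i = 0 then -(cEnd p e k * epsEnd p e) else 1) *
              (exp (-(I * (bgPhase p e x s : ℂ))) * v x s 1))) := by
        intro l; rw [jostCoord_eq]; ring
      rw [e1 j, e1 i, norm_mul, norm_mul (exp (-(colSign i * _))), hone, hone]
    rw [tendsto_zero_iff_norm_tendsto_zero] at h0i ⊢
    simp only [hconv] at h0i ⊢
    rw [← tendsto_zero_iff_norm_tendsto_zero] at h0i ⊢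
    have h1 := hb.tendsto_jostCoord_increment (e := e) hk.1 hv i ht (by
      simpa only [hone] using hbd)
    simpa using h1.add h0i
  -- Off the real line the other coordinate is strictly damped by the x-equation, so its mere
  -- boundedness at time t already forces it to vanish at infinity.
  · have hre : 0 < (jostExp p e j k i).re := by
      refine lt_of_le_of_ne (jostExp_re_nonneg hA hk i) (Ne.symm ?_)
      rw [jostExp_re p e j k hij]
      obtain ⟨ha, hb', -⟩ := lamEnd_im_sign hA hk.1
      have h1 : (lamEnd p e k).im ≠ 0 := by
        rcases lt_or_gt_of_ne hk0 with h | h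
        · exact (hb' h).ne
        · exact (ha h).ne'
      have h2 : jostSign e j ≠ 0 := by
        unfold jostSign
        cases e <;> simp only [SpatialEnd.sgn] <;> split_ifs <;> norm_num
      positivity
    obtain ⟨T, hT⟩ := HasTail.resid (p := p) (e := e) hb.nls ht (hb.int t ht e)
    obtain ⟨C, hC⟩ := exists_bound_exp_mul hb.dom hb.bdd hv j ht hbd
    have hM : ∀ᶠ x in e.toFilter, ‖jostCoord p e j k x t (v x t)‖ ≤
        2 * ‖(dEnd p e k)⁻¹‖ * |C| := by
      filter_upwards [hC] with x hx
      refine (norm_jostCoord_le hA hk.1 j x t _).trans ?_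
      gcongr
      exact (hx t Set.right_mem_uIcc).trans (le_abs_self _)
    obtain ⟨y0, hy0⟩ := eventually_atTop.1 (e.tendsto_sgn_mul.eventually hM)
    set M := 2 * ‖(dEnd p e k)⁻¹‖ * |C| with hMd
    rw [e.tendsto_iff]
    refine squeeze_zero_norm' (a := fun y => Real.exp (-((jostExp p e j k i).re * y)) * M +
      4 * ‖(detE p e k)⁻¹‖ * M * T y) ?_ ?_
    · filter_upwards [eventually_ge_atTop y0, eventually_ge_atTop 0] with y hy hy'
      -- Starting from 2y gives the bounded boundary value the damping factor exp(-(Re μ) y), with μ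
      -- the exponent of this coordinate; the forcing contributes a multiple of the tail at y.
      have h1 := norm_jostPath_sub_le hA hk hT (fun x => hv.eq_x x t ht) (y := y) (L := 2 * y)
        (by linarith) (by positivity) (fun s hs => hy0 s (hy.trans hs.1)) i
      rw [Pi.single_eq_of_ne hij, sub_zero, sub_zero, show 2 * y - y = y by ring] at h1
      refine h1.trans ?_
      gcongr
      exact (norm_le_pi_norm _ i).trans (hy0 (2 * y) (by linarith))
    · have h1 : Tendsto (fun y => Real.exp (-((jostExp p e j k i).re * y))) atTop (𝓝 0) :=
        Real.tendsto_exp_neg_atTop_nhds_zero.comp (tendsto_id.const_mul_atTop hre)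
      simpa using (h1.mul_const M).add (hT.tendsto.const_mul (4 * ‖(detE p e k)⁻¹‖ * M))

/-- The Jost columns exist, and are given by initial values that are continuous in the spectral
parameter and analytic in the interior of their domain. -/
theorem HasBackground.exists_jost_eq (hb : HasBackground J p q) (e : SpatialEnd) (j : Fin 2) :
    ∃ a : ℂ → Fin 2 → ℂ, ContinuousOn a (jostRegion p e j) ∧
      DifferentiableOn ℂ a {k | k ∉ branchCut p e ∧ 0 < jostSign e j * k.im} ∧
      ∀ k ∈ jostRegion p e j, IsJostColumn J p q e j k (fun x t => (Psi J q x t k).mulVec (a k)) ∧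
        ∀ x, ∀ t ∈ J, jost J p q e j x t k = (Psi J q x t k).mulVec (a k) := by
  obtain ⟨a, ha, ha', has⟩ := exists_jost_initial hb.amp hb.dom hb.nls
    (hb.int 0 hb.dom.zero_mem e) j
  refine ⟨a, ha, ha', fun k hk => ?_⟩
  have hv := isLaxSolution_Psi_mulVec hb.dom hb.nls k (a k)
  have hcol : IsJostColumn J p q e j k (fun x t => (Psi J q x t k).mulVec (a k)) :=
    ⟨hv, fun t ht => (asymp_iff hb.amp hk.1 j t _).2
      fun i => hb.tendsto_jostPath hk hv (has k hk) ht i⟩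
  refine ⟨hcol, fun x t ht => ?_⟩
  have hj : IsJostColumn J p q e j k (fun x t => jost J p q e j x t k) :=
    Classical.epsilon_spec (p := IsJostColumn J p q e j k) ⟨_, hcol⟩
  obtain ⟨T, hT⟩ := HasTail.resid (p := p) (e := e) hb.nls ht (hb.int t ht e)
  exact jost_unique hb.amp hk hT (fun x => hj.lax.eq_x x t ht) (fun x => hcol.lax.eq_x x t ht)
    ((asymp_iff hb.amp hk.1 j t _).1 (hj.asymp t ht))
    ((asymp_iff hb.amp hk.1 j t _).1 (hcol.asymp t ht)) x

lemma HasBackground.isJostColumn (hb : HasBackground J p q) {j : Fin 2}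
    (hk : k ∈ jostRegion p e j) : IsJostColumn J p q e j k (fun x t => jost J p q e j x t k) := by
  obtain ⟨a, -, -, h⟩ := hb.exists_jost_eq e j
  exact Classical.epsilon_spec (p := IsJostColumn J p q e j k) ⟨_, (h k hk).1⟩

lemma HasBackground.jost_eq (hb : HasBackground J p q) {j : Fin 2} (hk : k ∈ jostRegion p e j)
    (x : ℝ) {t : ℝ} (ht : t ∈ J) :
    jost J p q e j x t k = (Psi J q x t k).mulVec (jost J p q e j 0 0 k) :=
  (hb.isJostColumn hk).lax.eq_Psi_mulVec hb.dom hb.nls x ht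

lemma HasBackground.continuousOn_jost (hb : HasBackground J p q) (e : SpatialEnd) (j : Fin 2)
    (x : ℝ) {t : ℝ} (ht : t ∈ J) : ContinuousOn (jost J p q e j x t) (jostRegion p e j) := by
  obtain ⟨a, ha, -, h⟩ := hb.exists_jost_eq e j
  have hd := fun i l => (differentiable_Psi hb.dom hb.nls x ht i l).continuous
  have h1 : ContinuousOn (fun k => (Psi J q x t k).mulVec (a k)) (jostRegion p e j) := by
    rw [continuousOn_pi] at ha ⊢
    intro i
    simp only [Matrix.mulVec, dotProduct, Fin.sum_univ_two]
    exact ((hd i 0).continuousOn.mul (ha 0)).add ((hd i 1).continuousOn.mul (ha 1))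
  exact h1.congr fun k hk => (h k hk).2 x t ht

lemma HasBackground.differentiableOn_jost (hb : HasBackground J p q) (e : SpatialEnd) (j : Fin 2)
    (x : ℝ) {t : ℝ} (ht : t ∈ J) : DifferentiableOn ℂ (jost J p q e j x t)
      {k | k ∉ branchCut p e ∧ 0 < jostSign e j * k.im} := by
  obtain ⟨a, -, ha, h⟩ := hb.exists_jost_eq e j
  have hd := fun i l => differentiable_Psi hb.dom hb.nls x ht i l
  have h1 : DifferentiableOn ℂ (fun k => (Psi J q x t k).mulVec (a k))
      {k | k ∉ branchCut p e ∧ 0 < jostSign e j * k.im} := by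
    rw [differentiableOn_pi] at ha ⊢
    intro i
    simp only [Matrix.mulVec, dotProduct, Fin.sum_univ_two]
    exact ((hd i 0).differentiableOn.mul (ha 0)).add ((hd i 1).differentiableOn.mul (ha 1))
  exact h1.congr fun k hk => (h k ⟨hk.1, hk.2.le⟩).2 x t ht

end

/-! ### Jost solutions for large spectral parameter: coordinates -/

section

variable {p : Params} {e : SpatialEnd} {J : Set ℝ} {q : ℝ → ℝ → ℂ} {k : ℂ}

/-- The entry in row `i` of the off-diagonal matrix `offDiag r`. -/
def offEntry (r : ℂ) (i : Fin 2) : ℂ := if i = 0 then r else -starRingEnd ℂ r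

lemma norm_offEntry (r : ℂ) (i : Fin 2) : ‖offEntry r i‖ = ‖r‖ := by
  unfold offEntry
  split_ifs
  · rfl
  · rw [norm_neg, RCLike.norm_conj]

/-- Since E_± = I + O(c) and 1/det - 1 = c²/det, the force equals the off-diagonal potential acting
on u up to terms with a factor c, which is O(1/k) for large k. -/
lemma norm_jostForce_sub_le (hA : p.AmpNonneg) (hk : k ∉ branchCut p e)
    (hD : ‖(detE p e k)⁻¹‖ ≤ 2) (r : ℂ) (u : Fin 2 → ℂ) {i j : Fin 2} (hij : i ≠ j) :
    ‖jostForce p e k r u i - offEntry r i * u j‖ ≤ 8 * ‖cEnd p e k‖ * ‖r‖ * ‖u‖ := by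
  have hc := norm_cEnd_le_one hA hk
  have hε : ‖epsEnd p e‖ = 1 := norm_epsEnd
  have hε' : ‖(epsEnd p e)⁻¹‖ = 1 := by rw [norm_inv, hε, inv_one]
  have hD1 : (detE p e k)⁻¹ - 1 = (detE p e k)⁻¹ * cEnd p e k ^ 2 := by
    have h0 := detE_ne_zero hA hk
    field_simp
    rw [detE_eq hA hk]; ring
  have key : ∀ a b ε : ℂ, ‖ε‖ = 1 → ‖a‖ ≤ ‖u‖ → ‖b‖ ≤ ‖u‖ →
      ‖(detE p e k)⁻¹ * (a + cEnd p e k * ε * b) - a‖ ≤ 4 * ‖cEnd p e k‖ * ‖u‖ := by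
    intro a b ε h1 ha hb
    have e1 : (detE p e k)⁻¹ * (a + cEnd p e k * ε * b) - a =
        (detE p e k)⁻¹ * cEnd p e k * (cEnd p e k * a + ε * b) := by
      linear_combination a * hD1
    rw [e1, norm_mul, norm_mul]
    have h2 : ‖cEnd p e k * a + ε * b‖ ≤ 1 * ‖u‖ + 1 * ‖u‖ := by
      refine (norm_add_le _ _).trans ?_
      rw [norm_mul, norm_mul, h1]
      gcongr
    calc _ ≤ 2 * ‖cEnd p e k‖ * (1 * ‖u‖ + 1 * ‖u‖) := by gcongr
      _ = _ := by ring
  have key2 : ∀ a b ε : ℂ, ‖ε‖ = 1 → ‖a‖ ≤ ‖u‖ → ‖b‖ ≤ ‖u‖ →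
      ‖(detE p e k)⁻¹ * (a + cEnd p e k * ε * b)‖ ≤ 4 * ‖u‖ := by
    intro a b ε h1 ha hb
    rw [norm_mul]
    have h2 : ‖a + cEnd p e k * ε * b‖ ≤ ‖u‖ + 1 * 1 * ‖u‖ := by
      refine (norm_add_le _ _).trans ?_
      rw [norm_mul, norm_mul, h1]
      gcongr
    calc _ ≤ 2 * (‖u‖ + 1 * 1 * ‖u‖) := by gcongr
      _ = _ := by ring
  have h0 := norm_le_pi_norm u 0
  have h1 := norm_le_pi_norm u 1
  have hcr : ‖starRingEnd ℂ r‖ = ‖r‖ := RCLike.norm_conj r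
  have a0 := key (u 0) (u 1) _ hε h0 h1
  have a1 := key (u 1) (u 0) _ hε' h1 h0
  have b0 := key2 (u 0) (u 1) _ hε h0 h1
  have b1 := key2 (u 1) (u 0) _ hε' h1 h0
  set V0 := (detE p e k)⁻¹ * (u 0 + cEnd p e k * epsEnd p e * u 1)
  set V1 := (detE p e k)⁻¹ * (u 1 + cEnd p e k * (epsEnd p e)⁻¹ * u 0)
  have fin : ∀ {X Y z w ε : ℂ}, ‖z‖ = ‖r‖ → ‖w‖ = ‖r‖ → ‖ε‖ = 1 →
      ‖X‖ ≤ 4 * ‖cEnd p e k‖ * ‖u‖ → ‖Y‖ ≤ 4 * ‖u‖ →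
      ‖z * X + cEnd p e k * ε * (w * Y)‖ ≤ 8 * ‖cEnd p e k‖ * ‖r‖ * ‖u‖ := by
    intro X Y z w ε hz hw hε hX hY
    refine (norm_add_le _ _).trans ?_
    rw [norm_mul, norm_mul, norm_mul, norm_mul, hz, hw, hε]
    calc _ ≤ ‖r‖ * (4 * ‖cEnd p e k‖ * ‖u‖) + ‖cEnd p e k‖ * 1 * (‖r‖ * (4 * ‖u‖)) := by gcongr
      _ = _ := by ring
  have e0 : jostForce p e k r u 0 = r * V1 + cEnd p e k * epsEnd p e * (starRingEnd ℂ r * V0) := rfl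
  have e1 : jostForce p e k r u 1 =
    -(starRingEnd ℂ r * V0) - cEnd p e k * (epsEnd p e)⁻¹ * (r * V1) := rfl
  have h01 : (i = 0 ∧ j = 1) ∨ (i = 1 ∧ j = 0) := by
    fin_cases i <;> fin_cases j <;> simp at hij ⊢
  rcases h01 with ⟨rfl, rfl⟩ | ⟨rfl, rfl⟩
  · rw [e0, offEntry, if_pos rfl, show r * V1 + cEnd p e k * epsEnd p e * (starRingEnd ℂ r * V0)
      - r * u 1 = r * (V1 - u 1) + cEnd p e k * epsEnd p e * (starRingEnd ℂ r * V0) by ring]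
    exact fin rfl hcr hε a1 b0
  · rw [e1, offEntry, if_neg (by simp), show -(starRingEnd ℂ r * V0) - cEnd p e k *
      (epsEnd p e)⁻¹ * (r * V1) - -starRingEnd ℂ r * u 0 = (-starRingEnd ℂ r) * (V0 - u 0) +
        cEnd p e k * (epsEnd p e)⁻¹ * ((-r) * V1) by ring]
    exact fin (by rw [norm_neg, hcr]) (norm_neg r) hε' a0 b1

lemma hasDerivAt_offEntry {r : ℝ → ℂ} {r' : ℂ} {y : ℝ} (h : HasDerivAt r r' y) (i : Fin 2) :
    HasDerivAt (fun y => offEntry (r y) i) (offEntry r' i) y := by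
  unfold offEntry
  split_ifs
  · exact h
  · exact (hasDerivAt_conj h).neg

lemma HasBackground.exists_tail (hb : HasBackground J p q) {t : ℝ} (ht : t ∈ J) (e : SpatialEnd) :
    ∃ T, HasTail (fun y => ‖resid p q e (e.sgn * y) t‖ + ‖residX p q e (e.sgn * y) t‖) T ∧
      Antitone T := by
  have hs : Continuous fun y : ℝ => (e.sgn * y, t) := by fun_prop
  have c1 : Continuous fun y => resid p q e (e.sgn * y) t :=
    (continuousOn_resid hb.nls).comp_continuous hs fun y => ⟨trivial, ht⟩
  have c2 : Continuous fun y => residX p q e (e.sgn * y) t :=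
    (continuousOn_residX hb.nls).comp_continuous hs fun y => ⟨trivial, ht⟩
  have i1 : MeasureTheory.IntegrableOn (fun y => ‖resid p q e (e.sgn * y) t‖) (Set.Ioi 0) := by
    simp only [norm_resid]
    exact (e.integrableOn_comp (hb.int t ht e)).norm
  have i2 := (e.integrableOn_comp (hb.intX t ht e)).norm
  have i3 : MeasureTheory.IntegrableOn (fun y => ‖residX p q e (e.sgn * y) t‖) (Set.Ioi 0) := by
    -- Passing to the rotating frame adds to the derivative a multiple V of the deviation, which is
    -- itself integrable.
    refine (i2.add (i1.const_mul |p.V|)).mono' c2.norm.aestronglyMeasurable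
      (Eventually.of_forall fun y => ?_)
    rw [norm_norm, residX]
    refine (norm_add_le _ _).trans (add_le_add ?_ ?_)
    · rw [norm_mul, show 2 * I * (bgPhase p e (e.sgn * y) t : ℂ) =
        ((2 * bgPhase p e (e.sgn * y) t : ℝ) : ℂ) * I by push_cast; ring, norm_exp_ofReal_mul_I,
        mul_one]
    · rw [norm_mul, norm_mul, norm_I, one_mul, norm_real, Real.norm_eq_abs, abs_mul, e.abs_sgn,
        one_mul]
  obtain ⟨T, hT⟩ := hasTail_of_integrableOn (c1.norm.add c2.norm)
    (fun y => add_nonneg (norm_nonneg _) (norm_nonneg _)) (i1.add i3)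
  exact hT.exists_antitone

lemma HasTail.mono {n m T : ℝ → ℝ} (h : HasTail n T) (hm : Continuous m) (h0 : ∀ y, 0 ≤ m y)
    (hmn : ∀ y, m y ≤ n y) : HasTail m T :=
  ⟨hm, h0, fun y L hyL => (intervalIntegral.integral_mono_on hyL (hm.intervalIntegrable _ _)
    (h.cont.intervalIntegrable _ _) fun s _ => hmn s).trans (h.le y L hyL), h.tendsto⟩

/-- In asymptotic coordinates, the Jost column differs from the unit vector by a quantity of the
size of the inverse of the spectral parameter. -/
lemma HasBackground.exists_norm_jostPath_sub_le (hb : HasBackground J p q) {t : ℝ} (ht : t ∈ J)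
    (e : SpatialEnd) (j : Fin 2) (y : ℝ) : ∃ C, ∀ k ∈ jostRegion p e j, ∀ ε : ℝ, 0 ≤ ε →
      ‖(detE p e k)⁻¹‖ ≤ 2 → ‖cEnd p e k‖ ≤ ε →
      (∀ i, i ≠ j → jostExp p e j k i ≠ 0 ∧ ‖(jostExp p e j k i)⁻¹‖ ≤ ε) →
      ∀ i, ‖jostPath p e j k t (fun x => jost J p q e j x t k) y i -
        (Pi.single j 1 : Fin 2 → ℂ) i‖ ≤ C * ε := by
  have hA := hb.amp
  obtain ⟨T, hT, hTa⟩ := hb.exists_tail ht e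
  obtain ⟨B, hB⟩ := hb.bdd
  have hs1 : ‖(e.sgn : ℂ)‖ = 1 := by rw [norm_real, Real.norm_eq_abs, e.abs_sgn]
  have hs2 : (e.sgn : ℂ) * e.sgn = 1 := by exact_mod_cast e.sgn_sq
  set R := B + |p.amp e| with hR
  set r : ℝ → ℂ := fun y => resid p q e (e.sgn * y) t with hr
  set r' : ℝ → ℂ := fun y => residX p q e (e.sgn * y) t with hr'
  have hrR : ∀ y, ‖r y‖ ≤ R := fun y => norm_resid_le hB _ ht
  have hR0 : 0 ≤ R := (norm_nonneg _).trans (hrR 0)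
  have hrd : ∀ y, HasDerivAt r (e.sgn * r' y) y := by
    intro y
    have := (hasDerivAt_resid (p := p) (e := e) hb.nls ht (e.sgn * y)).scomp y
      ((hasDerivAt_id y).const_mul e.sgn)
    refine this.congr_deriv ?_
    rw [real_smul, mul_one]
  have hrc : Continuous r := continuous_iff_continuousAt.2 fun y => (hrd y).continuousAt
  have hTr : HasTail (fun y => ‖r y‖) T := hT.mono hrc.norm (fun y => norm_nonneg _)
    fun y => le_add_of_nonneg_right (norm_nonneg _)
  have hTy := hT.tail_nonneg y
  -- `M` bounds the path to the right of y, using ‖1/det‖ ≤ 2; εG multiplies the integrand left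
  -- after the integration by parts, and Hε bounds the coordinate other than j.
  set M := Real.exp (8 * T y) with hM
  have hM0 : 0 < M := Real.exp_pos _
  set G := M * (9 + 8 * R) with hG
  set H := G * T y + R * M with hH
  have hG0 : 0 ≤ G := by positivity
  have hH0 : 0 ≤ H := by positivity
  refine ⟨H + (8 * M + H) * T y, fun k hk ε hε hD hc hμ => ?_⟩
  have hcol := hb.isJostColumn hk
  have hw := hasDerivAt_jostPath (p := p) (e := e) hA hk.1 j (fun x => hcol.lax.eq_x x t ht)
  have hlim := (asymp_iff hA hk.1 j t _).1 (hcol.asymp t ht)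
  set w : ℝ → Fin 2 → ℂ := jostPath p e j k t (fun x => jost J p q e j x t k) with hwd
  have hwlim : Tendsto w atTop (𝓝 (Pi.single j 1)) := by
    rw [tendsto_pi_nhds]
    intro i
    simpa using (hlim i).add_const ((Pi.single j 1 : Fin 2 → ℂ) i)
  have hwM : ∀ s, y ≤ s → ‖w s‖ ≤ M := by
    intro s hs
    have h1 : Tendsto (fun L => ‖w L‖ * Real.exp (4 * ‖(detE p e k)⁻¹‖ * T s)) atTop
        (𝓝 (1 * Real.exp (4 * ‖(detE p e k)⁻¹‖ * T s))) := by
      have := hwlim.norm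
      rw [norm_single_le] at this
      exact this.mul_const _
    have h2 : ‖w s‖ ≤ 1 * Real.exp (4 * ‖(detE p e k)⁻¹‖ * T s) := by
      refine ge_of_tendsto h1 ?_
      filter_upwards [eventually_ge_atTop s] with L hL
      exact norm_jostPath_le hA hk hTr (fun x => hcol.lax.eq_x x t ht) hL
    refine h2.trans ?_
    rw [one_mul, hM]
    have h3 := hTa hs
    have h4 := hT.tail_nonneg s
    refine Real.exp_le_exp.2 ?_
    nlinarith [norm_nonneg (detE p e k)⁻¹]
  have hforce : ∀ s, y ≤ s → ∀ i, ‖jostForce p e k (r s) (w s) i‖ ≤ 8 * ‖r s‖ * M := by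
    intro s hs i
    refine (norm_jostForce_le hA hk.1 _ _ i).trans ?_
    have := hwM s hs
    calc _ ≤ 4 * 2 * ‖r s‖ * M := by gcongr
      _ = _ := by ring
  have hforce' : ∀ s, y ≤ s → ∀ {i l : Fin 2}, i ≠ l →
      ‖jostForce p e k (r s) (w s) i - offEntry (r s) i * w s l‖ ≤ 8 * ε * ‖r s‖ * M := by
    intro s hs i l hil
    refine (norm_jostForce_sub_le hA hk.1 hD _ _ hil).trans ?_
    have := hwM s hs
    gcongr
  have hoff : ∀ i, i ≠ j → ∀ s, y ≤ s → ‖w s i‖ ≤ H * ε := by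
    intro o ho s hs
    obtain ⟨hμ0, hμε⟩ := hμ o ho
    set μ := jostExp p e j k o with hμd
    -- Integration by parts in differential form. The added term cancels the leading force r w_j
    -- through the large exponent μ; what is left carries a factor μ⁻¹ or c, and the derivative has
    -- fallen on r.
    have hv : ∀ z, HasDerivAt (fun z => w z o + e.sgn * (offEntry (r z) o * μ⁻¹) * w z j)
        (μ * (w z o + e.sgn * (offEntry (r z) o * μ⁻¹) * w z j) +
          (e.sgn * (jostForce p e k (r z) (w z) o - offEntry (r z) o * w z j) +
            e.sgn * (offEntry (e.sgn * r' z) o * μ⁻¹) * w z j +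
            offEntry (r z) o * μ⁻¹ * jostForce p e k (r z) (w z) j)) z := by
      intro z
      refine ((hw z o).add (((((hasDerivAt_offEntry (hrd z) o).mul_const μ⁻¹).const_mul
        (e.sgn : ℂ)).mul (hw z j)))).congr_deriv ?_
      rw [jostExp_self]
      linear_combination (offEntry (r z) o * μ⁻¹ * jostForce p e k (r z) (w z) j) * hs2 -
        (e.sgn * offEntry (r z) o * w z j) * (mul_inv_cancel₀ hμ0)
    have hbd : ∀ z, y ≤ z → ‖e.sgn * (jostForce p e k (r z) (w z) o - offEntry (r z) o * w z j) +
            e.sgn * (offEntry (e.sgn * r' z) o * μ⁻¹) * w z j +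
            offEntry (r z) o * μ⁻¹ * jostForce p e k (r z) (w z) j‖ ≤
        (ε * G) * (‖r z‖ + ‖r' z‖) := by
      intro z hz
      have n1 := hforce' z hz ho
      have n2 := hforce z hz j
      have n3 := (norm_le_pi_norm (w z) j).trans (hwM z hz)
      refine norm_add₃_le.trans ?_
      simp only [norm_mul, norm_offEntry, hs1, one_mul]
      calc _ ≤ 8 * ε * ‖r z‖ * M + ‖r' z‖ * ε * M + ‖r z‖ * ε * (8 * R * M) := by
            gcongr
            refine n2.trans ?_
            gcongr
            exact hrR z
        _ ≤ _ := by
            rw [hG]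
            have := mul_nonneg (mul_nonneg hε hM0.le) (norm_nonneg (r z))
            have h5 := mul_nonneg (mul_nonneg hε hM0.le) (norm_nonneg (r' z))
            nlinarith [mul_nonneg hR0 h5]
    have hvlim : Tendsto (fun z => ‖w z o + e.sgn * (offEntry (r z) o * μ⁻¹) * w z j‖ + ε * G * T s)
        atTop (𝓝 (0 + ε * G * T s)) := by
      have h1 : Tendsto (fun z => w z o) atTop (𝓝 0) := by
        have := (tendsto_pi_nhds.1 hwlim) o
        rwa [Pi.single_eq_of_ne ho] at this
      have h2 : Tendsto (fun z => w z j) atTop (𝓝 1) := by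
        have := (tendsto_pi_nhds.1 hwlim) j
        rwa [Pi.single_eq_same] at this
      have h3 : Tendsto (fun z => offEntry (r z) o) atTop (𝓝 0) := by
        rw [tendsto_zero_iff_norm_tendsto_zero]
        simp only [norm_offEntry]
        rw [← tendsto_zero_iff_norm_tendsto_zero]
        exact e.tendsto_iff.1 (tendsto_resid_zero hb.nls ht (hb.int t ht e) (hb.intX t ht e))
      have h4 := (h1.add (((h3.mul_const μ⁻¹).const_mul (e.sgn : ℂ)).mul h2)).norm
      simp only [zero_mul, mul_zero, add_zero, norm_zero] at h4
      exact h4.add_const _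
    have hvs : ‖w s o + e.sgn * (offEntry (r s) o * μ⁻¹) * w s j‖ ≤ 0 + ε * G * T s := by
      refine ge_of_tendsto hvlim ?_
      filter_upwards [eventually_ge_atTop s] with L hL
      have hT' := hT.const_mul (c := ε * G) (by positivity)
      refine (norm_le_duhamel hL (jostExp_re_nonneg hA hk o) hv hT'.cont
        (fun z hz => hbd z (hs.trans hz.1))).trans ?_
      refine add_le_add ?_ (hT'.le s L hL)
      refine mul_le_of_le_one_left (norm_nonneg _) ?_
      rw [Real.exp_le_one_iff]
      have := mul_nonneg (jostExp_re_nonneg hA hk o) (sub_nonneg.2 hL)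
      linarith
    have h6 : ‖e.sgn * (offEntry (r s) o * μ⁻¹) * w s j‖ ≤ R * ε * M := by
      simp only [norm_mul, norm_offEntry, hs1, one_mul]
      have := hrR s
      have h7 := (norm_le_pi_norm (w s) j).trans (hwM s hs)
      gcongr
    have h8 := norm_sub_le (w s o + e.sgn * (offEntry (r s) o * μ⁻¹) * w s j)
      (e.sgn * (offEntry (r s) o * μ⁻¹) * w s j)
    rw [add_sub_cancel_right] at h8
    have h9 : ε * G * T s ≤ ε * G * T y := by
      gcongr
      exact hTa hs
    calc ‖w s o‖ ≤ ε * G * T y + R * ε * M := by linarith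
      _ = H * ε := by rw [hH]; ring
  have hC : 0 ≤ (8 * M + H) * T y := by positivity
  intro i
  by_cases hij : i = j
  · subst hij
    obtain ⟨o, ho⟩ : ∃ o : Fin 2, o ≠ i := ⟨1 - i, by fin_cases i <;> simp⟩
    rw [Pi.single_eq_same]
    have hlim1 : Tendsto (fun L => ‖w L i - 1‖ + ε * (8 * M + H) * T y) atTop
        (𝓝 (0 + ε * (8 * M + H) * T y)) := by
      have := (hlim i).norm
      rw [Pi.single_eq_same, norm_zero] at this
      exact this.add_const _
    -- The j-th coordinate has exponent zero and is driven by r times the other coordinate, already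
    -- shown to be O(ε), plus the frame correction.
    have h1 : ‖w y i - 1‖ ≤ 0 + ε * (8 * M + H) * T y := by
      refine ge_of_tendsto hlim1 ?_
      filter_upwards [eventually_ge_atTop y] with L hL
      have hT' := hTr.const_mul (c := ε * (8 * M + H)) (by positivity)
      have h2 := norm_sub_le_integral (f := fun z => w z i) hL (fun z => hw z i) hT'.cont
        (fun z hz => by
          rw [jostExp_self, zero_mul, zero_add, norm_mul, hs1, one_mul]
          have n1 := hforce' z hz.1 ho.symm
          have n2 := norm_add_le (jostForce p e k (r z) (w z) i - offEntry (r z) i * w z o)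
            (offEntry (r z) i * w z o)
          rw [sub_add_cancel, norm_mul, norm_offEntry] at n2
          have n3 := mul_le_mul_of_nonneg_left (hoff o ho z hz.1) (norm_nonneg (r z))
          refine n2.trans ?_
          calc _ ≤ 8 * ε * ‖r z‖ * M + ‖r z‖ * (H * ε) := add_le_add n1 n3
            _ = _ := by ring)
      have h3 := hT'.le y L hL
      have h4 := norm_sub_le (w L i - 1) (w L i - w y i)
      rw [show w L i - 1 - (w L i - w y i) = w y i - 1 by ring] at h4
      linarith
    nlinarith [mul_nonneg hH0 hε]
  · rw [Pi.single_eq_of_ne hij, sub_zero]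
    have := hoff i hij y le_rfl
    nlinarith [mul_nonneg hC hε]

end

/-! ### Functions that are constant up to `O(1/k)` -/

/-- `f(k) = a + O(1/k)` along the filter `l`. -/
def NearConst (l : Filter ℂ) (f : ℂ → ℂ) (a : ℂ) : Prop :=
  (fun k => f k - a) =O[l] fun k => k⁻¹

lemma eventually_le_norm (N : ℝ) : ∀ᶠ k in Bornology.cobounded ℂ, N ≤ ‖k‖ :=
  tendsto_norm_cobounded_atTop.eventually_ge_atTop N

section

variable {l : Filter ℂ} {f g : ℂ → ℂ} {a b : ℂ}

lemma NearConst.const (a : ℂ) : NearConst l (fun _ => a) a := by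
  simpa [NearConst] using isBigO_zero _ _

lemma NearConst.add (hf : NearConst l f a) (hg : NearConst l g b) :
    NearConst l (fun k => f k + g k) (a + b) := by
  refine (IsBigO.add hf hg).congr_left fun k => ?_
  ring

lemma NearConst.sub (hf : NearConst l f a) (hg : NearConst l g b) :
    NearConst l (fun k => f k - g k) (a - b) := by
  refine (IsBigO.sub hf hg).congr_left fun k => ?_
  ring

lemma isBigO_inv_one (hl : l ≤ Bornology.cobounded ℂ) :
    (fun k : ℂ => k⁻¹) =O[l] fun _ => (1 : ℂ) := by
  refine IsBigO.of_bound 1 (hl ?_)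
  filter_upwards [eventually_le_norm 1] with k hk
  rw [norm_inv, norm_one, mul_one]
  exact inv_le_one_of_one_le₀ hk

lemma NearConst.mul (hl : l ≤ Bornology.cobounded ℂ) (hf : NearConst l f a)
    (hg : NearConst l g b) : NearConst l (fun k => f k * g k) (a * b) := by
  have h1 : (fun k => (f k - a) * (g k - b)) =O[l] fun k => k⁻¹ := by
    have := IsBigO.mul hf (hg.trans (isBigO_inv_one hl))
    simpa using this
  refine ((h1.add (hg.const_mul_left a)).add (hf.const_mul_left b)).congr_left fun k => ?_
  ring

lemma tendsto_inv_of_le (hl : l ≤ Bornology.cobounded ℂ) :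
    Tendsto (fun k : ℂ => k⁻¹) l (𝓝 0) :=
  (tendsto_inv₀_cobounded (α := ℂ)).mono_left hl

lemma NearConst.tendsto (hl : l ≤ Bornology.cobounded ℂ) (hf : NearConst l f a) :
    Tendsto f l (𝓝 a) := by
  have := (IsBigO.trans_tendsto hf (tendsto_inv_of_le hl)).add_const a
  simpa using this

lemma NearConst.congr' (hf : NearConst l f a) (h : f =ᶠ[l] g) : NearConst l g a :=
  IsBigO.congr' hf (h.mono fun k hk => by simp only [hk]) EventuallyEq.rfl

lemma NearConst.mono {l' : Filter ℂ} (hf : NearConst l f a) (h : l' ≤ l) : NearConst l' f a :=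
  IsBigO.mono hf h

lemma NearConst.of_bound {C : ℝ} (h : ∀ᶠ k in l, ‖f k - a‖ ≤ C / ‖k‖) : NearConst l f a := by
  refine IsBigO.of_bound C (h.mono fun k hk => ?_)
  rwa [norm_inv, ← div_eq_mul_inv]

lemma NearConst.inv (hl : l ≤ Bornology.cobounded ℂ) (hf : NearConst l f a) (ha : a ≠ 0) :
    NearConst l (fun k => (f k)⁻¹) a⁻¹ := by
  have h0 := hf.tendsto hl
  have h1 : (fun k => (f k)⁻¹ * a⁻¹) =O[l] fun _ => (1 : ℂ) :=
    ((h0.inv₀ ha).mul_const a⁻¹).isBigO_one ℂ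
  have h2 := (IsBigO.mul hf h1).neg_left
  simp only [mul_one] at h2
  refine h2.congr' ?_ EventuallyEq.rfl
  filter_upwards [h0.eventually_ne ha] with k hk
  field_simp
  ring

lemma NearConst.cexp (hl : l ≤ Bornology.cobounded ℂ) (hf : NearConst l f a) :
    NearConst l (fun k => exp (f k)) (exp a) := by
  have h0 : Tendsto (fun k => f k - a) l (𝓝 0) := by
    simpa using (hf.tendsto hl).sub_const a
  have h1 : (fun k => exp (f k - a) - 1) =O[l] fun k => f k - a := by
    refine IsBigO.of_bound 2 ?_
    filter_upwards [h0.norm.eventually (ge_mem_nhds (by rw [norm_zero]; exact one_pos))] with k hk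
    exact norm_exp_sub_one_le hk
  refine ((h1.trans hf).const_mul_left (exp a)).congr_left fun k => ?_
  rw [mul_sub, ← exp_add]
  ring_nf

end

/-! ### Asymptotics of the background quantities -/

section

variable {p : Params} {e : SpatialEnd}

lemma norm_le_of_mem_branchCut {k : ℂ} (h : k ∈ branchCut p e) :
    ‖k‖ ≤ |p.V| / 2 + p.amp e := by
  refine (norm_le_abs_re_add_abs_im k).trans (add_le_add ?_ h.2)
  rw [h.1, abs_neg, abs_div, abs_mul, e.abs_sgn, one_mul, abs_two]

lemma eventually_notMem_branchCut (p : Params) (e : SpatialEnd) :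
    ∀ᶠ k in Bornology.cobounded ℂ, k ∉ branchCut p e := by
  filter_upwards [eventually_le_norm (|p.V| / 2 + p.amp e + 1)] with k hk h
  have := norm_le_of_mem_branchCut h
  linarith

lemma norm_sub_le_norm_kShift (k : ℂ) : ‖k‖ - |p.V| / 2 ≤ ‖kShift p e k‖ := by
  have h := norm_sub_norm_le k (-((e.sgn * p.V / 2 : ℝ) : ℂ))
  rw [sub_neg_eq_add, norm_neg, norm_real, Real.norm_eq_abs, abs_div, abs_mul, e.abs_sgn, one_mul,
    abs_two] at h
  exact h

/-- For a large spectral parameter, the shifted parameter is of the same size. -/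
lemma eventually_norm_kShift (p : Params) (e : SpatialEnd) (N : ℝ) :
    ∀ᶠ k in Bornology.cobounded ℂ, 0 < ‖k‖ ∧ N ≤ ‖kShift p e k‖ ∧ ‖k‖ / 2 ≤ ‖kShift p e k‖ := by
  filter_upwards [eventually_le_norm (|p.V| / 2 + N), eventually_le_norm (|p.V| + 1)] with k h1 h2
  have := norm_sub_le_norm_kShift (p := p) (e := e) k
  have := abs_nonneg p.V
  refine ⟨by linarith, by linarith, by linarith⟩

variable (hA : p.AmpNonneg)
include hA

lemma nearConst_cEnd : NearConst (Bornology.cobounded ℂ) (cEnd p e) 0 := by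
  refine NearConst.of_bound (C := 2 * p.amp e) ?_
  filter_upwards [eventually_norm_kShift p e 0, eventually_notMem_branchCut p e] with k h1 hk
  rw [sub_zero]
  refine (norm_cEnd_le hA hk).trans ?_
  rw [div_le_div_iff₀ (by linarith [h1.1, h1.2.2]) h1.1]
  nlinarith [h1.2.2, hA e]

lemma nearConst_lamEnd_sub :
    NearConst (Bornology.cobounded ℂ) (fun k => lamEnd p e k - kShift p e k) 0 := by
  refine NearConst.of_bound (C := 2 * p.amp e ^ 2) ?_
  filter_upwards [eventually_norm_kShift p e 0, eventually_notMem_branchCut p e] with k h1 hk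
  rw [sub_zero]
  refine (norm_lamEnd_sub_kShift_le hA hk).trans ?_
  rw [div_le_div_iff₀ (by linarith [h1.1, h1.2.2]) h1.1]
  nlinarith [h1.2.2, sq_nonneg (p.amp e)]

lemma nearConst_inv_lamEnd_add :
    NearConst (Bornology.cobounded ℂ) (fun k => (lamEnd p e k + kShift p e k)⁻¹) 0 := by
  refine NearConst.of_bound (C := 2) ?_
  filter_upwards [eventually_norm_kShift p e 0, eventually_notMem_branchCut p e] with k h1 hk
  have h2 := norm_kShift_le hA hk
  rw [sub_zero, norm_inv, inv_eq_one_div, div_le_div_iff₀ (by linarith [h1.1, h1.2.2]) h1.1]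
  linarith [h1.2.2]

lemma nearConst_dEnd : NearConst (Bornology.cobounded ℂ) (dEnd p e) 1 := by
  refine NearConst.of_bound (C := 2 * p.amp e ^ 2) ?_
  filter_upwards [eventually_norm_kShift p e 1, eventually_notMem_branchCut p e] with k h1 hk
  refine (norm_dEnd_sub_one_le hA hk).trans ?_
  have h2 : ‖kShift p e k‖ ≤ ‖kShift p e k‖ ^ 2 := by nlinarith [h1.2.1]
  rw [div_le_div_iff₀ (by linarith [h1.1, h1.2.2]) h1.1]
  nlinarith [h1.2.2, sq_nonneg (p.amp e)]

lemma nearConst_detE : NearConst (Bornology.cobounded ℂ) (detE p e) 1 := by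
  have := (NearConst.const (l := Bornology.cobounded ℂ) 1).sub
    ((nearConst_cEnd (e := e) hA).mul le_rfl (nearConst_cEnd (e := e) hA))
  rw [mul_zero, sub_zero] at this
  refine this.congr' ?_
  filter_upwards [eventually_notMem_branchCut p e] with k hk
  rw [detE_eq hA hk, sq]

/-- From -2λκ = (λ - κ)² - 2κ² - A² and λ - κ = A²/(λ + κ), all growing powers of k cancel. The
constant left over is f_±, which compensates the factor e^{-if_± σ₃} of the Jost normalization. -/
lemma nearConst_thetaEnd_sub (x t : ℝ) : NearConst (Bornology.cobounded ℂ)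
    (fun k => thetaEnd p e x t k - thetaO x t k) (bgPhase p e x t) := by
  have h1 := nearConst_lamEnd_sub (e := e) hA
  have h2 := nearConst_inv_lamEnd_add (e := e) hA
  have h3 : NearConst (Bornology.cobounded ℂ)
      (fun k => (p.amp e : ℂ) ^ 2 * (lamEnd p e k + kShift p e k)⁻¹ *
        (-2 * (e.sgn * p.V) - (lamEnd p e k - kShift p e k))) 0 := by
    have := ((NearConst.const ((p.amp e : ℂ) ^ 2)).mul le_rfl h2).mul le_rfl
      ((NearConst.const (-2 * ((e.sgn : ℂ) * p.V))).sub h1)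
    simpa using this
  have h4 := ((NearConst.const (bgPhase p e x t : ℂ)).add (h1.mul le_rfl
    (NearConst.const (x : ℂ)))).sub (h3.mul le_rfl (NearConst.const (t : ℂ)))
  simp only [zero_mul, add_zero, sub_zero] at h4
  refine h4.congr' ?_
  filter_upwards [eventually_notMem_branchCut p e] with k hk
  have h5 := lamEnd_add_ne_zero hA hk
  have h6 := lamEnd_sq (p := p) (e := e) (k := k)
  have h7 : lamEnd p e k - kShift p e k =
      (p.amp e : ℂ) ^ 2 * (lamEnd p e k + kShift p e k)⁻¹ := by
    rw [← div_eq_mul_inv, eq_div_iff h5]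
    linear_combination h6
  have hs : ((e.sgn : ℂ)) * e.sgn = 1 := by exact_mod_cast e.sgn_sq
  rw [← h7, thetaEnd, thetaO, bgPhase]
  simp only [kShift] at h6 ⊢
  push_cast at h6 ⊢
  linear_combination (t : ℂ) * h6 - (p.V ^ 2 / 2 * t) * hs

/-- The exponent has modulus 2|λ|, and λ is within |κ|/4 of κ once |κ| ≥ 2A, with |κ| ≥ |k|/2 for
large k. -/
lemma eventually_jostExp {j i : Fin 2} (hij : i ≠ j) : ∀ᶠ k in Bornology.cobounded ℂ,
    jostExp p e j k i ≠ 0 ∧ ‖(jostExp p e j k i)⁻¹‖ ≤ 2 / ‖k‖ := by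
  filter_upwards [eventually_norm_kShift p e (2 * p.amp e), eventually_notMem_branchCut p e]
    with k h1 hk
  have hσ : ‖colSign i - colSign j‖ = 2 := by
    fin_cases i <;> fin_cases j <;> simp [colSign] at hij ⊢ <;> norm_num
  have hn : ‖jostExp p e j k i‖ = 2 * ‖lamEnd p e k‖ := by
    rw [jostExp, norm_mul, norm_mul, norm_mul, norm_I, hσ, norm_real, Real.norm_eq_abs, e.abs_sgn]
    ring
  have h2 := norm_lamEnd_sub_kShift_le hA hk
  have hκ : 0 < ‖kShift p e k‖ := by linarith [h1.1, h1.2.2]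
  have h3 : p.amp e ^ 2 / ‖kShift p e k‖ ≤ ‖kShift p e k‖ / 4 := by
    rw [div_le_div_iff₀ hκ (by norm_num)]
    nlinarith [h1.2.1, hA e]
  have h4 := norm_sub_norm_le (kShift p e k) (lamEnd p e k)
  rw [norm_sub_rev] at h4
  have h5 : ‖k‖ / 2 ≤ ‖jostExp p e j k i‖ := by rw [hn]; linarith [h1.2.2]
  have h6 : 0 < ‖jostExp p e j k i‖ := by linarith [h1.1]
  refine ⟨norm_pos_iff.1 h6, ?_⟩
  rw [norm_inv, inv_eq_one_div, div_le_div_iff₀ h6 h1.1]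
  linarith

end

/-! ### Asymptotics of the Jost solutions -/

section

variable {p : Params} {J : Set ℝ} {q : ℝ → ℝ → ℂ}

/-- The filter `k → ∞` within the closed half-plane where a Jost column is defined. -/
def jostFilter (e : SpatialEnd) (j : Fin 2) : Filter ℂ :=
  Bornology.cobounded ℂ ⊓ 𝓟 {k | 0 ≤ jostSign e j * k.im}

lemma jostFilter_le (e : SpatialEnd) (j : Fin 2) : jostFilter e j ≤ Bornology.cobounded ℂ :=
  inf_le_left

lemma eventually_mem_jostRegion (p : Params) (e : SpatialEnd) (j : Fin 2) :
    ∀ᶠ k in jostFilter e j, k ∈ jostRegion p e j :=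
  ((eventually_notMem_branchCut p e).filter_mono (jostFilter_le e j)).and
    (mem_inf_of_right (mem_principal_self _))

/-- A single ε of size 1/|k| dominates both c and the inverse exponents, which turns the estimate at
fixed k into an expansion at infinity. -/
lemma HasBackground.nearConst_jostCoord (hb : HasBackground J p q) (e : SpatialEnd) (j : Fin 2)
    (x : ℝ) {t : ℝ} (ht : t ∈ J) (i : Fin 2) : NearConst (jostFilter e j)
      (fun k => jostCoord p e j k x t (jost J p q e j x t k) i)
      ((Pi.single j 1 : Fin 2 → ℂ) i) := by
  have hA := hb.amp
  have hl := jostFilter_le e j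
  obtain ⟨C, hC⟩ := hb.exists_norm_jostPath_sub_le ht e j (e.sgn * x)
  obtain ⟨C1, hC1⟩ := (nearConst_cEnd (e := e) hA).bound
  refine NearConst.of_bound (C := C * (|C1| + 2)) ?_
  have hD := (((nearConst_detE (e := e) hA).inv le_rfl one_ne_zero).tendsto le_rfl).norm
  rw [inv_one, norm_one] at hD
  have hμ : ∀ᶠ k in Bornology.cobounded ℂ, ∀ i, i ≠ j →
      jostExp p e j k i ≠ 0 ∧ ‖(jostExp p e j k i)⁻¹‖ ≤ 2 / ‖k‖ := by
    rw [eventually_all]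
    intro i
    by_cases hij : i = j
    · exact Eventually.of_forall fun k h => absurd hij h
    · exact (eventually_jostExp hA hij).mono fun k hk _ => hk
  filter_upwards [eventually_mem_jostRegion p e j, hl hC1,
    hl (hD.eventually (ge_mem_nhds one_lt_two)), hl hμ, hl (eventually_norm_kShift p e 0)]
    with k h1 h2 h3 h4 h5
  have h0 : 0 ≤ 1 / ‖k‖ := by positivity
  have h6 := hC k h1 ((|C1| + 2) / ‖k‖) (by positivity) h3 (by
    rw [sub_zero, norm_inv] at h2
    refine h2.trans ?_
    rw [div_eq_mul_inv]
    gcongr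
    linarith [le_abs_self C1]) (fun i hi => ⟨(h4 i hi).1, (h4 i hi).2.trans (by
      gcongr
      linarith [abs_nonneg C1])⟩) i
  rw [jostPath, ← mul_assoc, e.sgn_sq, one_mul] at h6
  refine h6.trans (le_of_eq ?_)
  ring

/-- The Jost columns, normalized by the free exponential, tend to the columns of the identity. -/
theorem HasBackground.nearConst_jost (hb : HasBackground J p q) (e : SpatialEnd) (j : Fin 2)
    (x : ℝ) {t : ℝ} (ht : t ∈ J) (i : Fin 2) : NearConst (jostFilter e j)
      (fun k => exp (-(colSign j * (I * thetaO x t k))) * jost J p q e j x t k i)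
      ((1 : Mat2) i j) := by
  have hA := hb.amp
  have hl := jostFilter_le e j
  have hX : NearConst (jostFilter e j)
      (fun k => exp (colSign j * (I * (thetaEnd p e x t k - thetaO x t k))))
      (exp (colSign j * (I * bgPhase p e x t))) :=
    (((NearConst.const (colSign j)).mul le_rfl ((NearConst.const I).mul le_rfl
      (nearConst_thetaEnd_sub hA x t))).cexp le_rfl).mono hl
  have hd := ((nearConst_dEnd (e := e) hA).inv le_rfl one_ne_zero).mono hl
  rw [inv_one] at hd
  have hc := (nearConst_cEnd (e := e) hA).mono hl
  have hu := hb.nearConst_jostCoord e j x ht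
  have hsplit : ∀ k, exp (-(colSign j * (I * thetaO x t k))) =
      exp (colSign j * (I * (thetaEnd p e x t k - thetaO x t k))) *
        exp (-(colSign j * (I * thetaEnd p e x t k))) := fun k => by
    rw [← exp_add]; congr 1; ring
  have hff : exp (I * (bgPhase p e x t : ℂ)) * exp (-(I * (bgPhase p e x t : ℂ))) = 1 := by
    rw [← exp_add]; simp
  revert i
  rw [Fin.forall_fin_two]
  constructor
  · have h1 := hX.mul hl (hd.mul hl ((NearConst.const (exp (-(I * (bgPhase p e x t : ℂ))))).mul hl
      ((hu 0).add ((hc.mul hl (NearConst.const (epsEnd p e))).mul hl (hu 1)))))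
    -- In the limit c = 0 and d = 1, and the factor e^{±if} from θ_± - θ_o cancels the phase of the
    -- background, leaving the j-th unit vector.
    have e1 : exp (colSign j * (I * bgPhase p e x t)) * (1 * (exp (-(I * (bgPhase p e x t : ℂ))) *
        ((Pi.single j 1 : Fin 2 → ℂ) 0 + 0 * epsEnd p e * (Pi.single j 1 : Fin 2 → ℂ) 1))) =
        (1 : Mat2) 0 j := by
      fin_cases j
      · simpa [colSign, Matrix.one_apply] using hff
      · simp
    rw [e1] at h1
    refine h1.congr' ?_
    filter_upwards [eventually_mem_jostRegion p e j] with k hk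
    rw [hsplit, mul_assoc (exp (colSign j * (I * (thetaEnd p e x t k - thetaO x t k)))),
      (jostCoord_inv hA hk.1 j x t _).1]
  · have h1 := hX.mul hl (hd.mul hl ((NearConst.const (exp (I * (bgPhase p e x t : ℂ)))).mul hl
      ((hu 1).add ((hc.mul hl (NearConst.const (epsEnd p e)⁻¹)).mul hl (hu 0)))))
    have e1 : exp (colSign j * (I * bgPhase p e x t)) * (1 * (exp (I * (bgPhase p e x t : ℂ)) *
        ((Pi.single j 1 : Fin 2 → ℂ) 1 + 0 * (epsEnd p e)⁻¹ * (Pi.single j 1 : Fin 2 → ℂ) 0))) =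
        (1 : Mat2) 1 j := by
      fin_cases j
      · simp
      · simpa [colSign, Matrix.one_apply] using (mul_comm _ _).trans hff
    rw [e1] at h1
    refine h1.congr' ?_
    filter_upwards [eventually_mem_jostRegion p e j] with k hk
    rw [hsplit, mul_assoc (exp (colSign j * (I * (thetaEnd p e x t k - thetaO x t k)))),
      (jostCoord_inv hA hk.1 j x t _).2]

end

/-! ### Symmetry and determinants on the real line -/

section

variable {p : Params} {e : SpatialEnd} {J : Set ℝ} {q : ℝ → ℝ → ℂ} {k : ℂ}

lemma jostSign_eq : jostSign .plus 0 = 1 ∧ jostSign .plus 1 = -1 ∧ jostSign .minus 0 = -1 ∧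
    jostSign .minus 1 = 1 := by
  simp [jostSign, SpatialEnd.sgn]

lemma mem_jostRegion_of_real (hk : k ∉ branchCut p e) (hk0 : k.im = 0) (j : Fin 2) :
    k ∈ jostRegion p e j := ⟨hk, by rw [hk0, mul_zero]⟩

/-- The two columns carry opposite exponentials, and the factor d_±⁻² cancels det E_± = d_±²; so the
coordinate change preserves Wronskians. -/
lemma wr_jostCoord (hA : p.AmpNonneg) (hk : k ∉ branchCut p e) (x t : ℝ) (v w : Fin 2 → ℂ) :
    wr (jostCoord p e 0 k x t v) (jostCoord p e 1 k x t w) = wr v w := by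
  have hd := dEnd_ne_zero hA hk
  have hd2 : dEnd p e k ^ 2 = 1 - cEnd p e k ^ 2 := by rw [dEnd_sq, detE_eq hA hk]
  have hε := epsEnd_ne_zero (p := p) (e := e)
  have ha := exp_ne_zero (I * (bgPhase p e x t : ℂ))
  have hb := exp_ne_zero (I * thetaEnd p e x t k)
  simp only [wr, jostCoord, colSign, if_true, one_mul, Fin.isValue, one_ne_zero, if_false,
    neg_mul, neg_neg, exp_neg (I * (bgPhase p e x t : ℂ)), exp_neg (I * thetaEnd p e x t k),
    Matrix.cons_val_zero, Matrix.cons_val_one]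
  generalize exp (I * (bgPhase p e x t : ℂ)) = a at ha ⊢
  generalize exp (I * thetaEnd p e x t k) = b at hb ⊢
  field_simp
  rw [hd2]
  ring

/-- The Jost matrix has determinant one on the real line. -/
lemma HasBackground.wr_jost (hb : HasBackground J p q) (hk : k ∉ branchCut p e) (hk0 : k.im = 0) :
    wr (jost J p q e 0 0 0 k) (jost J p q e 1 0 0 k) = 1 := by
  have h0 := hb.isJostColumn (mem_jostRegion_of_real hk hk0 0)
  have h1 := hb.isJostColumn (mem_jostRegion_of_real hk hk0 1)
  have hJ0 := hb.dom.zero_mem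
  have l0 := (asymp_iff hb.amp hk 0 0 _).1 (h0.asymp 0 hJ0)
  have l1 := (asymp_iff hb.amp hk 1 0 _).1 (h1.asymp 0 hJ0)
  have l0' := fun i => (l0 i).add_const ((Pi.single 0 1 : Fin 2 → ℂ) i)
  have l1' := fun i => (l1 i).add_const ((Pi.single 1 1 : Fin 2 → ℂ) i)
  simp only [sub_add_cancel, zero_add] at l0' l1'
  have hl := ((l0' 0).mul (l1' 1)).sub ((l0' 1).mul (l1' 0))
  simp only [Pi.single_eq_same, Pi.single_eq_of_ne (one_ne_zero : (1 : Fin 2) ≠ 0), mul_one,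
    zero_mul, sub_zero] at hl
  refine tendsto_nhds_unique (tendsto_const_nhds.congr fun y => ?_) hl
  rw [← h0.lax.wr_eq hb.dom h1.lax (e.sgn * y) hJ0,
    ← wr_jostCoord hb.amp hk (e.sgn * y) 0]
  rfl

/-- The involution `v ↦ (-conj v₁, conj v₀)`. -/
def conjSwap (v : Fin 2 → ℂ) : Fin 2 → ℂ := ![-starRingEnd ℂ (v 1), starRingEnd ℂ (v 0)]

/-- The symmetry of the focusing potential: for real k the matrix X is anti-Hermitian and
trace-free, and the involution commutes with every such matrix. -/
lemma hasDerivAt_conjSwap (hk0 : k.im = 0) {v : ℝ → Fin 2 → ℂ} {x t : ℝ}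
    (hv : HasDerivAt v ((laxX q k x t).mulVec (v x)) x) :
    HasDerivAt (fun y => conjSwap (v y)) ((laxX q k x t).mulVec (conjSwap (v x))) x := by
  have hkc : starRingEnd ℂ k = k := conj_eq_iff_im.2 hk0
  rw [laxX_mulVec, hasDerivAt_pair] at hv
  rw [laxX_mulVec, hasDerivAt_pair]
  simp only [conjSwap, Matrix.cons_val_zero, Matrix.cons_val_one]
  constructor
  · refine (hasDerivAt_conj hv.2).neg.congr_deriv ?_
    simp only [map_sub, map_neg, map_mul, conj_I, conj_conj, hkc]
    ring
  · refine (hasDerivAt_conj hv.1).congr_deriv ?_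
    simp only [map_add, map_mul, conj_I, hkc]
    ring

lemma jostCoord_conjSwap (hA : p.AmpNonneg) (hk : k ∉ branchCut p e) (hk0 : k.im = 0) (x t : ℝ)
    (v : Fin 2 → ℂ) :
    jostCoord p e 1 k x t (conjSwap v) = conjSwap (jostCoord p e 0 k x t v) := by
  have hkc : starRingEnd ℂ k = k := conj_eq_iff_im.2 hk0
  have hd : starRingEnd ℂ (dEnd p e k) = dEnd p e k := by
    have := dEnd_conj hA hk
    rw [hkc] at this
    exact this.symm
  have hc : starRingEnd ℂ (cEnd p e k) = -cEnd p e k := by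
    have := cEnd_conj hA hk
    rw [hkc] at this
    rw [this, neg_neg, ← this]
  have hl : starRingEnd ℂ (lamEnd p e k) = lamEnd p e k := by
    have := lamEnd_conj hA hk
    rw [hkc] at this
    exact this.symm
  have hθ : starRingEnd ℂ (thetaEnd p e x t k) = thetaEnd p e x t k := by
    simp only [thetaEnd, map_mul, map_sub, conj_ofReal, hkc, hl, map_ofNat]
  have hE : starRingEnd ℂ (exp (-(I * thetaEnd p e x t k))) = exp (I * thetaEnd p e x t k) := by
    rw [← exp_conj, map_neg, map_mul, conj_I, hθ]; ring_nf
  have hf : starRingEnd ℂ (exp (I * (bgPhase p e x t : ℂ))) =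
      exp (-(I * (bgPhase p e x t : ℂ))) := by
    rw [← exp_conj, map_mul, conj_I, conj_ofReal]; ring_nf
  have hf' : starRingEnd ℂ (exp (-(I * (bgPhase p e x t : ℂ)))) =
      exp (I * (bgPhase p e x t : ℂ)) := by
    rw [← hf, conj_conj]
  have hε : starRingEnd ℂ (epsEnd p e) = (epsEnd p e)⁻¹ := conj_epsEnd
  ext i
  fin_cases i
  · simp [jostCoord, conjSwap, colSign, hd, hc, hE, hf, hf', hε]
    ring
  · simp [jostCoord, conjSwap, colSign, hd, hc, hE, hf, hf', hε]

/-- Symmetry of the Jost columns on the real line. -/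
lemma HasBackground.jost_one_eq (hb : HasBackground J p q) (hk : k ∉ branchCut p e)
    (hk0 : k.im = 0) : jost J p q e 1 0 0 k = conjSwap (jost J p q e 0 0 0 k) := by
  have h0 := hb.isJostColumn (mem_jostRegion_of_real hk hk0 0)
  have h1 := hb.isJostColumn (mem_jostRegion_of_real hk hk0 1)
  have hJ0 := hb.dom.zero_mem
  have l0 := (asymp_iff hb.amp hk 0 0 _).1 (h0.asymp 0 hJ0)
  obtain ⟨T, hT⟩ := HasTail.resid (p := p) (e := e) hb.nls hJ0 (hb.int 0 hJ0 e)
  refine jost_unique hb.amp (mem_jostRegion_of_real hk hk0 1) hT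
    (v := fun x => jost J p q e 1 x 0 k) (w := fun x => conjSwap (jost J p q e 0 x 0 k))
    (fun x => h1.lax.eq_x x 0 hJ0)
    (fun x => hasDerivAt_conjSwap hk0 (h0.lax.eq_x x 0 hJ0))
    ((asymp_iff hb.amp hk 1 0 _).1 (h1.asymp 0 hJ0)) (fun i => ?_) 0
  -- The involution intertwines the coordinates of the two columns, so it carries the asymptotics of
  -- the first to those of the second; uniqueness of Jost columns concludes.
  have hcs : ∀ y, jostPath p e 1 k 0 (fun x => conjSwap (jost J p q e 0 x 0 k)) y =
      conjSwap (jostPath p e 0 k 0 (fun x => jost J p q e 0 x 0 k) y) := fun y =>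
    jostCoord_conjSwap hb.amp hk hk0 _ _ _
  simp only [hcs]
  have conj0 : ∀ {f : ℝ → ℂ}, Tendsto f atTop (𝓝 0) →
      Tendsto (fun y => starRingEnd ℂ (f y)) atTop (𝓝 0) := by
    intro f hf
    simpa [Function.comp_def] using (continuous_conj.tendsto 0).comp hf
  revert i
  rw [Fin.forall_fin_two]
  constructor
  · have := (conj0 (l0 1)).neg
    rw [neg_zero] at this
    refine this.congr fun y => ?_
    simp [conjSwap]
  · refine (conj0 (l0 0)).congr fun y => ?_
    simp [conjSwap]

end

/-! ### The matrix `Φ` -/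

section

variable {p : Params} {J : Set ℝ} {q : ℝ → ℝ → ℂ} {k : ℂ}

/-- The expression of `Φ` in the upper half-plane. -/
def PhiUpper (J : Set ℝ) (p : Params) (q : ℝ → ℝ → ℂ) (x t : ℝ) (k : ℂ) : Mat2 :=
  ofCols (jost J p q .plus 0 x t k) ((s22 J p q k)⁻¹ • jost J p q .minus 1 x t k)

/-- The expression of `Φ` in the lower half-plane. -/
def PhiLower (J : Set ℝ) (p : Params) (q : ℝ → ℝ → ℂ) (x t : ℝ) (k : ℂ) : Mat2 :=
  ofCols ((s11 J p q k)⁻¹ • jost J p q .minus 0 x t k) (jost J p q .plus 1 x t k)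

lemma Phi_of_pos (h : 0 < k.im) (x t : ℝ) : Phi J p q x t k = PhiUpper J p q x t k := if_pos h

lemma Phi_of_nonpos (h : k.im ≤ 0) (x t : ℝ) : Phi J p q x t k = PhiLower J p q x t k :=
  if_neg (not_lt.2 h)

lemma mul_ofCols (M : Mat2) (v w : Fin 2 → ℂ) :
    M * ofCols v w = ofCols (M.mulVec v) (M.mulVec w) := by
  ext i j
  fin_cases i <;> fin_cases j <;>
    simp [ofCols, Matrix.mul_apply, Matrix.mulVec, dotProduct, Fin.sum_univ_two]

/-- The coefficient 1/s₂₂ does not depend on (x, t), so Φ is Ψ times its own value at the origin.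
This is the jump on the upper arc. -/
lemma HasBackground.PhiUpper_eq (hb : HasBackground J p q) (h1 : ∀ e, k ∉ branchCut p e)
    (h2 : 0 ≤ k.im) (x : ℝ) {t : ℝ} (ht : t ∈ J) :
    PhiUpper J p q x t k = Psi J q x t k * PhiUpper J p q 0 0 k := by
  rw [PhiUpper, PhiUpper, mul_ofCols, Matrix.mulVec_smul,
    hb.jost_eq (j := 0) ⟨h1 .plus, by rw [jostSign_eq.1]; linarith⟩ x ht,
    hb.jost_eq (j := 1) ⟨h1 .minus, by rw [jostSign_eq.2.2.2]; linarith⟩ x ht]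

lemma HasBackground.PhiLower_eq (hb : HasBackground J p q) (h1 : ∀ e, k ∉ branchCut p e)
    (h2 : k.im ≤ 0) (x : ℝ) {t : ℝ} (ht : t ∈ J) :
    PhiLower J p q x t k = Psi J q x t k * PhiLower J p q 0 0 k := by
  rw [PhiLower, PhiLower, mul_ofCols, Matrix.mulVec_smul,
    hb.jost_eq (j := 0) ⟨h1 .minus, by rw [jostSign_eq.2.2.1]; linarith⟩ x ht,
    hb.jost_eq (j := 1) ⟨h1 .plus, by rw [jostSign_eq.2.1]; linarith⟩ x ht]

/-- The second column pairs with the first to s₁₁, which the normalization divides out. It makes C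
invertible on the lower arc, where the jump is C⁻¹. -/
lemma det_PhiLower (h : s11 J p q k ≠ 0) : (PhiLower J p q 0 0 k).det = 1 := by
  rw [PhiLower, ofCols, Matrix.det_fin_two_of]
  simp only [Pi.smul_apply, smul_eq_mul]
  have : (s11 J p q k)⁻¹ * wr (jost J p q .minus 0 0 0 k) (jost J p q .plus 1 0 0 k) = 1 :=
    inv_mul_cancel₀ h
  rw [wr] at this
  linear_combination this

/-- In dimension two any three vectors are linearly dependent, with Wronskians as coefficients. This
expands the upper columns in the lower ones; the symmetry identifies the coefficients with ρ and its
conjugate. -/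
lemma HasBackground.Phi_jump_real (hb : HasBackground J p q) (hk : ∀ e, k ∉ branchCut p e)
    (hk0 : k.im = 0) (h11 : s11 J p q k ≠ 0) (h22 : s22 J p q k ≠ 0) :
    PhiUpper J p q 0 0 k = PhiLower J p q 0 0 k * jumpReal J p q k := by
  have wp := hb.wr_jost (hk .plus) hk0
  have wm := hb.wr_jost (hk .minus) hk0
  have sp := hb.jost_one_eq (hk .plus) hk0
  have sm := hb.jost_one_eq (hk .minus) hk0
  have hc11 : starRingEnd ℂ (s22 J p q k) = s11 J p q k := by
    rw [s11, s22, sp, sm]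
    simp only [wr, conjSwap, Matrix.cons_val_zero, Matrix.cons_val_one, map_sub, map_mul, map_neg,
      conj_conj]
    ring
  have hc12 : starRingEnd ℂ (s12 J p q k) =
      wr (jost J p q .minus 0 0 0 k) (jost J p q .plus 0 0 0 k) := by
    rw [s12, sp, sm]
    simp only [wr, conjSwap, Matrix.cons_val_zero, Matrix.cons_val_one, map_sub, map_mul, map_neg,
      conj_conj]
    ring
  have hρ : starRingEnd ℂ (rho J p q k) = starRingEnd ℂ (s12 J p q k) / s11 J p q k := by
    rw [rho, map_div₀, hc11]
  rw [jumpReal, hρ, hc12, rho, PhiUpper, PhiLower]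
  have e11 : s11 J p q k = wr (jost J p q .minus 0 0 0 k) (jost J p q .plus 1 0 0 k) := rfl
  have e12 : s12 J p q k = wr (jost J p q .minus 1 0 0 k) (jost J p q .plus 1 0 0 k) := rfl
  have e22 : s22 J p q k = wr (jost J p q .plus 0 0 0 k) (jost J p q .minus 1 0 0 k) := rfl
  generalize s11 J p q k = σ11 at *
  generalize s12 J p q k = σ12 at *
  generalize s22 J p q k = σ22 at *
  generalize jost J p q .plus 0 0 0 k = a at *
  generalize jost J p q .plus 1 0 0 k = b at *
  generalize jost J p q .minus 0 0 0 k = c at *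
  generalize jost J p q .minus 1 0 0 k = d at *
  have pl : ∀ u v w : Fin 2 → ℂ, ∀ i, u i * wr v w = v i * wr u w + w i * wr v u := by
    intro u v w i
    simp only [wr]
    fin_cases i <;> simp <;> ring
  -- The determinant of the scattering matrix, s₁₁s₂₂ + |s₁₂|² = 1, which follows from the
  -- unimodularity of both Jost matrices and produces the entry 1 + |ρ|².
  have key : σ11 * σ22 + σ12 * wr c a = 1 := by
    rw [e11, e12, e22]
    simp only [wr] at wp wm ⊢
    linear_combination (c 0 * d 1 - c 1 * d 0) * wp + wm
  have col1 : ∀ i, a i = σ11⁻¹ * c i * 1 + b i * (wr c a / σ11) := by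
    intro i
    have := pl a c b i
    rw [← e11, wp] at this
    field_simp
    linear_combination this
  have col2 : ∀ i, σ22⁻¹ * d i = σ11⁻¹ * c i * (σ12 / σ22) +
      b i * (1 + σ12 / σ22 * (wr c a / σ11)) := by
    intro i
    have := pl d c b i
    rw [← e11, ← e12, wm] at this
    field_simp
    linear_combination this - b i * key
  ext i j
  fin_cases i <;> fin_cases j <;>
    simp only [ofCols, Matrix.mul_apply, Fin.sum_univ_two, Pi.smul_apply, smul_eq_mul] <;> simp
  · simpa using col1 0
  · simpa using col2 0
  · simpa using col1 1
  · simpa using col2 1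

end

/-! ### The Riemann-Hilbert problem -/

section

variable {p : Params} {J : Set ℝ} {q : ℝ → ℝ → ℂ} {k : ℂ} {R : ℝ}

lemma mul_expSigma3_apply (M : Mat2) (z : ℂ) (i j : Fin 2) :
    (M * expSigma3 z) i j = M i j * exp (colSign j * z) := by
  fin_cases j <;> simp [expSigma3, Matrix.mul_apply, Fin.sum_univ_two, colSign]

lemma expSigma3_neg_mul (z : ℂ) : expSigma3 (-z) * expSigma3 z = 1 := by
  ext i j
  rw [mul_expSigma3_apply]
  fin_cases i <;> fin_cases j <;> simp [expSigma3, colSign, ← exp_add]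

lemma continuous_thetaO (x t : ℝ) : Continuous fun k => thetaO x t k := by
  unfold thetaO; fun_prop

lemma differentiable_thetaO (x t : ℝ) : Differentiable ℂ fun k => thetaO x t k := by
  unfold thetaO; fun_prop

lemma continuous_expSigma3_thetaO (x t : ℝ) :
    Continuous fun k => expSigma3 (-(I * thetaO x t k)) := by
  have := continuous_thetaO x t
  unfold expSigma3
  refine continuous_matrix fun i j => ?_
  fin_cases i <;> fin_cases j <;> simp <;> fun_prop

lemma continuous_ofCols :
    Continuous fun z : (Fin 2 → ℂ) × (Fin 2 → ℂ) => ofCols z.1 z.2 := by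
  unfold ofCols
  refine continuous_matrix fun i j => ?_
  fin_cases i <;> fin_cases j <;> simp <;> fun_prop

lemma notMem_branchCut (h : ∀ e, branchCut p e ⊆ Metric.ball 0 R) (hk : R ≤ ‖k‖) (e : SpatialEnd) :
    k ∉ branchCut p e := fun hm => by
  have := mem_ball_zero_iff.1 (h e hm)
  linarith

/-- The part of the closed upper half-plane outside the ball of radius `R`. -/
def upperOutside (R : ℝ) : Set ℂ := {k | 0 ≤ k.im ∧ R ≤ ‖k‖}

/-- The part of the closed lower half-plane outside the ball of radius `R`. -/
def lowerOutside (R : ℝ) : Set ℂ := {k | k.im ≤ 0 ∧ R ≤ ‖k‖}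

lemma upperOutside_subset (h : ∀ e, branchCut p e ⊆ Metric.ball 0 R) :
    upperOutside R ⊆ jostRegion p .plus 0 ∩ jostRegion p .minus 1 := fun k hk =>
  ⟨⟨notMem_branchCut h hk.2 _, by rw [jostSign_eq.1]; linarith [hk.1]⟩,
    ⟨notMem_branchCut h hk.2 _, by rw [jostSign_eq.2.2.2]; linarith [hk.1]⟩⟩

lemma lowerOutside_subset (h : ∀ e, branchCut p e ⊆ Metric.ball 0 R) :
    lowerOutside R ⊆ jostRegion p .minus 0 ∩ jostRegion p .plus 1 := fun k hk =>
  ⟨⟨notMem_branchCut h hk.2 _, by rw [jostSign_eq.2.2.1]; linarith [hk.1]⟩,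
    ⟨notMem_branchCut h hk.2 _, by rw [jostSign_eq.2.1]; linarith [hk.1]⟩⟩

lemma continuousOn_wr {v w : ℂ → Fin 2 → ℂ} {S : Set ℂ} (hv : ContinuousOn v S)
    (hw : ContinuousOn w S) : ContinuousOn (fun k => wr (v k) (w k)) S := by
  rw [continuousOn_pi] at hv hw
  exact ((hv 0).mul (hw 1)).sub ((hv 1).mul (hw 0))

lemma differentiableOn_wr {v w : ℂ → Fin 2 → ℂ} {S : Set ℂ} (hv : DifferentiableOn ℂ v S)
    (hw : DifferentiableOn ℂ w S) : DifferentiableOn ℂ (fun k => wr (v k) (w k)) S := by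
  rw [differentiableOn_pi] at hv hw
  exact ((hv 0).mul (hw 1)).sub ((hv 1).mul (hw 0))

lemma HasBackground.continuousOn_PhiUpper (hb : HasBackground J p q)
    (hR : IsAdmissibleRadius J p q R) (x : ℝ) {t : ℝ} (ht : t ∈ J) :
    ContinuousOn (PhiUpper J p q x t) (upperOutside R) := by
  have hs := upperOutside_subset hR.cuts
  have c := fun (x : ℝ) {t : ℝ} (ht : t ∈ J) =>
    (hb.continuousOn_jost .plus 0 x ht).mono (hs.trans Set.inter_subset_left)
  have c' := fun (x : ℝ) {t : ℝ} (ht : t ∈ J) =>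
    (hb.continuousOn_jost .minus 1 x ht).mono (hs.trans Set.inter_subset_right)
  have hw := continuousOn_wr (c 0 hb.dom.zero_mem) (c' 0 hb.dom.zero_mem)
  exact continuous_ofCols.comp_continuousOn ((c x ht).prodMk
    ((hw.inv₀ fun k hk => hR.zeros22 k hk.1 hk.2).smul (c' x ht)))

lemma HasBackground.continuousOn_PhiLower (hb : HasBackground J p q)
    (hR : IsAdmissibleRadius J p q R) (x : ℝ) {t : ℝ} (ht : t ∈ J) :
    ContinuousOn (PhiLower J p q x t) (lowerOutside R) := by
  have hs := lowerOutside_subset hR.cuts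
  have c := fun (x : ℝ) {t : ℝ} (ht : t ∈ J) =>
    (hb.continuousOn_jost .minus 0 x ht).mono (hs.trans Set.inter_subset_left)
  have c' := fun (x : ℝ) {t : ℝ} (ht : t ∈ J) =>
    (hb.continuousOn_jost .plus 1 x ht).mono (hs.trans Set.inter_subset_right)
  have hw := continuousOn_wr (c 0 hb.dom.zero_mem) (c' 0 hb.dom.zero_mem)
  exact continuous_ofCols.comp_continuousOn
    (((hw.inv₀ fun k hk => hR.zeros11 k hk.1 hk.2).smul (c x ht)).prodMk (c' x ht))

lemma differentiableOn_ofCols {v w : ℂ → Fin 2 → ℂ} {S : Set ℂ} (hv : DifferentiableOn ℂ v S)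
    (hw : DifferentiableOn ℂ w S) (i j : Fin 2) :
    DifferentiableOn ℂ (fun k => ofCols (v k) (w k) i j) S := by
  rw [differentiableOn_pi] at hv hw
  fin_cases i <;> fin_cases j <;> simp [ofCols]
  · exact hv 0
  · exact hw 0
  · exact hv 1
  · exact hw 1

lemma HasBackground.differentiableOn_PhiUpper (hb : HasBackground J p q)
    (hR : IsAdmissibleRadius J p q R) (x : ℝ) {t : ℝ} (ht : t ∈ J) (i j : Fin 2) :
    DifferentiableOn ℂ (fun k => PhiUpper J p q x t k i j) {k | 0 < k.im ∧ R < ‖k‖} := by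
  have c := fun (x : ℝ) {t : ℝ} (ht : t ∈ J) =>
    (hb.differentiableOn_jost .plus 0 x ht).mono (s := {k | 0 < k.im ∧ R < ‖k‖}) fun k hk =>
      ⟨notMem_branchCut hR.cuts hk.2.le _, by rw [jostSign_eq.1]; linarith [hk.1]⟩
  have c' := fun (x : ℝ) {t : ℝ} (ht : t ∈ J) =>
    (hb.differentiableOn_jost .minus 1 x ht).mono (s := {k | 0 < k.im ∧ R < ‖k‖}) fun k hk =>
      ⟨notMem_branchCut hR.cuts hk.2.le _, by rw [jostSign_eq.2.2.2]; linarith [hk.1]⟩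
  have hw := differentiableOn_wr (c 0 hb.dom.zero_mem) (c' 0 hb.dom.zero_mem)
  exact differentiableOn_ofCols (c x ht)
    ((hw.inv fun k hk => hR.zeros22 k hk.1.le hk.2.le).smul (c' x ht)) i j

lemma HasBackground.differentiableOn_PhiLower (hb : HasBackground J p q)
    (hR : IsAdmissibleRadius J p q R) (x : ℝ) {t : ℝ} (ht : t ∈ J) (i j : Fin 2) :
    DifferentiableOn ℂ (fun k => PhiLower J p q x t k i j) {k | k.im < 0 ∧ R < ‖k‖} := by
  have c := fun (x : ℝ) {t : ℝ} (ht : t ∈ J) =>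
    (hb.differentiableOn_jost .minus 0 x ht).mono (s := {k | k.im < 0 ∧ R < ‖k‖}) fun k hk =>
      ⟨notMem_branchCut hR.cuts hk.2.le _, by rw [jostSign_eq.2.2.1]; linarith [hk.1]⟩
  have c' := fun (x : ℝ) {t : ℝ} (ht : t ∈ J) =>
    (hb.differentiableOn_jost .plus 1 x ht).mono (s := {k | k.im < 0 ∧ R < ‖k‖}) fun k hk =>
      ⟨notMem_branchCut hR.cuts hk.2.le _, by rw [jostSign_eq.2.1]; linarith [hk.1]⟩
  have hw := differentiableOn_wr (c 0 hb.dom.zero_mem) (c' 0 hb.dom.zero_mem)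
  exact differentiableOn_ofCols
    ((hw.inv fun k hk => hR.zeros11 k hk.1.le hk.2.le).smul (c x ht)) (c' x ht) i j

/-! ### Asymptotics and admissible radii -/

/-- The filter `k → ∞` in the closed upper half-plane. -/
def upperFilter : Filter ℂ := Bornology.cobounded ℂ ⊓ 𝓟 {k | 0 ≤ k.im}

/-- The filter `k → ∞` in the closed lower half-plane. -/
def lowerFilter : Filter ℂ := Bornology.cobounded ℂ ⊓ 𝓟 {k | k.im ≤ 0}

lemma jostFilter_eq : jostFilter .plus 0 = upperFilter ∧ jostFilter .minus 1 = upperFilter ∧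
    jostFilter .minus 0 = lowerFilter ∧ jostFilter .plus 1 = lowerFilter := by
  obtain ⟨h1, h2, h3, h4⟩ := jostSign_eq
  simp only [jostFilter, upperFilter, lowerFilter, h1, h2, h3, h4, one_mul, neg_mul,
    Left.nonneg_neg_iff, and_self]

lemma HasBackground.nearConst_jost_zero (hb : HasBackground J p q) (e : SpatialEnd) (j i : Fin 2) :
    NearConst (jostFilter e j) (fun k => jost J p q e j 0 0 k i) ((1 : Mat2) i j) := by
  have := hb.nearConst_jost e j 0 hb.dom.zero_mem i
  simpa [thetaO] using this

/-- At the origin θ_o = 0, so the columns themselves tend to those of the identity and their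
Wronskian tends to 1. All zeros therefore lie in a bounded set. -/
lemma HasBackground.nearConst_s22 (hb : HasBackground J p q) :
    NearConst upperFilter (s22 J p q) 1 := by
  have h1 := hb.nearConst_jost_zero .plus 0
  have h2 := hb.nearConst_jost_zero .minus 1
  rw [jostFilter_eq.1] at h1
  rw [jostFilter_eq.2.1] at h2
  have hl : upperFilter ≤ Bornology.cobounded ℂ := inf_le_left
  have h := ((h1 0).mul hl (h2 1)).sub ((h1 1).mul hl (h2 0))
  rw [show (1 : Mat2) 0 0 * (1 : Mat2) 1 1 - (1 : Mat2) 1 0 * (1 : Mat2) 0 1 = 1 by simp] at h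
  exact h

lemma HasBackground.nearConst_s11 (hb : HasBackground J p q) :
    NearConst lowerFilter (s11 J p q) 1 := by
  have h1 := hb.nearConst_jost_zero .minus 0
  have h2 := hb.nearConst_jost_zero .plus 1
  rw [jostFilter_eq.2.2.1] at h1
  rw [jostFilter_eq.2.2.2] at h2
  have hl : lowerFilter ≤ Bornology.cobounded ℂ := inf_le_left
  have h := ((h1 0).mul hl (h2 1)).sub ((h1 1).mul hl (h2 0))
  rw [show (1 : Mat2) 0 0 * (1 : Mat2) 1 1 - (1 : Mat2) 1 0 * (1 : Mat2) 0 1 = 1 by simp] at h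
  exact h

/-- Admissible radii exist. -/
theorem HasBackground.exists_isAdmissibleRadius (hb : HasBackground J p q) :
    ∃ R, IsAdmissibleRadius J p q R := by
  have h22 := (hb.nearConst_s22.tendsto inf_le_left).eventually_ne one_ne_zero
  have h11 := (hb.nearConst_s11.tendsto inf_le_left).eventually_ne one_ne_zero
  replace h22 := eventually_inf_principal.1 h22
  replace h11 := eventually_inf_principal.1 h11
  obtain ⟨R, -, hR⟩ := (hasBasis_cobounded_norm (E := ℂ)).eventually_iff.1 (h22.and h11)
  have hle : ∀ e, p.amp e ≤ |p.ampPlus| + |p.ampMinus| := by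
    intro e
    have h1 := le_abs_self p.ampPlus
    have h2 := le_abs_self p.ampMinus
    have h3 := abs_nonneg p.ampPlus
    have h4 := abs_nonneg p.ampMinus
    cases e
    · change p.ampPlus ≤ _; linarith
    · change p.ampMinus ≤ _; linarith
  refine ⟨max R (|p.V| / 2 + (|p.ampPlus| + |p.ampMinus|) + 1),
    lt_max_of_lt_right (by positivity), fun e k hk => ?_, fun k hk hkR => ?_, fun k hk hkR => ?_⟩
  · rw [mem_ball_zero_iff]
    refine lt_max_of_lt_right ?_
    have := norm_le_of_mem_branchCut hk
    linarith [hle e]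
  · exact (hR ((le_max_left _ _).trans hkR)).1 hk
  · exact (hR ((le_max_left _ _).trans hkR)).2 hk

lemma HasBackground.nearConst_PhiUpper (hb : HasBackground J p q) (x : ℝ) {t : ℝ} (ht : t ∈ J)
    (i j : Fin 2) : NearConst upperFilter
      (fun k => PhiUpper J p q x t k i j * exp (colSign j * -(I * thetaO x t k)))
      ((1 : Mat2) i j) := by
  have hl : upperFilter ≤ Bornology.cobounded ℂ := inf_le_left
  fin_cases j
  · have h1 := hb.nearConst_jost .plus 0 x ht i
    rw [jostFilter_eq.1] at h1
    refine h1.congr' (Eventually.of_forall fun k => ?_)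
    beta_reduce
    rw [← mul_neg]
    fin_cases i <;> exact mul_comm _ _
  · have h1 := hb.nearConst_jost .minus 1 x ht i
    rw [jostFilter_eq.2.1] at h1
    have h2 := (hb.nearConst_s22.inv hl one_ne_zero).mul hl h1
    rw [inv_one, one_mul] at h2
    refine h2.congr' (Eventually.of_forall fun k => ?_)
    fin_cases i <;> simp [PhiUpper, ofCols] <;> ring

lemma HasBackground.nearConst_PhiLower (hb : HasBackground J p q) (x : ℝ) {t : ℝ} (ht : t ∈ J)
    (i j : Fin 2) : NearConst lowerFilter
      (fun k => PhiLower J p q x t k i j * exp (colSign j * -(I * thetaO x t k)))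
      ((1 : Mat2) i j) := by
  have hl : lowerFilter ≤ Bornology.cobounded ℂ := inf_le_left
  fin_cases j
  · have h1 := hb.nearConst_jost .minus 0 x ht i
    rw [jostFilter_eq.2.2.1] at h1
    have h2 := (hb.nearConst_s11.inv hl one_ne_zero).mul hl h1
    rw [inv_one, one_mul] at h2
    refine h2.congr' (Eventually.of_forall fun k => ?_)
    fin_cases i <;> simp [PhiLower, ofCols] <;> ring
  · have h1 := hb.nearConst_jost .plus 1 x ht i
    rw [jostFilter_eq.2.2.2] at h1
    refine h1.congr' (Eventually.of_forall fun k => ?_)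
    beta_reduce
    rw [← mul_neg]
    fin_cases i <;> exact mul_comm _ _

/-! ### Solution of the Riemann-Hilbert problem -/

lemma Mtilde_of_lt {x t : ℝ} (h : ‖k‖ < R) :
    Mtilde J p q R x t k = Psi J q x t k * expSigma3 (-(I * thetaO x t k)) := if_pos h

lemma Mtilde_of_pos {x t : ℝ} (h : R ≤ ‖k‖) (h0 : 0 < k.im) :
    Mtilde J p q R x t k = PhiUpper J p q x t k * expSigma3 (-(I * thetaO x t k)) := by
  rw [Mtilde, if_neg (not_lt.2 h), Phi_of_pos h0]

lemma Mtilde_of_nonpos {x t : ℝ} (h : R ≤ ‖k‖) (h0 : k.im ≤ 0) :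
    Mtilde J p q R x t k = PhiLower J p q x t k * expSigma3 (-(I * thetaO x t k)) := by
  rw [Mtilde, if_neg (not_lt.2 h), Phi_of_nonpos h0]

lemma eq_or_eq_neg_of_im_eq_zero (hk : k.im = 0) (hn : ‖k‖ = R) : k = (R : ℂ) ∨ k = -(R : ℂ) := by
  have h1 : k = (k.re : ℂ) := Complex.ext rfl (by simpa using hk)
  rw [h1, norm_real, Real.norm_eq_abs] at hn
  rcases abs_choice k.re with h | h
  · left; rw [h1, ← hn, h]
  · right; rw [h1, ← hn, h]; simp

/-- The limit is expressed by `PhiUpper`, which is continuous up to the real axis, because `Phi` at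
real k is by definition the lower expression. -/
lemma HasBackground.tendsto_upper (hb : HasBackground J p q) (hR : IsAdmissibleRadius J p q R)
    (x : ℝ) {t : ℝ} (ht : t ∈ J) (hk : k ∈ upperOutside R) {S : Set ℂ}
    (hS : ∀ᶠ z in 𝓝[S] k, 0 < z.im ∧ R ≤ ‖z‖) : Tendsto (Mtilde J p q R x t) (𝓝[S] k)
      (𝓝 (PhiUpper J p q x t k * expSigma3 (-(I * thetaO x t k)))) := by
  have h1 := ((hb.continuousOn_PhiUpper hR x ht).mul
    (continuous_expSigma3_thetaO x t).continuousOn) k hk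
  have h2 : Tendsto id (𝓝[S] k) (𝓝[upperOutside R] k) :=
    tendsto_nhdsWithin_iff.2 ⟨tendsto_id.mono_left nhdsWithin_le_nhds,
      hS.mono fun z hz => ⟨hz.1.le, hz.2⟩⟩
  refine (Tendsto.comp h1 h2).congr' ?_
  filter_upwards [hS] with z hz
  exact (Mtilde_of_pos hz.2 hz.1).symm

lemma HasBackground.tendsto_lower (hb : HasBackground J p q) (hR : IsAdmissibleRadius J p q R)
    (x : ℝ) {t : ℝ} (ht : t ∈ J) (hk : k ∈ lowerOutside R) {S : Set ℂ}
    (hS : ∀ᶠ z in 𝓝[S] k, z.im < 0 ∧ R ≤ ‖z‖) : Tendsto (Mtilde J p q R x t) (𝓝[S] k)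
      (𝓝 (PhiLower J p q x t k * expSigma3 (-(I * thetaO x t k)))) := by
  have h1 := ((hb.continuousOn_PhiLower hR x ht).mul
    (continuous_expSigma3_thetaO x t).continuousOn) k hk
  have h2 : Tendsto id (𝓝[S] k) (𝓝[lowerOutside R] k) :=
    tendsto_nhdsWithin_iff.2 ⟨tendsto_id.mono_left nhdsWithin_le_nhds,
      hS.mono fun z hz => ⟨hz.1.le, hz.2⟩⟩
  refine (Tendsto.comp h1 h2).congr' ?_
  filter_upwards [hS] with z hz
  exact (Mtilde_of_nonpos hz.2 hz.1.le).symm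

lemma HasBackground.tendsto_inside (hb : HasBackground J p q) (x : ℝ) {t : ℝ} (ht : t ∈ J) :
    Tendsto (Mtilde J p q R x t) (𝓝[{z | ‖z‖ < R}] k)
      (𝓝 (Psi J q x t k * expSigma3 (-(I * thetaO x t k)))) := by
  have h1 : Continuous fun k => Psi J q x t k := continuous_matrix fun i j =>
    (differentiable_Psi hb.dom hb.nls x ht i j).continuous
  have h2 := ((h1.mul (continuous_expSigma3_thetaO x t)).tendsto k).mono_left
    (nhdsWithin_le_nhds (s := {z | ‖z‖ < R}))
  refine h2.congr' ?_
  filter_upwards [self_mem_nhdsWithin] with z hz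
  exact (Mtilde_of_lt hz).symm

/-- The outer factors e^{∓iθ_o σ₃} of jump and solution cancel, and Φ = ΨC reduces the claim to x =
t = 0. On the lower arc the interior is on the left, so the same relation is read backwards and
yields C⁻¹. -/
lemma HasBackground.jump (hb : HasBackground J p q) (hR : IsAdmissibleRadius J p q R)
    (x : ℝ) {t : ℝ} (ht : t ∈ J) (hk : k ∈ contour R) (h1 : k ≠ (R : ℂ)) (h2 : k ≠ -(R : ℂ)) :
    ∃ Mp Mm : Mat2, Tendsto (Mtilde J p q R x t) (𝓝[leftSide R k] k) (𝓝 Mp) ∧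
      Tendsto (Mtilde J p q R x t) (𝓝[rightSide R k] k) (𝓝 Mm) ∧
        Mp = Mm * jumpTilde J p q R x t k := by
  have cancel : ∀ M N : Mat2, M * expSigma3 (-(I * thetaO x t k)) *
      (expSigma3 (I * thetaO x t k) * N * expSigma3 (-(I * thetaO x t k))) =
        M * N * expSigma3 (-(I * thetaO x t k)) := by
    intro M N
    rw [← mul_assoc, ← mul_assoc, mul_assoc M, expSigma3_neg_mul, mul_one]
  have evpos : 0 < k.im → ∀ S : Set ℂ, ∀ᶠ z in 𝓝[S] k, 0 < z.im := fun h S =>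
    nhdsWithin_le_nhds (continuous_im.continuousAt.eventually (lt_mem_nhds h))
  have evneg : k.im < 0 → ∀ S : Set ℂ, ∀ᶠ z in 𝓝[S] k, z.im < 0 := fun h S =>
    nhdsWithin_le_nhds (continuous_im.continuousAt.eventually (gt_mem_nhds h))
  by_cases hn : ‖k‖ = R
  · have hcut := notMem_branchCut hR.cuts hn.ge
    rcases lt_trichotomy k.im 0 with h0 | h0 | h0
    · refine ⟨Psi J q x t k * expSigma3 (-(I * thetaO x t k)),
        PhiLower J p q x t k * expSigma3 (-(I * thetaO x t k)), ?_, ?_, ?_⟩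
      · rw [leftSide, if_pos hn, if_neg (not_lt.2 h0.le)]
        exact hb.tendsto_inside x ht
      · rw [rightSide, if_pos hn, if_neg (not_lt.2 h0.le)]
        exact hb.tendsto_lower hR x ht ⟨h0.le, hn.ge⟩ ((evneg h0 _).and
          (eventually_nhdsWithin_of_forall fun z hz => le_of_lt hz))
      · rw [jumpTilde, cancel, jumpCore, if_pos hn, if_neg (not_lt.2 h0.le),
          Phi_of_nonpos h0.le, hb.PhiLower_eq hcut h0.le x ht, mul_assoc (Psi J q x t k),
          Matrix.mul_nonsing_inv _ (by
            rw [det_PhiLower (hR.zeros11 k h0.le hn.ge)]; exact isUnit_one), mul_one]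
    · exact ((eq_or_eq_neg_of_im_eq_zero h0 hn).elim h1 h2).elim
    · refine ⟨PhiUpper J p q x t k * expSigma3 (-(I * thetaO x t k)),
        Psi J q x t k * expSigma3 (-(I * thetaO x t k)), ?_, ?_, ?_⟩
      · rw [leftSide, if_pos hn, if_pos h0]
        exact hb.tendsto_upper hR x ht ⟨h0.le, hn.ge⟩ ((evpos h0 _).and
          (eventually_nhdsWithin_of_forall fun z hz => le_of_lt hz))
      · rw [rightSide, if_pos hn, if_pos h0]
        exact hb.tendsto_inside x ht
      · rw [jumpTilde, cancel, jumpCore, if_pos hn, if_pos h0, Phi_of_pos h0,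
          hb.PhiUpper_eq hcut h0.le x ht]
  · obtain ⟨h0, hre⟩ : k.im = 0 ∧ R < |k.re| := hk.resolve_left hn
    have hnR : R < ‖k‖ := hre.trans_le (abs_re_le_norm k)
    have hcut := notMem_branchCut hR.cuts hnR.le
    have evR : ∀ S : Set ℂ, ∀ᶠ z in 𝓝[S] k, R ≤ ‖z‖ := fun S =>
      nhdsWithin_le_nhds ((continuous_norm.continuousAt.eventually (lt_mem_nhds hnR)).mono
        fun z hz => le_of_lt hz)
    refine ⟨PhiUpper J p q x t k * expSigma3 (-(I * thetaO x t k)),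
      PhiLower J p q x t k * expSigma3 (-(I * thetaO x t k)), ?_, ?_, ?_⟩
    · rw [leftSide, if_neg hn]
      exact hb.tendsto_upper hR x ht ⟨h0.ge, hnR.le⟩
        (Eventually.and (eventually_nhdsWithin_of_forall fun z hz => hz) (evR _))
    · rw [rightSide, if_neg hn]
      exact hb.tendsto_lower hR x ht ⟨h0.le, hnR.le⟩
        (Eventually.and (eventually_nhdsWithin_of_forall fun z hz => hz) (evR _))
    · rw [jumpTilde, cancel, jumpCore, if_neg hn, hb.PhiUpper_eq hcut h0.ge x ht,
        hb.PhiLower_eq hcut h0.le x ht, hb.Phi_jump_real hcut h0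
          (hR.zeros11 k h0.le hnR.le) (hR.zeros22 k h0.ge hnR.le)]
      simp only [mul_assoc]

lemma HasBackground.analytic (hb : HasBackground J p q) (hR : IsAdmissibleRadius J p q R)
    (x : ℝ) {t : ℝ} (ht : t ∈ J) (i j : Fin 2) :
    AnalyticOnNhd ℂ (fun k => Mtilde J p q R x t k i j) (contour R)ᶜ := by
  intro k hk
  have key : ∀ {F : ℂ → Mat2} {U : Set ℂ}, IsOpen U → k ∈ U →
      DifferentiableOn ℂ (fun z => F z i j) U →
      (∀ z ∈ U, Mtilde J p q R x t z = F z * expSigma3 (-(I * thetaO x t z))) →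
      AnalyticAt ℂ (fun z => Mtilde J p q R x t z i j) k := by
    intro F U hU hkU hF hM
    have h1 : DifferentiableOn ℂ (fun z => F z i j * exp (colSign j * -(I * thetaO x t z))) U :=
      hF.mul ((((differentiable_thetaO x t).const_mul I).neg.const_mul
        (colSign j)).cexp.differentiableOn)
    refine (h1.congr fun z hz => ?_).analyticAt (hU.mem_nhds hkU)
    rw [hM z hz, mul_expSigma3_apply]
  have hout : IsOpen {z : ℂ | R < ‖z‖} := isOpen_lt continuous_const continuous_norm
  rcases lt_trichotomy ‖k‖ R with h | h | h
  · exact key (F := fun z => Psi J q x t z) (isOpen_lt continuous_norm continuous_const) h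
      (differentiable_Psi hb.dom hb.nls x ht i j).differentiableOn fun z hz => Mtilde_of_lt hz
  · exact absurd (Or.inl h) hk
  · rcases lt_trichotomy k.im 0 with h0 | h0 | h0
    · exact key ((isOpen_lt continuous_im continuous_const).inter hout) ⟨h0, h⟩
        (hb.differentiableOn_PhiLower hR x ht i j)
        fun z hz => Mtilde_of_nonpos (le_of_lt hz.2) (le_of_lt hz.1)
    · refine absurd (Or.inr ⟨h0, ?_⟩) hk
      have h1 : k = (k.re : ℂ) := Complex.ext rfl (by simpa using h0)
      rw [h1, norm_real, Real.norm_eq_abs] at h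
      simpa using h
    · exact key ((isOpen_lt continuous_const continuous_im).inter hout) ⟨h0, h⟩
        (hb.differentiableOn_PhiUpper hR x ht i j)
        fun z hz => Mtilde_of_pos (le_of_lt hz.2) hz.1

lemma HasBackground.normalization (hb : HasBackground J p q) (x : ℝ) {t : ℝ} (ht : t ∈ J)
    (i j : Fin 2) : (fun k => Mtilde J p q R x t k i j - (1 : Mat2) i j)
      =O[Bornology.cobounded ℂ ⊓ 𝓟 (contour R)ᶜ] (fun k => k⁻¹) := by
  set lu : Filter ℂ := Bornology.cobounded ℂ ⊓ 𝓟 {k | 0 < k.im} with hlu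
  set ll : Filter ℂ := Bornology.cobounded ℂ ⊓ 𝓟 {k | k.im < 0} with hll
  have hu : NearConst lu (fun k => Mtilde J p q R x t k i j) ((1 : Mat2) i j) := by
    refine ((hb.nearConst_PhiUpper x ht i j).mono (inf_le_inf_left _ (principal_mono.2
      fun k hk => le_of_lt (show 0 < k.im from hk)))).congr' ?_
    filter_upwards [(eventually_le_norm R).filter_mono inf_le_left,
      mem_inf_of_right (mem_principal_self _)] with k h1 h2
    rw [Mtilde_of_pos h1 h2, mul_expSigma3_apply]
  have hl : NearConst ll (fun k => Mtilde J p q R x t k i j) ((1 : Mat2) i j) := by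
    refine ((hb.nearConst_PhiLower x ht i j).mono (inf_le_inf_left _ (principal_mono.2
      fun k hk => le_of_lt (show k.im < 0 from hk)))).congr' ?_
    filter_upwards [(eventually_le_norm R).filter_mono inf_le_left,
      mem_inf_of_right (mem_principal_self _)] with k h1 h2
    rw [Mtilde_of_nonpos h1 (le_of_lt h2), mul_expSigma3_apply]
  refine (IsBigO.sup hu hl).mono ?_
  rw [hlu, hll, ← inf_sup_left, sup_principal]
  refine le_inf inf_le_left (le_principal_iff.2 ?_)
  -- A real k with |k| ≥ R + 1 satisfies R < |k| strictly and so lies on the contour; off the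
  -- contour and near infinity, k is therefore in one of the open half-planes.
  filter_upwards [(eventually_le_norm (R + 1)).filter_mono inf_le_left,
    mem_inf_of_right (mem_principal_self _)] with k h1 h2
  by_contra hk
  simp only [Set.mem_union, Set.mem_ofPred_eq, not_or, not_lt] at hk
  have h0 : k.im = 0 := le_antisymm hk.1 hk.2
  refine h2 (Or.inr ⟨h0, ?_⟩)
  have h3 : k = (k.re : ℂ) := Complex.ext rfl (by simpa using h0)
  rw [h3, norm_real, Real.norm_eq_abs] at h1
  linarith

end

end NLSIST

end

/-! ### The modified Riemann–Hilbert problem: conclusion -/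

theorem theoremt (J : Set ℝ) (hJ : J = Set.Ici 0 ∨ J = Set.univ)
    (p : NLSIST.Params) (hp : 0 ≤ p.ampPlus) (hm : 0 ≤ p.ampMinus)
    (q : ℝ → ℝ → ℂ) (hq : NLSIST.IsClassicalNLS J q)
    (hbdd : ∃ B : ℝ, ∀ x : ℝ, ∀ t ∈ J, ‖q x t‖ ≤ B)
    (hL1 : ∀ t ∈ J, ∀ e : NLSIST.SpatialEnd,
      MeasureTheory.IntegrableOn (fun x : ℝ => q x t - NLSIST.bgWave p e x t)
        e.halfLine MeasureTheory.volume)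
    (hL1x : ∀ t ∈ J, ∀ e : NLSIST.SpatialEnd,
      MeasureTheory.IntegrableOn
        (NLSIST.dX (fun y s => q y s - NLSIST.bgWave p e y s) · t)
        e.halfLine MeasureTheory.volume) :
    (∃ R : ℝ, NLSIST.IsAdmissibleRadius J p q R) ∧
      ∀ R : ℝ, NLSIST.IsAdmissibleRadius J p q R → ∀ x : ℝ, ∀ t ∈ J,
        NLSIST.SolvesModifiedRHP R (NLSIST.jumpTilde J p q R x t)
          (NLSIST.Mtilde J p q R x t) := by
  have hb : NLSIST.HasBackground J p q :=
    ⟨fun e => by cases e; exacts [hp, hm], hJ, hq, hbdd, hL1, hL1x⟩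
  exact ⟨hb.exists_isAdmissibleRadius, fun R hR x t ht =>
    ⟨hb.analytic hR x ht, fun k hk h1 h2 => hb.jump hR x ht hk h1 h2, hb.normalization x ht⟩⟩
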